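/- Let $K$ be a number field with an embedding $K\subseteq\mathbb{C}$, let $N\ge 1$ and $d\ge 2$ be integers, and let $F=(F_0,\dots,F_N)$ be homogeneous forms of degree $d$ in $\mathbf{X}=(X_0,\dots,X_N)$ with coefficients in $K(s)$ and with no common zero in $\mathbb{P}^N$ over an algebraic closure of $K(s)$, so that $F$ is a lift of an endomorphism of $\mathbb{P}^N$ over $K(s)$. Let $\Phi\ne 0$ be a homogeneous form in $\mathbf{X}$ with coefficients in $K(s)$ (for instance, in $K[s]$). For a field $k$ of characteristic zero, a lift $F$ over $k$ of an endomorphism of $\mathbb{P}^N$ and a form $\Phi$ over $k$, let $F_*\Phi\in k[\mathbf{X}]$ be the form $$F_*\Phi(\mathbf{X})=\prod_{F(\mathbf{Y})=\mathbf{X}}\Phi(\mathbf{Y}),$$ where $\mathbf{Y}$ runs over the solutions of $F(\mathbf{Y})=\mathbf{X}$ in an algebraic closure of $k(\mathbf{X})$. If $|\cdot|$ is an absolute value on $k$, let $\|\Phi\|$ be the largest absolute value of a coefficient of $\Phi$, and define the escape rate $$G_F(\Phi)=\lim_{j\to\infty}\frac{\log\|F_*^j\Phi\|}{d^{j(N+1)}}.$$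 For $t\in\mathbb{C}$ which is not a pole of a coefficient, let $F_t,\Phi_t$ be the specializations at $s=t$. Let $G_F(\Phi)$ be the escape rate over $k=K(s)$ with respect to $|r|_\infty=e^{-\operatorname{ord}_{s=\infty}(r)}$, and let $G_{F_t}(\Phi_t)$ be the escape rate over $k=\mathbb{C}$ with respect to the usual absolute value. Then the limit defining $G_F(\Phi)$ exists, the limit defining $G_{F_t}(\Phi_t)$ exists for all $t\in\mathbb{C}$ with $|t|$ sufficiently large, and, with $\log^+=\max\{\log,0\}$, $$G_{F_t}(\Phi_t)=G_F(\Phi)\log^+|t|+O\left((\log^+|t|)^{(3N+3)/(3N+4)}\right)\qquad\text{as } |t|\to\infty,$$ where the implied constant may depend on $F$, $\Phi$, $N$ and $d$ but not on $t$. -/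

import Mathlib

open Filter Topology

noncomputable section

namespace EscapeRate

/-- The sup norm of the coefficients of a polynomial, with respect to an absolute value `v`. The
supremum runs over finitely many nonzero values, so it is a maximum. -/
def coeffNorm {k : Type*} [Field k] (v : AbsoluteValue k ℝ) {n : ℕ}
    (Φ : MvPolynomial (Fin n) k) : ℝ :=
  ⨆ m : Fin n →₀ ℕ, v (Φ.coeff m)

/-- `F = (F₀, …, F_N)` is a lift of an endomorphism of `ℙ^N` of degree `d` over the field `k`:
each `F i` is a form of degree `d`, and `F` has no nontrivial common zero over an algebraic
closure of `k`. -/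
def IsLift {k : Type*} [Field k] {N : ℕ} (d : ℕ)
    (F : Fin (N + 1) → MvPolynomial (Fin (N + 1)) k) : Prop :=
  (∀ i, (F i).IsHomogeneous d) ∧
    ∀ y : Fin (N + 1) → AlgebraicClosure k, (∀ i, MvPolynomial.aeval y (F i) = 0) → y = 0

/-- An algebraic closure of the field `k(X₀, …, X_N)`. -/
abbrev GenericClosure (k : Type*) [Field k] (N : ℕ) : Type _ :=
  AlgebraicClosure (FractionRing (MvPolynomial (Fin (N + 1)) k))

/-- The inclusion of `k[X₀, …, X_N]` into the algebraic closure of its fraction field. -/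
def toGenericClosure (k : Type*) [Field k] (N : ℕ) :
    MvPolynomial (Fin (N + 1)) k →+* GenericClosure k N :=
  (algebraMap (FractionRing (MvPolynomial (Fin (N + 1)) k)) (GenericClosure k N)).comp
    (algebraMap (MvPolynomial (Fin (N + 1)) k) (FractionRing (MvPolynomial (Fin (N + 1)) k)))

/-- The solutions `Y` of `F(Y) = X`, where `X = (X₀, …, X_N)` is the generic point. When `F` is a
lift of an endomorphism and `k` has characteristic zero there are `d ^ (N + 1)` of them, all
simple. -/
def genericFibre {k : Type*} [Field k] {N : ℕ}
    (F : Fin (N + 1) → MvPolynomial (Fin (N + 1)) k) : Set (Fin (N + 1) → GenericClosure k N) :=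
  {Y | ∀ i, MvPolynomial.aeval Y (F i) = toGenericClosure k N (MvPolynomial.X i)}

/-- The product `∏_{F(Y) = X} Φ(Y)`. -/
def fibreProd {k : Type*} [Field k] {N : ℕ}
    (F : Fin (N + 1) → MvPolynomial (Fin (N + 1)) k) (Φ : MvPolynomial (Fin (N + 1)) k) :
    GenericClosure k N :=
  ∏ᶠ Y ∈ genericFibre F, MvPolynomial.aeval Y Φ

open Classical in
/-- The pushforward `F_*Φ`: the unique polynomial in `X` that equals `∏_{F(Y) = X} Φ(Y)`. For a
lift `F` of an endomorphism in characteristic zero it always exists; the value `0` is a default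
for other `F`. -/
def pushforward {k : Type*} [Field k] {N : ℕ}
    (F : Fin (N + 1) → MvPolynomial (Fin (N + 1)) k) (Φ : MvPolynomial (Fin (N + 1)) k) :
    MvPolynomial (Fin (N + 1)) k :=
  if h : ∃ P : MvPolynomial (Fin (N + 1)) k, toGenericClosure k N P = fibreProd F Φ
  then h.choose else 0

/-- The sequence `log ‖F_*^j Φ‖ / d ^ (j (N + 1))`, whose limit is the escape rate. -/
def escapeSeq {k : Type*} [Field k] (v : AbsoluteValue k ℝ) {N : ℕ} (d : ℕ)
    (F : Fin (N + 1) → MvPolynomial (Fin (N + 1)) k) (Φ : MvPolynomial (Fin (N + 1)) k)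
    (j : ℕ) : ℝ :=
  Real.log (coeffNorm v ((pushforward F)^[j] Φ)) / (d : ℝ) ^ (j * (N + 1))

/-- The escape rate `G_F(Φ) = lim_j log ‖F_*^j Φ‖ / d ^ (j (N + 1))`. -/
def escapeRate {k : Type*} [Field k] (v : AbsoluteValue k ℝ) {N : ℕ} (d : ℕ)
    (F : Fin (N + 1) → MvPolynomial (Fin (N + 1)) k) (Φ : MvPolynomial (Fin (N + 1)) k) : ℝ :=
  limUnder atTop (escapeSeq v d F Φ)

open Classical in
/-- The absolute value `|r|_∞ = e ^ (-ord_∞ r)` on `K(s)`; here `-ord_∞ r` is the degree of the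
numerator of `r` minus the degree of its denominator. -/
def absInfty (K : Type*) [Field K] : AbsoluteValue (RatFunc K) ℝ where
  toFun r := if r = 0 then 0 else Real.exp (r.intDegree : ℝ)
  map_mul' x y := by
    by_cases hx : x = 0
    · simp [hx]
    by_cases hy : y = 0
    · simp [hy]
    simp [hx, hy, RatFunc.intDegree_mul hx hy, Real.exp_add]
  nonneg' x := by
    split_ifs
    · exact le_rfl
    · exact (Real.exp_pos _).le
  eq_zero' x := by
    split_ifs with h
    · simp [h]
    · simp [h, Real.exp_ne_zero]
  add_le' x y := by
    by_cases hx : x = 0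
    · simp [hx]
    by_cases hy : y = 0
    · simp [hy]
    by_cases hxy : x + y = 0
    · simp only [hxy, hx, hy, if_true, if_false]
      positivity
    simp only [hxy, hx, hy, if_false]
    have h := RatFunc.intDegree_add_le hy hxy
    rcases le_max_iff.mp h with h | h
    · have : Real.exp ((x + y).intDegree : ℝ) ≤ Real.exp (x.intDegree : ℝ) :=
        Real.exp_le_exp.mpr (by exact_mod_cast h)
      linarith [Real.exp_pos (y.intDegree : ℝ)]
    · have : Real.exp ((x + y).intDegree : ℝ) ≤ Real.exp (y.intDegree : ℝ) :=
        Real.exp_le_exp.mpr (by exact_mod_cast h)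
      linarith [Real.exp_pos (x.intDegree : ℝ)]

/-- The value at `s = t` of a rational function `r` in `K(s)`, where `K` is embedded in `ℂ` by `σ`.
It is meaningful for every `t` that is not a pole of `r`. -/
def evalAt {K : Type*} [Field K] (σ : K →+* ℂ) (t : ℂ) (r : RatFunc K) : ℂ :=
  r.num.eval₂ σ t / r.denom.eval₂ σ t

/-- The specialization at `s = t` of a polynomial with coefficients in `K(s)`. It is meaningful for
every `t` that is not a pole of a coefficient, so for all but finitely many `t`. -/
def specialize {K : Type*} [Field K] (σ : K →+* ℂ) (t : ℂ) {n : ℕ}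
    (Φ : MvPolynomial (Fin n) (RatFunc K)) : MvPolynomial (Fin n) ℂ :=
  ∑ m ∈ Φ.support, MvPolynomial.monomial m (evalAt σ t (Φ.coeff m))

/-- The usual absolute value on `ℂ`. -/
def absComplex : AbsoluteValue ℂ ℝ := NormedField.toAbsoluteValue ℂ

end EscapeRate

end

/-! Write L = log|t|, δ = d^(N+1), a_j(t) = log‖F_*^j Φ_t‖ and b_j = log‖F_*^j Φ‖_∞, and let D be
the number of points of the generic fibre of F. The proof rests on two estimates and one choice of
j.

Distortion of one step (`exists_abs_log_coeffNorm_sub_le`, `IsLift.exists_eventually_iterate`). A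
value of F_*Ψ is a product of D values of Ψ, and a polynomial of degree e is much smaller than its
largest coefficient only on a set of small volume. Hence log‖F_*Ψ_t‖ differs from D log‖Ψ_t‖ by
O((e+1)(L + log(e+1))). The degree of F_*^j Φ is O(d^(Nj)), so |a_{j+1} - D a_j| ≤ C L (δ/√d)^j;
letting t tend to infinity gives the same for b_j without the factor L. Since D ≤ δ, both a_j/δ^j
and b_j/δ^j converge, and if D = δ the errors are O(L d^(-j/2)) and O(d^(-j/2)). Only the inequality
D ≤ δ is proved (`IsLift.ncard_genericFibre_le`); if D < δ, both limits are zero and there is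
nothing to compare.

Comparison of the early iterates (`IsLift.exists_eventually_abs_log_sub_mul_le`). There is C
independent of j with |a_j - b_j L| ≤ C δ^j whenever L ≥ C δ^j. For a single j this is the growth of
rational functions; uniformity in j is arithmetic. For some E_j = O(δ^j) the form R^(E_j) F_*^j Φ
has coefficients in 𝓞_K[s]. Under every embedding of K the recursion bounds it by exp(B δ^j) on one
fixed circle, so Cauchy's estimate bounds all conjugates of its coefficients. A nonzero algebraic
integer has norm at least 1, so the leading coefficient in s has size at least exp(-O(δ^j)).

Conclusion (`abs_sub_mul_le_rpow`). Choosing j with C δ^j ≤ L < C δ^(j+1) makes the total error O(L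
d^(-j/2)) + O(1) = O(L^(1 - 1/(2N+2))), and this exponent is below the required one.

Underneath lies the fact that F_*Φ is a polynomial and commutes with specialization
(`IsRegularLift.pushforward_map`). By the Nullstellensatz, F makes k[X] integral over k[F]; the
product over the fibre is Galois invariant and integral, hence lies in A[X] when A is integrally
closed. A homomorphism out of the ring of integral elements carries the generic fibre to the
specialized one, and over a generic point it does so bijectively because the Jacobian of F does not
vanish there. -/

noncomputable section

namespace EscapeRate

open MvPolynomial

/-! ### Integrality of fibre coordinates -/

section Integrality

variable {σ A T : Type*} [Fintype σ] [CommRing A] [CommRing T]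

/-- A relation `R yᵢ ^ m = ∑ₗ G_{il}(y) xₗ` with `G_{il}` homogeneous of degree less than `m`
makes `R yᵢ` integral over `A[x]`. -/
theorem isIntegralElem_of_pow_relation [IsDomain T] (j : A →+* T) (y x : σ → T) (R : A) {m d : ℕ}
    (hd : 1 ≤ d) (hdm : d ≤ m) (G : σ → σ → MvPolynomial σ A)
    (hG : ∀ i l, (G i l).IsHomogeneous (m - d))
    (h : ∀ i, j R * y i ^ m = ∑ l, (G i l).eval₂ j y * x l) (i : σ) :
    (eval₂Hom j x).IsIntegralElem (j R * y i) := by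
  classical
  let := (eval₂Hom j x).toAlgebra
  have halg : ∀ p : MvPolynomial σ A, algebraMap (MvPolynomial σ A) T p = eval₂ j x p :=
    fun p => rfl
  set M := Fintype.card σ * m + 1 with hM
  set mon : (σ →₀ ℕ) → T := fun β => β.prod fun i k => y i ^ k with hmon
  have mon_add : ∀ α β, mon (α + β) = mon α * mon β := fun α β =>
    Finsupp.prod_add_index' (by simp) (by intros; rw [pow_add])
  have mon_single : ∀ i k, mon (Finsupp.single i k) = y i ^ k := fun i k => by
    simp only [hmon]
    exact Finsupp.prod_single_index (pow_zero _)
  set V : Submodule (MvPolynomial σ A) T :=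
    Submodule.span _ (mon '' {β | Finsupp.degree β ≤ M - 1}) with hV
  have hmem : ∀ β, Finsupp.degree β ≤ M - 1 → mon β ∈ V := fun β hβ =>
    Submodule.subset_span ⟨β, hβ, rfl⟩
  have hsm : ∀ (a : A) v, v ∈ V → j a * v ∈ V := fun a v hv => by
    have : j a * v = (C a : MvPolynomial σ A) • v := by
      rw [Algebra.smul_def, halg, eval₂_C]
    rw [this]
    exact V.smul_mem _ hv
  have hsx : ∀ l v, v ∈ V → v * x l ∈ V := fun l v hv => by
    have : v * x l = (X l : MvPolynomial σ A) • v := by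
      rw [Algebra.smul_def, halg, eval₂_X, mul_comm]
    rw [this]
    exact V.smul_mem _ hv
  -- Cayley–Hamilton: an element of a domain that preserves a nonzero finitely generated submodule
  -- is integral.
  have key : IsIntegral (MvPolynomial σ A) (j R * y i) := by
    refine isIntegral_of_smul_mem_submodule (M := T) V ?_ ?_ _ ?_
    · intro h0
      have h1 : mon 0 ∈ V := hmem 0 (by simp)
      rw [h0] at h1
      simp [hmon] at h1
    · exact Submodule.fg_span ((Finsupp.finite_of_degree_le _).image _)
    · intro v hv
      induction hv using Submodule.span_induction with
      | zero => simp
      | add u v _ _ hu hv => rw [smul_add]; exact V.add_mem hu hv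
      | smul a v _ hv =>
        rw [smul_comm]
        exact V.smul_mem _ hv
      | mem v hv =>
        obtain ⟨β, hβ, rfl⟩ := hv
        change Finsupp.degree β ≤ M - 1 at hβ
        have e1 : (j R * y i) • mon β = j R * mon (β + Finsupp.single i 1) := by
          rw [mon_add, mon_single, smul_eq_mul]; ring
        rw [e1]
        have hdeg : Finsupp.degree (β + Finsupp.single i 1) = Finsupp.degree β + 1 := by
          simp
        by_cases hlt : Finsupp.degree β + 1 ≤ M - 1
        · exact hsm _ _ (hmem _ (by rw [hdeg]; exact hlt))
        set γ := β + Finsupp.single i 1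
        have hγ : Finsupp.degree γ = M := by rw [hdeg]; omega
        obtain ⟨l, hl⟩ : ∃ l, m ≤ γ l := by
          by_contra! hcon
          have : Finsupp.degree γ ≤ Fintype.card σ * m := by
            rw [Finsupp.degree_eq_sum]
            calc ∑ i, γ i ≤ ∑ _i : σ, m := Finset.sum_le_sum fun i _ => (hcon i).le
              _ = _ := by simp
          omega
        obtain ⟨α, hα⟩ : ∃ α, γ = α + Finsupp.single l m :=
          ⟨γ - Finsupp.single l m, (tsub_add_cancel_of_le (by
            rw [Finsupp.single_le_iff]; exact hl)).symm⟩
        have hαd : Finsupp.degree α + m = M := by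
          rw [← hγ, hα]; simp
        rw [hα, mon_add, mon_single]
        have e2 : j R * (mon α * y l ^ m) = ∑ l', (mon α * (G l l').eval₂ j y) * x l' := by
          rw [mul_left_comm, h l, Finset.mul_sum]
          exact Finset.sum_congr rfl fun _ _ => by ring
        rw [e2]
        refine V.sum_mem fun l' _ => hsx _ _ ?_
        rw [eval₂_eq, Finset.mul_sum]
        refine V.sum_mem fun b hb => ?_
        have hbd : Finsupp.degree b = m - d := by
          by_contra hne
          exact (mem_support_iff.mp hb) ((hG l l').coeff_eq_zero hne)
        have e3 : mon α * (j (coeff b (G l l')) * ∏ i ∈ b.support, y i ^ b i)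
            = j (coeff b (G l l')) * mon (α + b) := by
          rw [mon_add]
          simp only [hmon, Finsupp.prod]
          ring
        rw [e3]
        refine hsm _ _ (hmem _ ?_)
        rw [map_add, hbd]
        omega
  exact key

end Integrality

/-! ### The Nullstellensatz in homogeneous form, with and without denominators -/

section Nullstellensatz

theorem homogeneousComponent_mul_of_isHomogeneous {σ R : Type*} [CommSemiring R]
    (p : MvPolynomial σ R) {q : MvPolynomial σ R} {m d : ℕ} (hq : q.IsHomogeneous d)
    (hdm : d ≤ m) :
    homogeneousComponent m (p * q) = homogeneousComponent (m - d) p * q := by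
  have key : ∀ i, homogeneousComponent m (homogeneousComponent i p * q)
      = if i = m - d then homogeneousComponent i p * q else 0 := fun i => by
    rw [homogeneousComponent_of_mem (n := i + d) ((mem_homogeneousSubmodule _ _).mpr
      ((homogeneousComponent_isHomogeneous i p).mul hq))]
    congr 1
    exact propext (by omega)
  conv_lhs => rw [← sum_homogeneousComponent p, Finset.sum_mul, map_sum]
  rw [Finset.sum_congr rfl fun i _ => key i, Finset.sum_ite_eq']
  split_ifs with h
  · rfl
  · rw [homogeneousComponent_eq_zero _ _ (by rw [Finset.mem_range] at h; omega), zero_mul]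

variable {k : Type*} [Field k] {N d : ℕ}

/-- Nullstellensatz: for a lift `F`, some power of each variable is a combination of the `F l`
with homogeneous coefficients. -/
theorem IsLift.exists_pow_relation {F : Fin (N + 1) → MvPolynomial (Fin (N + 1)) k}
    (hF : IsLift d F) : ∃ m, d ≤ m ∧ ∃ G : Fin (N + 1) → Fin (N + 1) →
      MvPolynomial (Fin (N + 1)) k, (∀ i l, (G i l).IsHomogeneous (m - d)) ∧
      ∀ i, (X i : MvPolynomial (Fin (N + 1)) k) ^ m = ∑ l, G i l * F l := by
  classical
  obtain ⟨hhom, hzero⟩ := hF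
  set I := Ideal.span (Set.range F)
  have hrad : ∀ i, (X i : MvPolynomial (Fin (N + 1)) k) ∈ I.radical := fun i => by
    rw [← vanishingIdeal_zeroLocus_eq_radical (K := AlgebraicClosure k), mem_vanishingIdeal_iff]
    intro y hy
    have : y = 0 := hzero y fun l => hy _ (Ideal.subset_span ⟨l, rfl⟩)
    simp [this]
  choose e he using hrad
  -- One exponent that serves every variable; the summand d makes the truncated subtraction m - d a
  -- true one.
  set m := d + ∑ i, e i with hm
  have hmem : ∀ i, (X i : MvPolynomial (Fin (N + 1)) k) ^ m ∈ I := fun i =>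
    Ideal.pow_mem_of_pow_mem I (he i)
      (le_add_left (Finset.single_le_sum (fun _ _ => Nat.zero_le _) (Finset.mem_univ i)))
  choose G hG using fun i => Ideal.mem_span_range_iff_exists_fun.mp (hmem i)
  have hdm' : d ≤ m := by omega
  -- Since F_l is homogeneous of degree d, the degree m part of the relation only sees the degree m
  -- - d part of the coefficients.
  refine ⟨m, hdm', fun i l => homogeneousComponent (m - d) (G i l),
    fun i l => homogeneousComponent_isHomogeneous _ _, fun i => ?_⟩
  have h1 : (X i : MvPolynomial (Fin (N + 1)) k) ^ m = homogeneousComponent m (X i ^ m) := by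
    rw [homogeneousComponent_of_mem (m := m) (n := m)
      ((mem_homogeneousSubmodule _ _).mpr (isHomogeneous_X_pow i m)), if_pos rfl]
  rw [h1, ← hG i, map_sum]
  refine Finset.sum_congr rfl fun l _ => ?_
  exact homogeneousComponent_mul_of_isHomogeneous _ (hhom l) hdm'

variable {A : Type*} [CommRing A] [IsDomain A] [Algebra A k] [IsFractionRing A k]

/-- Clearing the denominators of a finite family of polynomials. -/
theorem exists_common_denom {σ ι : Type*} [Finite ι] (G : ι → MvPolynomial σ k) :
    ∃ R : A, R ≠ 0 ∧ ∃ G' : ι → MvPolynomial σ A,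
      ∀ i, map (algebraMap A k) (G' i) = C (algebraMap A k R) * G i := by
  classical
  have := Fintype.ofFinite ι
  obtain ⟨b, hb⟩ := IsLocalization.exist_integer_multiples_of_finset (nonZeroDivisors A)
    (Finset.univ.biUnion fun i => (G i).support.image fun m => coeff m (G i))
  refine ⟨b, nonZeroDivisors.ne_zero b.2, ?_⟩
  have key : ∀ i, ∃ P : MvPolynomial σ A, map (algebraMap A k) P = C (algebraMap A k b) * G i := by
    intro i
    have : (C (algebraMap A k b) * G i) ∈ (map (σ := σ) (algebraMap A k)).range := by
      rw [(G i).as_sum, Finset.mul_sum]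
      refine Subring.sum_mem _ fun m hm => ?_
      obtain ⟨a, ha⟩ := hb (coeff m (G i)) (by
        simp only [Finset.mem_biUnion, Finset.mem_univ, true_and, Finset.mem_image]
        exact ⟨i, m, hm, rfl⟩)
      refine ⟨monomial m a, ?_⟩
      rw [map_monomial, ha, C_mul_monomial, Algebra.smul_def]
    exact this
  choose G' hG' using key
  exact ⟨G', hG'⟩

/-- The relation of the Nullstellensatz with denominators cleared. -/
theorem IsLift.exists_pow_relation_integral
    {F : Fin (N + 1) → MvPolynomial (Fin (N + 1)) k} (hF : IsLift d F) :
    ∃ m, d ≤ m ∧ ∃ R : A, R ≠ 0 ∧ ∃ G : Fin (N + 1) → Fin (N + 1) →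
      MvPolynomial (Fin (N + 1)) A, (∀ i l, (G i l).IsHomogeneous (m - d)) ∧
      ∀ i, C (algebraMap A k R) * (X i : MvPolynomial (Fin (N + 1)) k) ^ m
        = ∑ l, map (algebraMap A k) (G i l) * F l := by
  obtain ⟨m, hdm, G, hG, h⟩ := hF.exists_pow_relation
  obtain ⟨R, hR, G', hG'⟩ := exists_common_denom (A := A)
    (fun p : Fin (N + 1) × Fin (N + 1) => G p.1 p.2)
  refine ⟨m, hdm, R, hR, fun i l => G' (i, l), fun i l => ?_, fun i => ?_⟩
  · refine IsHomogeneous.of_map (f := algebraMap A k) (IsFractionRing.injective A k) ?_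
    rw [hG', ← zero_add (m - d)]
    exact (isHomogeneous_C _ _).mul (hG i l)
  · rw [h i, Finset.mul_sum]
    exact Finset.sum_congr rfl fun l _ => by rw [hG', mul_assoc]

end Nullstellensatz

end EscapeRate
end

/-! ### Extension of homomorphisms along integral extensions -/

noncomputable section

namespace EscapeRate

open MvPolynomial

/-- Homomorphisms to an algebraically closed field extend along integral extensions. -/
theorem exists_ringHom_comp_eq_of_isIntegral {R S L : Type*} [CommRing R] [CommRing S]
    [IsDomain S] [Field L] [IsAlgClosed L] (f : R →+* S) (hf : f.IsIntegral) (ψ : R →+* L)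
    (hker : ∀ a b, f a = f b → ψ a = ψ b) : ∃ g : S →+* L, ∀ a, g (f a) = ψ a := by
  let := f.toAlgebra
  have : Algebra.IsIntegral R S := ⟨hf⟩
  have := RingHom.ker_isPrime ψ
  -- Lying over: a prime Q above ker ψ turns the problem into embedding the algebraic extension S/Q
  -- of R/P into the algebraically closed `L`.
  obtain ⟨Q, hQ, hQP⟩ := Ideal.exists_ideal_over_prime_of_isIntegral_of_isDomain (S := S)
    (RingHom.ker ψ) (fun a ha => by
      rw [RingHom.mem_ker, hker a 0, map_zero]
      rw [map_zero]
      exact ha)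
  let P := Q.comap (algebraMap R S)
  have hPψ : ∀ a ∈ P, ψ a = 0 := fun a ha => by
    have : a ∈ RingHom.ker ψ := by rw [← hQP]; exact ha
    exact this
  let ψ' : R ⧸ P →+* L := Ideal.Quotient.lift P ψ hPψ
  let := ψ'.toAlgebra
  have hψ' : Function.Injective ψ' := RingHom.lift_injective_of_ker_le_ideal P hPψ (by
    rw [← hQP])
  have : FaithfulSMul (R ⧸ P) L := (faithfulSMul_iff_algebraMap_injective _ _).mpr hψ'
  have : FaithfulSMul (R ⧸ P) (S ⧸ Q) :=
    (faithfulSMul_iff_algebraMap_injective _ _).mpr Ideal.algebraMap_quotient_injective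
  have : IsDomain (S ⧸ Q) := Ideal.Quotient.isDomain Q
  have : IsDomain (R ⧸ P) := Ideal.Quotient.isDomain P
  have : Algebra.IsIntegral (R ⧸ P) (S ⧸ Q) := inferInstance
  have : Module.IsTorsionFree (R ⧸ P) (S ⧸ Q) := FaithfulSMul.to_isTorsionFree _ _
  have : Module.IsTorsionFree (R ⧸ P) L := FaithfulSMul.to_isTorsionFree _ _
  let g : S ⧸ Q →ₐ[R ⧸ P] L := IsAlgClosed.lift
  refine ⟨g.toRingHom.comp (Ideal.Quotient.mk Q), fun a => ?_⟩
  exact g.commutes (Ideal.Quotient.mk P a)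

theorem _root_.MvPolynomial.IsHomogeneous.eval₂_mul_left {σ R T : Type*} [CommSemiring R]
    [CommSemiring T] {Φ : MvPolynomial σ R} {e : ℕ} (hΦ : Φ.IsHomogeneous e) (f : R →+* T)
    (c : T) (y : σ → T) : Φ.eval₂ f (fun i => c * y i) = c ^ e * Φ.eval₂ f y := by
  rw [eval₂_eq, eval₂_eq, Finset.mul_sum]
  refine Finset.sum_congr rfl fun b hb => ?_
  have hbd : ∑ i ∈ b.support, b i = e := by
    by_contra hne
    exact (mem_support_iff.mp hb) (hΦ.coeff_eq_zero hne)
  simp_rw [mul_pow]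
  rw [Finset.prod_mul_distrib, Finset.prod_pow_eq_pow_sum, hbd]
  ring

/-! ### The generic fibre is finite, nonempty and consists of generic points -/

section Fibre

variable {k : Type*} [Field k] {N d : ℕ}

theorem toGenericClosure_eq_algebraMap :
    toGenericClosure k N = algebraMap (MvPolynomial (Fin (N + 1)) k) (GenericClosure k N) := rfl

theorem toGenericClosure_injective : Function.Injective (toGenericClosure k N) :=
  (algebraMap (FractionRing (MvPolynomial (Fin (N + 1)) k)) (GenericClosure k N)).injective.comp
    (IsFractionRing.injective _ _)

theorem toGenericClosure_C (a : k) :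
    toGenericClosure k N (C a) = algebraMap k (GenericClosure k N) a := by
  rw [toGenericClosure_eq_algebraMap, ← algebraMap_eq,
    ← IsScalarTower.algebraMap_apply k (MvPolynomial (Fin (N + 1)) k)]

theorem toGenericClosure_apply (P : MvPolynomial (Fin (N + 1)) k) :
    toGenericClosure k N P = aeval (fun i => toGenericClosure k N (X i)) P := by
  have : toGenericClosure k N
      = (aeval (R := k) fun i => toGenericClosure k N (X i)).toRingHom := by
    refine ringHom_ext (fun a => ?_) fun i => ?_
    · simp [toGenericClosure_C]
    · simp
  exact congrArg (fun f => f P) this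

theorem aeval_comp_of_mem_genericFibre {F : Fin (N + 1) → MvPolynomial (Fin (N + 1)) k}
    {Y : Fin (N + 1) → GenericClosure k N} (hY : Y ∈ genericFibre F)
    (P : MvPolynomial (Fin (N + 1)) k) :
    aeval Y (aeval F P) = toGenericClosure k N P := by
  rw [toGenericClosure_apply, ← AlgHom.comp_apply, comp_aeval]
  congr 2
  funext i
  exact hY i

variable {F : Fin (N + 1) → MvPolynomial (Fin (N + 1)) k}

/-- The relations X_i^m = ∑ G_{il} F_l are the input of `isIntegralElem_of_pow_relation` with y = X,
x = F and R = 1. This is the finiteness of the morphism defined by F. -/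
theorem IsLift.isIntegral_aeval (hF : IsLift d F) (hd : 1 ≤ d) :
    (aeval F : MvPolynomial (Fin (N + 1)) k →ₐ[k] _).toRingHom.IsIntegral := by
  obtain ⟨m, hdm, G, hG, h⟩ := hF.exists_pow_relation
  have hX : ∀ i, (aeval F : MvPolynomial (Fin (N + 1)) k →ₐ[k] _).toRingHom.IsIntegralElem
      (X i) := fun i => by
    have := isIntegralElem_of_pow_relation (C : k →+* MvPolynomial (Fin (N + 1)) k) X F 1 hd hdm G
      hG (fun i => by
        rw [map_one, one_mul, h i]
        refine Finset.sum_congr rfl fun l _ => ?_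
        rw [eval₂_eta]) i
    rw [map_one, one_mul] at this
    exact this
  let := (aeval F : MvPolynomial (Fin (N + 1)) k →ₐ[k] MvPolynomial (Fin (N + 1)) k).toRingHom.toAlgebra
  intro p
  induction p using MvPolynomial.induction_on with
  | C a =>
    have : C a = (aeval F : MvPolynomial (Fin (N + 1)) k →ₐ[k] _).toRingHom (C a) := by simp
    rw [this]
    exact RingHom.isIntegralElem_map _
  | add p q hp hq => exact RingHom.IsIntegralElem.add _ hp hq
  | mul_X p i hp => exact RingHom.IsIntegralElem.mul _ hp (hX i)

/-- k[X] has transcendence degree N + 1 and is algebraic over the subring generated by the N + 1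
elements F_i, so these form a transcendence basis. -/
theorem IsLift.algebraicIndependent (hF : IsLift d F) (hd : 1 ≤ d) : AlgebraicIndependent k F := by
  have hint := hF.isIntegral_aeval hd
  have : Algebra.IsIntegral (Algebra.adjoin k (Set.range F)) (MvPolynomial (Fin (N + 1)) k) := by
    refine ⟨fun p => ?_⟩
    obtain ⟨q, hq, h0⟩ := hint p
    have hr : ∀ a : MvPolynomial (Fin (N + 1)) k,
        aeval F a ∈ Algebra.adjoin k (Set.range F) := fun a => by
      rw [Algebra.adjoin_range_eq_range_aeval]
      exact ⟨a, rfl⟩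
    refine ⟨q.map ((aeval F).codRestrict _ hr).toRingHom, hq.map _, ?_⟩
    rw [Polynomial.eval₂_map]
    exact h0
  exact (Algebra.IsAlgebraic.isTranscendenceBasis_of_lift_le_trdeg_of_finite k F (by
    rw [MvPolynomial.trdeg_of_isDomain]; simp)).1

/-- The kernel of evaluation at Y contracts to zero along P ↦ P(F), because P(F(Y)) = P(X). In an
integral extension of domains only the zero ideal does that. -/
theorem IsLift.aeval_injective_of_mem (hF : IsLift d F) (hd : 1 ≤ d)
    {Y : Fin (N + 1) → GenericClosure k N} (hY : Y ∈ genericFibre F) :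
    Function.Injective (aeval Y : MvPolynomial (Fin (N + 1)) k →ₐ[k] _) := by
  let := (aeval F : MvPolynomial (Fin (N + 1)) k →ₐ[k] MvPolynomial (Fin (N + 1)) k).toRingHom.toAlgebra
  have hint : Algebra.IsIntegral (MvPolynomial (Fin (N + 1)) k) (MvPolynomial (Fin (N + 1)) k) :=
    ⟨hF.isIntegral_aeval hd⟩
  change Function.Injective (aeval Y : MvPolynomial (Fin (N + 1)) k →ₐ[k] _).toRingHom
  rw [RingHom.injective_iff_ker_eq_bot]
  refine Ideal.eq_bot_of_comap_eq_bot (R := MvPolynomial (Fin (N + 1)) k) ?_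
  rw [eq_bot_iff]
  intro P hP
  have h1 : aeval Y (aeval F P) = 0 := hP
  rw [aeval_comp_of_mem_genericFibre hY] at h1
  exact toGenericClosure_injective (by rw [h1, map_zero])

/-- The inclusion of k[X] in the closure extends along the injective integral map P ↦ P(F); the
images of the variables are a solution. -/
theorem IsLift.genericFibre_nonempty (hF : IsLift d F) (hd : 1 ≤ d) :
    (genericFibre F).Nonempty := by
  have hint := hF.isIntegral_aeval hd
  have hinj := hF.algebraicIndependent hd
  let f := (aeval F : MvPolynomial (Fin (N + 1)) k →ₐ[k] MvPolynomial (Fin (N + 1)) k)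
  obtain ⟨g, hg⟩ := exists_ringHom_comp_eq_of_isIntegral f.toRingHom hint (toGenericClosure k N)
    (fun a b h => congrArg _ (hinj h))
  have hgC : ∀ a, g (C a) = algebraMap k _ a := fun a => by
    have := hg (C a)
    rw [toGenericClosure_C] at this
    simpa [f] using this
  refine ⟨fun i => g (X i), fun i => ?_⟩
  have h2 : ∀ p, aeval (fun i => g (X i)) p = g p := fun p => by
    have : (aeval (R := k) fun i => g (X i)).toRingHom = g :=
      ringHom_ext (fun a => by simp [hgC]) (fun i => by simp)
    exact congrArg (fun f => f p) this
  rw [h2, ← hg]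
  simp [f]

/-- Evaluating at Y the integral equation of X_i over k[F] shows that each coordinate of Y is a root
of a fixed monic polynomial over k[X]. -/
theorem IsLift.genericFibre_finite (hF : IsLift d F) (hd : 1 ≤ d) :
    (genericFibre F).Finite := by
  choose p hp h0 using fun i => hF.isIntegral_aeval hd (X i)
  refine Set.Finite.subset (Set.Finite.pi' (t := fun i =>
    {z | ((p i).map (toGenericClosure k N)).IsRoot z})
    fun i => Polynomial.finite_setOfPred_isRoot ((hp i).map _).ne_zero) fun Y hY i => ?_
  change Polynomial.eval (Y i) _ = 0
  rw [Polynomial.eval_map]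
  have := congrArg (aeval Y) (h0 i)
  rw [map_zero] at this
  rw [← this]
  change _ = (aeval Y : MvPolynomial (Fin (N + 1)) k →ₐ[k] _).toRingHom _
  rw [Polynomial.hom_eval₂]
  congr 1
  · exact RingHom.ext fun P => (aeval_comp_of_mem_genericFibre hY P).symm
  · simp

end Fibre

/-! ### Descent of products over the fibre to polynomials over an integrally closed ring -/

section Descent

variable {k : Type*} [Field k] {N d : ℕ}
variable {A : Type*} [CommRing A] [Algebra A k]

/-- The inclusion of `A[X₀, …, X_N]` into the algebraic closure of `k(X₀, …, X_N)`. -/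
def integralToGenericClosure (A k : Type*) [CommRing A] [Field k] [Algebra A k] (N : ℕ) :
    MvPolynomial (Fin (N + 1)) A →+* GenericClosure k N :=
  (toGenericClosure k N).comp (map (algebraMap A k))

theorem integralToGenericClosure_eq_eval₂Hom :
    integralToGenericClosure A k N = eval₂Hom ((algebraMap k (GenericClosure k N)).comp
      (algebraMap A k)) (fun i => toGenericClosure k N (X i)) := by
  refine ringHom_ext (fun a => ?_) fun i => ?_
  · simp [integralToGenericClosure, toGenericClosure_C]
  · simp [integralToGenericClosure]

/-- Elements of the algebraic closure of `k(X)` that are integral over `A[X]` and fixed by the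
Galois group lie in `A[X]`. -/
theorem exists_eq_of_fixed_of_isIntegral [CharZero k] [IsFractionRing A k] [IsIntegrallyClosed A]
    {z : GenericClosure k N}
    (hfix : ∀ g : Gal(GenericClosure k N/FractionRing (MvPolynomial (Fin (N + 1)) k)), g z = z)
    (hint : (integralToGenericClosure A k N).IsIntegralElem z) :
    ∃ P : MvPolynomial (Fin (N + 1)) A, integralToGenericClosure A k N P = z := by
  -- In characteristic zero the algebraic closure is Galois, so a fixed element is a rational
  -- function; being integral over the integrally closed ring k[X], it is a polynomial.
  obtain ⟨w, hw⟩ := IntermediateField.mem_bot.mp ((InfiniteGalois.mem_bot_iff_fixed z).mpr hfix)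
  have hinjw := (algebraMap (FractionRing (MvPolynomial (Fin (N + 1)) k))
    (GenericClosure k N)).injective
  have h1 : IsIntegral (MvPolynomial (Fin (N + 1)) k) w := by
    obtain ⟨p, hp, h0⟩ := hint
    refine ⟨p.map (map (algebraMap A k)), hp.map _, hinjw ?_⟩
    rw [map_zero, Polynomial.hom_eval₂, Polynomial.eval₂_map, hw]
    exact h0
  obtain ⟨Q, hQ⟩ := IsIntegrallyClosed.isIntegral_iff.mp h1
  have hQz : toGenericClosure k N Q = z := by rw [← hw, ← hQ]; rfl
  have h2 : (map (σ := Fin (N + 1)) (algebraMap A k)).IsIntegralElem Q := by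
    obtain ⟨p, hp, h0⟩ := hint
    refine ⟨p, hp, toGenericClosure_injective ?_⟩
    rw [map_zero, Polynomial.hom_eval₂, hQz]
    exact h0
  -- A polynomial integral over A[X] has coefficients integral over `A`.
  have h3 : ∀ n, IsIntegral A (coeff n Q) :=
    MvPolynomial.isIntegral_iff_isIntegral_coeff.mp h2
  have h4 : Q ∈ (map (σ := Fin (N + 1)) (algebraMap A k)).range := by
    rw [Q.as_sum]
    refine Subring.sum_mem _ fun m hm => ?_
    obtain ⟨a, ha⟩ := IsIntegrallyClosed.isIntegral_iff.mp (h3 m)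
    exact ⟨monomial m a, by rw [map_monomial, ha]⟩
  obtain ⟨P, rfl⟩ := h4
  exact ⟨P, hQz⟩

variable {F : Fin (N + 1) → MvPolynomial (Fin (N + 1)) k}

/-- F and Φ have coefficients in k, so Galois permutes the points of the fibre and with them the
factors. -/
theorem galois_apply_fibreProd (Φ : MvPolynomial (Fin (N + 1)) k)
    (g : Gal(GenericClosure k N/FractionRing (MvPolynomial (Fin (N + 1)) k)))
    (hfin : (genericFibre F).Finite) :
    g (fibreProd F Φ) = fibreProd F Φ := by
  have hgk : ∀ a : k, g (algebraMap k _ a) = algebraMap k _ a := fun a => by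
    rw [← toGenericClosure_C]; exact g.commutes _
  have haev : ∀ (g : Gal(GenericClosure k N/FractionRing (MvPolynomial (Fin (N + 1)) k)))
      (Y : Fin (N + 1) → GenericClosure k N) (p : MvPolynomial (Fin (N + 1)) k),
      g (aeval Y p) = aeval (fun i => g (Y i)) p := fun g Y p => by
    have hgk : ∀ a : k, g (algebraMap k _ a) = algebraMap k _ a := fun a => by
      rw [← toGenericClosure_C]; exact g.commutes _
    have : ((g : _ →+* GenericClosure k N).comp (aeval (R := k) Y).toRingHom)
        = (aeval (R := k) fun i => g (Y i)).toRingHom :=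
      ringHom_ext (fun a => by simp [hgk]) (fun i => by simp)
    exact congrArg (fun f => f p) this
  have hmem : ∀ (g : Gal(GenericClosure k N/FractionRing (MvPolynomial (Fin (N + 1)) k)))
      (Y : Fin (N + 1) → GenericClosure k N), Y ∈ genericFibre F →
      (fun i => g (Y i)) ∈ genericFibre F := fun g Y hY i => by
    rw [← haev, hY i]
    exact g.commutes _
  unfold fibreProd
  rw [finprod_mem_eq_finite_toFinset_prod _ hfin, map_prod]
  refine Finset.prod_bij' (fun Y _ i => g (Y i)) (fun Y _ i => g.symm (Y i))
    ?_ ?_ ?_ ?_ ?_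
  · intro Y hY
    rw [Set.Finite.mem_toFinset] at hY ⊢
    exact hmem g Y hY
  · intro Y hY
    rw [Set.Finite.mem_toFinset] at hY ⊢
    exact hmem g.symm Y hY
  · intro Y _; simp
  · intro Y _; simp
  · intro Y _; exact haev g Y Φ

/-- The integrality of the coordinates of the points in the generic fibre. -/
theorem isIntegralElem_of_mem_genericFibre (hd : 1 ≤ d) {m : ℕ} (hdm : d ≤ m) {R : A}
    {G : Fin (N + 1) → Fin (N + 1) → MvPolynomial (Fin (N + 1)) A}
    (hG : ∀ i l, (G i l).IsHomogeneous (m - d))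
    (h : ∀ i, C (algebraMap A k R) * (X i : MvPolynomial (Fin (N + 1)) k) ^ m
      = ∑ l, map (algebraMap A k) (G i l) * F l)
    {Y : Fin (N + 1) → GenericClosure k N} (hY : Y ∈ genericFibre F) (i : Fin (N + 1)) :
    (integralToGenericClosure A k N).IsIntegralElem
      (algebraMap k _ (algebraMap A k R) * Y i) := by
  rw [integralToGenericClosure_eq_eval₂Hom]
  refine isIntegralElem_of_pow_relation ((algebraMap k (GenericClosure k N)).comp
    (algebraMap A k)) Y _ R hd hdm G hG (fun i => ?_) i
  have := congrArg (aeval Y) (h i)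
  simp only [map_mul, map_pow, map_sum, aeval_X, algHom_C] at this
  rw [RingHom.comp_apply, this]
  refine Finset.sum_congr rfl fun l _ => ?_
  rw [hY l, aeval_def, eval₂_map]

theorem isIntegralElem_eval₂ {T : Type*} [CommRing T] (f : MvPolynomial (Fin (N + 1)) A →+* T)
    {y : Fin (N + 1) → T} (hy : ∀ i, f.IsIntegralElem (y i)) (Φ : MvPolynomial (Fin (N + 1)) A) :
    f.IsIntegralElem (Φ.eval₂ (f.comp C) y) := by
  induction Φ using MvPolynomial.induction_on with
  | C a => rw [eval₂_C]; exact RingHom.isIntegralElem_map f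
  | add p q hp hq => rw [eval₂_add]; exact RingHom.IsIntegralElem.add _ hp hq
  | mul_X p i hp => rw [eval₂_mul, eval₂_X]; exact RingHom.IsIntegralElem.mul _ hp (hy i)

/-- The product over the generic fibre lies in `A[X]` after multiplication by a suitable power
of `R`. -/
theorem exists_integral_fibreProd [CharZero k] [IsFractionRing A k] [IsIntegrallyClosed A]
    (hd : 1 ≤ d) {m : ℕ} (hdm : d ≤ m) {R : A}
    {G : Fin (N + 1) → Fin (N + 1) → MvPolynomial (Fin (N + 1)) A}
    (hG : ∀ i l, (G i l).IsHomogeneous (m - d))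
    (h : ∀ i, C (algebraMap A k R) * (X i : MvPolynomial (Fin (N + 1)) k) ^ m
      = ∑ l, map (algebraMap A k) (G i l) * F l)
    (hfin : (genericFibre F).Finite) {e : ℕ} {Φ : MvPolynomial (Fin (N + 1)) A}
    (hΦ : R = 1 ∨ Φ.IsHomogeneous e) :
    ∃ P : MvPolynomial (Fin (N + 1)) A, integralToGenericClosure A k N P =
      algebraMap k _ (algebraMap A k R) ^ (e * (genericFibre F).ncard)
        * fibreProd F (map (algebraMap A k) Φ) := by
  refine exists_eq_of_fixed_of_isIntegral (fun g => ?_) ?_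
  · rw [map_mul, map_pow, galois_apply_fibreProd _ g hfin, ← toGenericClosure_C]
    congr 2
    exact g.commutes _
  -- Homogeneity turns R^e Φ(Y) into Φ(RY), where the coordinates of RY are integral. For R = 1 no
  -- homogeneity is needed, hence the alternative in `hΦ`.
  · have key : algebraMap k _ (algebraMap A k R) ^ (e * (genericFibre F).ncard)
        * fibreProd F (map (algebraMap A k) Φ) = ∏ Y ∈ hfin.toFinset,
        Φ.eval₂ ((integralToGenericClosure A k N).comp C)
          (fun i => algebraMap k _ (algebraMap A k R) * Y i) := by
      unfold fibreProd
      rw [finprod_mem_eq_finite_toFinset_prod _ hfin, Set.ncard_eq_toFinset_card _ hfin, pow_mul,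
        ← Finset.prod_const, ← Finset.prod_mul_distrib]
      refine Finset.prod_congr rfl fun Y _ => ?_
      have hC : (integralToGenericClosure A k N).comp C
          = (algebraMap k (GenericClosure k N)).comp (algebraMap A k) := by
        ext a; simp [integralToGenericClosure, toGenericClosure_C]
      rw [hC, aeval_def, eval₂_map]
      rcases hΦ with rfl | hΦ
      · simp
      · exact (hΦ.eval₂_mul_left _ _ _).symm
    rw [key]
    refine Finset.prod_induction _ _ (fun a b => RingHom.IsIntegralElem.mul _)
      (RingHom.isIntegralElem_one _) fun Y hY => ?_
    rw [Set.Finite.mem_toFinset] at hY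
    exact isIntegralElem_eval₂ _
      (fun i => isIntegralElem_of_mem_genericFibre hd hdm hG h hY i) Φ

/-- The case A = k, R = 1 of `exists_integral_fibreProd`: for a lift, the default branch of
`pushforward` is never taken. -/
theorem IsLift.toGenericClosure_pushforward [CharZero k] (hF : IsLift d F) (hd : 1 ≤ d)
    (Φ : MvPolynomial (Fin (N + 1)) k) :
    toGenericClosure k N (pushforward F Φ) = fibreProd F Φ := by
  obtain ⟨m, hdm, G, hG, h⟩ := hF.exists_pow_relation
  obtain ⟨P, hP⟩ := exists_integral_fibreProd (A := k) (R := 1) (e := 0) (Φ := Φ) hd hdm hG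
    (by simpa [MvPolynomial.map_id] using h) (hF.genericFibre_finite hd) (Or.inl rfl)
  have hex : ∃ P, toGenericClosure k N P = fibreProd F Φ :=
    ⟨P, by simpa [integralToGenericClosure, MvPolynomial.map_id] using hP⟩
  rw [pushforward, dif_pos hex]
  exact hex.choose_spec

end Descent

end EscapeRate
end

noncomputable section

namespace EscapeRate

open MvPolynomial

/-! ### Lifts over a ring and their base change -/

section RegularLift

variable {A B k : Type*} [CommRing A] [CommRing B] [Field k] {N d : ℕ}

/-- A lift of an endomorphism over a ring: forms of degree `d` generating an ideal that contains
a power of each variable. -/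
structure IsRegularLift (d : ℕ) (F : Fin (N + 1) → MvPolynomial (Fin (N + 1)) A) : Prop where
  isHomogeneous : ∀ i, (F i).IsHomogeneous d
  exists_pow : ∃ m, d ≤ m ∧ ∃ G : Fin (N + 1) → Fin (N + 1) → MvPolynomial (Fin (N + 1)) A,
    (∀ i l, (G i l).IsHomogeneous (m - d)) ∧ ∀ i, X i ^ m = ∑ l, G i l * F l

theorem IsRegularLift.baseChange {F : Fin (N + 1) → MvPolynomial (Fin (N + 1)) A}
    (hF : IsRegularLift d F) (φ : A →+* B) :
    IsRegularLift d fun i => MvPolynomial.map φ (F i) := by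
  obtain ⟨hh, m, hdm, G, hG, h⟩ := hF
  refine ⟨fun i => (hh i).map φ, m, hdm, fun i l => MvPolynomial.map φ (G i l),
    fun i l => (hG i l).map φ, fun i => ?_⟩
  have := congrArg (MvPolynomial.map φ) (h i)
  simpa using this

theorem IsRegularLift.isLift {F : Fin (N + 1) → MvPolynomial (Fin (N + 1)) k}
    (hF : IsRegularLift d F) : IsLift d F := by
  obtain ⟨hh, m, hdm, G, hG, h⟩ := hF
  refine ⟨hh, fun y hy => funext fun i => ?_⟩
  have := congrArg (aeval y) (h i)
  simp only [map_pow, aeval_X, map_sum, map_mul, hy, mul_zero, Finset.sum_const_zero] at this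
  exact eq_zero_of_pow_eq_zero this

end RegularLift

/-- The vectors (1, c, c², …) suffice: each nonzero w turns into a nonzero polynomial in c, and
finitely many such polynomials have only finitely many roots. Integer entries survive every ring
homomorphism, so the resulting linear form can be specialized. -/
theorem exists_int_vector_ne_zero {L ι : Type*} [Field L] [CharZero L] [Finite ι] {n : ℕ}
    (w : ι → Fin n → L) (hw : ∀ a, w a ≠ 0) :
    ∃ u : Fin n → ℤ, ∀ a, ∑ i, (u i : L) * w a i ≠ 0 := by
  classical
  have := Fintype.ofFinite ι
  let q : ι → Polynomial L := fun a => ∑ i : Fin n, Polynomial.C (w a i) * Polynomial.X ^ (i : ℕ)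
  have hq : ∀ a, q a ≠ 0 := fun a h0 => hw a <| funext fun i => by
    have := congrArg (fun p => Polynomial.coeff p (i : ℕ)) h0
    simp only [q, Polynomial.finsetSum_coeff, Polynomial.coeff_C_mul, Polynomial.coeff_X_pow,
      Polynomial.coeff_zero, Fin.val_inj] at this
    simpa using this
  have hprod : ∏ a, q a ≠ 0 := Finset.prod_ne_zero_iff.mpr fun a _ => hq a
  obtain ⟨c, hc⟩ : ∃ c : ℤ, ¬ (∏ a, q a).IsRoot (c : L) := by
    by_contra! hcon
    refine hprod (Polynomial.eq_zero_of_infinite_isRoot _ ?_)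
    refine Set.Infinite.mono ?_
      (Set.infinite_range_of_injective (Int.cast_injective (α := L)))
    rintro _ ⟨c, rfl⟩
    exact hcon c
  refine ⟨fun i => c ^ (i : ℕ), fun a h0 => hc ?_⟩
  rw [Polynomial.IsRoot.def, Polynomial.eval_prod]
  refine Finset.prod_eq_zero (Finset.mem_univ a) ?_
  rw [← h0]
  simp only [q, Polynomial.eval_finsetSum, Polynomial.eval_mul, Polynomial.eval_C,
    Polynomial.eval_pow, Polynomial.eval_X, Int.cast_pow]
  exact Finset.sum_congr rfl fun i _ => mul_comm _ _

/-! ### Specialization of the generic fibre through the ring of integral elements -/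

section Specialization

variable {k : Type*} [Field k] {N d : ℕ}
variable {A : Type*} [CommRing A] [Algebra A k]

/-- The elements of the closure of `k(X)` that are integral over `A[X]`. -/
def integralSubring (A k : Type*) [CommRing A] [Field k] [Algebra A k] (N : ℕ) :
    Subring (GenericClosure k N) where
  carrier := {z | (integralToGenericClosure A k N).IsIntegralElem z}
  mul_mem' := RingHom.IsIntegralElem.mul _
  one_mem' := RingHom.isIntegralElem_one _
  add_mem' := RingHom.IsIntegralElem.add _
  zero_mem' := RingHom.isIntegralElem_zero _
  neg_mem' := RingHom.IsIntegralElem.neg _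

/-- The inclusion of `A[X]` into the ring of elements integral over it. -/
def toIntegralSubring (A k : Type*) [CommRing A] [Field k] [Algebra A k] (N : ℕ) :
    MvPolynomial (Fin (N + 1)) A →+* integralSubring A k N :=
  (integralToGenericClosure A k N).codRestrict _ fun _ => RingHom.isIntegralElem_map _

theorem coe_toIntegralSubring (P : MvPolynomial (Fin (N + 1)) A) :
    (toIntegralSubring A k N P : GenericClosure k N) = integralToGenericClosure A k N P := rfl

theorem isIntegral_toIntegralSubring : (toIntegralSubring A k N).IsIntegral := by
  intro z
  obtain ⟨p, hp, h0⟩ := z.2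
  refine ⟨p, hp, Subtype.ext ?_⟩
  have := Polynomial.hom_eval₂ p (toIntegralSubring A k N) (integralSubring A k N).subtype z
  exact this.trans h0

variable {F : Fin (N + 1) → MvPolynomial (Fin (N + 1)) A}

theorem IsRegularLift.mem_integralSubring (hF : IsRegularLift d F) (hd : 1 ≤ d)
    {Y : Fin (N + 1) → GenericClosure k N}
    (hY : Y ∈ genericFibre fun i => map (algebraMap A k) (F i)) (i : Fin (N + 1)) :
    Y i ∈ integralSubring A k N := by
  obtain ⟨hh, m, hdm, G, hG, h⟩ := hF
  have := isIntegralElem_of_mem_genericFibre (R := (1 : A)) hd hdm hG (fun i => by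
    have := congrArg (MvPolynomial.map (algebraMap A k)) (h i)
    simpa using this) hY i
  rw [map_one, map_one, one_mul] at this
  exact this

/-- The point with integral coordinates given by an element of the generic fibre. -/
def IsRegularLift.integralPoint (hF : IsRegularLift d F) (hd : 1 ≤ d)
    (Y : genericFibre fun i => map (algebraMap A k) (F i)) (i : Fin (N + 1)) :
    integralSubring A k N := ⟨Y.1 i, hF.mem_integralSubring hd Y.2 i⟩

theorem IsRegularLift.coe_eval₂_integralPoint (hF : IsRegularLift d F) (hd : 1 ≤ d)
    (Y : genericFibre fun i => map (algebraMap A k) (F i)) (Φ : MvPolynomial (Fin (N + 1)) A) :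
    ((Φ.eval₂ ((toIntegralSubring A k N).comp C) (hF.integralPoint hd Y) :
      integralSubring A k N) : GenericClosure k N) = aeval Y.1 (map (algebraMap A k) Φ) := by
  rw [aeval_def, eval₂_map]
  have h : (integralSubring A k N).subtype.comp (eval₂Hom ((toIntegralSubring A k N).comp C)
      (hF.integralPoint hd Y)) = eval₂Hom ((algebraMap k (GenericClosure k N)).comp
      (algebraMap A k)) Y.1 := by
    refine ringHom_ext (fun a => ?_) fun i => ?_
    · simp [coe_toIntegralSubring, integralToGenericClosure, toGenericClosure_C]
    · simp [IsRegularLift.integralPoint]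
  exact RingHom.congr_fun h Φ

variable {L : Type*} [Field L] {φ : A →+* L} {x : Fin (N + 1) → L}

theorem eval₂_integralPoint (hF : IsRegularLift d F) (hd : 1 ≤ d)
    {ρ : integralSubring A k N →+* L} (hρ : ∀ P, ρ (toIntegralSubring A k N P) = P.eval₂ φ x)
    (Y : genericFibre fun i => map (algebraMap A k) (F i)) (Φ : MvPolynomial (Fin (N + 1)) A) :
    Φ.eval₂ φ (fun i => ρ (hF.integralPoint hd Y i))
      = ρ (Φ.eval₂ ((toIntegralSubring A k N).comp C) (hF.integralPoint hd Y)) := by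
  rw [← coe_eval₂Hom, ← coe_eval₂Hom, ← RingHom.comp_apply]
  refine congrFun (congrArg DFunLike.coe (ringHom_ext (fun a => ?_) fun i => ?_)) Φ
  · simp [hρ]
  · simp

/-- Apply ρ to the product over the generic fibre. The index set stays the generic fibre, so
specialized points that coincide are counted with multiplicity. -/
theorem eval₂_eq_finprod (hF : IsRegularLift d F) (hd : 1 ≤ d)
    (hfin : (genericFibre fun i => map (algebraMap A k) (F i)).Finite)
    {ρ : integralSubring A k N →+* L} (hρ : ∀ P, ρ (toIntegralSubring A k N P) = P.eval₂ φ x)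
    {Φ P : MvPolynomial (Fin (N + 1)) A}
    (hP : integralToGenericClosure A k N P
      = fibreProd (fun i => map (algebraMap A k) (F i)) (map (algebraMap A k) Φ)) :
    P.eval₂ φ x = ∏ᶠ Y : genericFibre fun i => map (algebraMap A k) (F i),
      Φ.eval₂ φ (fun i => ρ (hF.integralPoint hd Y i)) := by
  have := hfin.to_subtype
  simp_rw [eval₂_integralPoint hF hd hρ]
  rw [← hρ]
  refine Eq.trans ?_ (map_finprod (ρ : integralSubring A k N →* L) (Set.toFinite _))
  change ρ _ = ρ _
  congr 1
  refine Subtype.ext ?_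
  refine Eq.trans ?_ (map_finprod ((integralSubring A k N).subtype :
    integralSubring A k N →* GenericClosure k N) (Set.toFinite _)).symm
  rw [coe_toIntegralSubring, hP, fibreProd, ← finprod_set_coe_eq_finprod_mem]
  exact finprod_congr fun Y => (hF.coe_eval₂_integralPoint hd Y Φ).symm

theorem eval₂_integralPoint_eq (hF : IsRegularLift d F) (hd : 1 ≤ d)
    {ρ : integralSubring A k N →+* L} (hρ : ∀ P, ρ (toIntegralSubring A k N P) = P.eval₂ φ x)
    (Y : genericFibre fun i => map (algebraMap A k) (F i)) (i : Fin (N + 1)) :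
    (F i).eval₂ φ (fun i => ρ (hF.integralPoint hd Y i)) = x i := by
  rw [eval₂_integralPoint hF hd hρ]
  have h1 : x i = ρ (toIntegralSubring A k N (X i)) := by rw [hρ, eval₂_X]
  rw [h1]
  congr 1
  refine Subtype.ext ?_
  rw [hF.coe_eval₂_integralPoint hd, coe_toIntegralSubring]
  simpa [integralToGenericClosure] using Y.2 i

/-- A first order Taylor formula without remainder: the difference quotients M_j become partial
derivatives as soon as Y and Z have the same specialization. -/
theorem exists_eval₂_sub_eq_sum {T L : Type*} [CommRing T] [Field L] (g : A →+* T) (ρ : T →+* L)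
    (φ : A →+* L) (hρ : ∀ a, ρ (g a) = φ a) {n : ℕ}
    (Y Z : Fin n → T) (hYZ : ∀ i, ρ (Y i) = ρ (Z i)) (p : MvPolynomial (Fin n) A) :
    ∃ M : Fin n → T, p.eval₂ g Y - p.eval₂ g Z = ∑ j, M j * (Y j - Z j) ∧
      ∀ j, ρ (M j) = (pderiv j p).eval₂ φ (fun i => ρ (Y i)) := by
  classical
  have hev : ∀ p : MvPolynomial (Fin n) A, ρ (p.eval₂ g Z) = p.eval₂ φ (fun i => ρ (Y i)) := by
    intro p
    rw [← RingHom.comp_id ρ, ← coe_eval₂Hom, ← coe_eval₂Hom, RingHom.comp_id, ← RingHom.comp_apply]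
    refine congrFun (congrArg DFunLike.coe (ringHom_ext (fun a => ?_) fun i => ?_)) p
    · simp [hρ]
    · simp [hYZ]
  induction p using MvPolynomial.induction_on with
  | C a => exact ⟨0, by simp⟩
  | add p q hp hq =>
    obtain ⟨M, hM, hM'⟩ := hp
    obtain ⟨M₁, hM₁, hM₁'⟩ := hq
    refine ⟨M + M₁, ?_, fun j => by simp [hM', hM₁']⟩
    simp only [eval₂_add, Pi.add_apply, add_mul, Finset.sum_add_distrib, ← hM, ← hM₁]
    ring
  | mul_X p i hp =>
    obtain ⟨M, hM, hM'⟩ := hp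
    refine ⟨fun j => M j * Y i + if j = i then p.eval₂ g Z else 0, ?_, fun j => ?_⟩
    · have : ∑ j, (M j * Y i + if j = i then p.eval₂ g Z else 0) * (Y j - Z j)
          = (∑ j, M j * (Y j - Z j)) * Y i + p.eval₂ g Z * (Y i - Z i) := by
        simp [add_mul, Finset.sum_add_distrib, Finset.sum_mul, mul_right_comm]
      rw [this, ← hM, eval₂_mul, eval₂_mul, eval₂_X, eval₂_X]
      ring
    · by_cases hji : j = i
      · subst hji
        simp [hM', hev, Derivation.leibniz]
        ring
      · simp [hM', hji, Derivation.leibniz, pderiv_X, Ne.symm hji]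
        ring

/-- Distinct points of the generic fibre stay distinct when the specialized map is unramified at
the specialized point. -/
theorem integralPoint_injective_of_det_ne_zero (hF : IsRegularLift d F) (hd : 1 ≤ d)
    {ρ : integralSubring A k N →+* L} (hρ : ∀ P, ρ (toIntegralSubring A k N P) = P.eval₂ φ x)
    (hdet : ∀ y : Fin (N + 1) → L, (∀ i, (F i).eval₂ φ y = x i) →
      (Matrix.of fun i j => (pderiv j (F i)).eval₂ φ y).det ≠ 0) :
    Function.Injective fun (Y : genericFibre fun i => map (algebraMap A k) (F i))
      (i : Fin (N + 1)) => ρ (hF.integralPoint hd Y i) := by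
  intro Y Z hYZ
  by_contra hne
  choose M hM hM' using fun i => exists_eval₂_sub_eq_sum ((toIntegralSubring A k N).comp C) ρ φ
    (fun a => by simp [hρ]) (hF.integralPoint hd Y) (hF.integralPoint hd Z)
    (fun i => congrFun hYZ i) (F i)
  refine hdet _ (eval₂_integralPoint_eq hF hd hρ Y) ?_
  -- F(Y) = X = F(Z), so the matrix of difference quotients kills the nonzero vector Y - Z. Its
  -- determinant specializes to the Jacobian.
  have h0 : (Matrix.of M).det = 0 := by
    refine Matrix.exists_mulVec_eq_zero_iff.mp
      ⟨fun j => hF.integralPoint hd Y j - hF.integralPoint hd Z j, fun h => hne ?_, ?_⟩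
    · refine Subtype.ext (funext fun i => ?_)
      exact congrArg Subtype.val (sub_eq_zero.mp (congrFun h i))
    · funext i
      refine (hM i).symm.trans (sub_eq_zero.mpr (Subtype.ext ?_))
      rw [hF.coe_eval₂_integralPoint hd, hF.coe_eval₂_integralPoint hd]
      exact (Y.2 i).trans (Z.2 i).symm
  have := congrArg ρ h0
  rw [map_zero, RingHom.map_det] at this
  rw [← this]
  congr 1
  ext i j
  exact (hM' i j).symm

variable [IsFractionRing A k]

/-- Lying over for the integral extension of A[X]: any point x with values in an algebraically
closed field extends to the coordinates of the generic fibre. -/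
theorem exists_specialization [IsAlgClosed L] (φ : A →+* L) (x : Fin (N + 1) → L) :
    ∃ ρ : integralSubring A k N →+* L, ∀ P, ρ (toIntegralSubring A k N P) = P.eval₂ φ x := by
  refine exists_ringHom_comp_eq_of_isIntegral (toIntegralSubring A k N)
    isIntegral_toIntegralSubring (eval₂Hom φ x) fun a b hab => ?_
  have h1 : toGenericClosure k N (map (algebraMap A k) a)
      = toGenericClosure k N (map (algebraMap A k) b) := congrArg Subtype.val hab
  rw [map_injective _ (IsFractionRing.injective A k) (toGenericClosure_injective h1)]

variable [CharZero k] [IsIntegrallyClosed A]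

theorem IsRegularLift.exists_integralToGenericClosure_eq (hF : IsRegularLift d F) (hd : 1 ≤ d)
    (Φ : MvPolynomial (Fin (N + 1)) A) :
    ∃ P : MvPolynomial (Fin (N + 1)) A, integralToGenericClosure A k N P
      = fibreProd (fun i => MvPolynomial.map (algebraMap A k) (F i))
          (MvPolynomial.map (algebraMap A k) Φ) := by
  have hfin := (hF.baseChange (algebraMap A k)).isLift.genericFibre_finite hd
  obtain ⟨hh, m, hdm, G, hG, h⟩ := hF
  obtain ⟨P, hP⟩ := exists_integral_fibreProd (R := (1 : A)) (e := 0) (Φ := Φ) hd hdm hG (fun i => by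
    have := congrArg (MvPolynomial.map (algebraMap A k)) (h i)
    simpa using this) hfin (Or.inl rfl)
  exact ⟨P, by simpa using hP⟩

/-- Every solution of the specialized system is the specialization of a point of the generic
fibre. -/
theorem exists_integralPoint_eq [IsAlgClosed L] [CharZero L] (hF : IsRegularLift d F) (hd : 1 ≤ d)
    {ρ : integralSubring A k N →+* L} (hρ : ∀ P, ρ (toIntegralSubring A k N P) = P.eval₂ φ x)
    {y : Fin (N + 1) → L} (hy : ∀ i, (F i).eval₂ φ y = x i) :
    ∃ Y : genericFibre fun i => map (algebraMap A k) (F i),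
      (fun i => ρ (hF.integralPoint hd Y i)) = y := by
  classical
  have hlift := (hF.baseChange (algebraMap A k)).isLift
  have hfin := hlift.genericFibre_finite hd
  obtain ⟨Y₀, hY₀⟩ := hlift.genericFibre_nonempty hd
  let f : MvPolynomial (Fin (N + 1)) A →+* integralSubring A k N :=
    eval₂Hom ((toIntegralSubring A k N).comp C) (hF.integralPoint hd ⟨Y₀, hY₀⟩)
  have hfval : ∀ p, (f p : GenericClosure k N) = aeval Y₀ (map (algebraMap A k) p) :=
    hF.coe_eval₂_integralPoint hd ⟨Y₀, hY₀⟩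
  have hcomp : ∀ P : MvPolynomial (Fin (N + 1)) A,
      f (bind₁ F P) = toIntegralSubring A k N P := fun P => by
    refine Subtype.ext ?_
    rw [hfval, coe_toIntegralSubring, map_bind₁]
    exact aeval_comp_of_mem_genericFibre hY₀ _
  have hfint : f.IsIntegral := fun z => by
    obtain ⟨p, hp, h0⟩ := isIntegral_toIntegralSubring (A := A) z
    refine ⟨p.map (bind₁ F).toRingHom, hp.map _, ?_⟩
    rw [Polynomial.eval₂_map, ← h0]
    congr 1
    exact RingHom.ext hcomp
  -- `f` embeds A[X] by sending the variables to the coordinates of Y₀, and the ring is integral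
  -- over its image. Extending along `f` gives a second specialization over the same x that sends
  -- the chosen Y₀ exactly to y.
  obtain ⟨ρ', hρ'⟩ := exists_ringHom_comp_eq_of_isIntegral f hfint (eval₂Hom φ y)
    (fun a b hab => by
      have h1 : aeval Y₀ (map (algebraMap A k) a) = aeval Y₀ (map (algebraMap A k) b) := by
        rw [← hfval, ← hfval, hab]
      rw [map_injective _ (IsFractionRing.injective A k)
        (hlift.aeval_injective_of_mem hd hY₀ h1)])
  have hρ'x : ∀ P, ρ' (toIntegralSubring A k N P) = P.eval₂ φ x := fun P => by
    rw [← hcomp, hρ', coe_eval₂Hom, ← coe_eval₂Hom, ← coe_eval₂Hom, eval₂Hom_bind₁]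
    simp only [coe_eval₂Hom, hy]
  have hy' : (fun i => ρ' (hF.integralPoint hd ⟨Y₀, hY₀⟩ i)) = y := funext fun i => by
    have := hρ' (X i)
    simpa [f] using this
  by_contra! hcon
  have := hfin.to_subtype
  have := Fintype.ofFinite (genericFibre fun i => map (algebraMap A k) (F i))
  obtain ⟨u, hu⟩ := exists_int_vector_ne_zero (fun Y i => ρ (hF.integralPoint hd Y i) - y i)
    (fun Y h0 => hcon Y (funext fun i => sub_eq_zero.mp (congrFun h0 i)))
  -- The polynomial whose roots are the values of the separating form `u` at the specialized points.
  -- Its values at integers c are specializations of the fibre product of the polynomial u·X - c, so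
  -- they depend on x only and not on r.
  let p : (integralSubring A k N →+* L) → Polynomial L := fun r =>
    ∏ Y : genericFibre fun i => map (algebraMap A k) (F i),
      (Polynomial.C (∑ i, (u i : L) * r (hF.integralPoint hd Y i)) - Polynomial.X)
  have hpeval : ∀ r : integralSubring A k N →+* L,
      (∀ P, r (toIntegralSubring A k N P) = P.eval₂ φ x) → ∀ c : ℤ, ∀ P,
      integralToGenericClosure A k N P
        = fibreProd (fun i => map (algebraMap A k) (F i)) (map (algebraMap A k)
          (∑ i, C (u i : A) * X i - C (c : A))) → (p r).eval (c : L) = P.eval₂ φ x := by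
    intro r hr c P hP
    rw [eval₂_eq_finprod hF hd hfin hr hP, finprod_eq_prod_of_fintype, Polynomial.eval_prod]
    refine Finset.prod_congr rfl fun Y _ => ?_
    simp only [Polynomial.eval_sub, Polynomial.eval_C, Polynomial.eval_X, eval₂_sub, eval₂_sum,
      eval₂_mul, eval₂_C, eval₂_X]
    simp only [_root_.map_intCast]
  -- Agreement at all integers suffices. Hence u·y, a root for ρ', is a root for ρ, against the
  -- choice of `u`.
  have hpp : p ρ = p ρ' := by
    refine Polynomial.eq_of_infinite_eval_eq _ _ (Set.Infinite.mono ?_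
      (Set.infinite_range_of_injective (Int.cast_injective (α := L))))
    rintro _ ⟨c, rfl⟩
    obtain ⟨P, hP⟩ := hF.exists_integralToGenericClosure_eq (k := k) hd
      (∑ i, C (u i : A) * X i - C (c : A))
    exact (hpeval ρ hρ c P hP).trans (hpeval ρ' hρ'x c P hP).symm
  have h1 : (p ρ').eval (∑ i, (u i : L) * y i) = 0 := by
    rw [Polynomial.eval_prod]
    refine Finset.prod_eq_zero (Finset.mem_univ ⟨Y₀, hY₀⟩) ?_
    rw [Polynomial.eval_sub, Polynomial.eval_C, Polynomial.eval_X, ← hy', sub_self]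
  rw [← hpp, Polynomial.eval_prod, Finset.prod_eq_zero_iff] at h1
  obtain ⟨Y, -, hY⟩ := h1
  refine hu Y ?_
  rw [Polynomial.eval_sub, Polynomial.eval_C, Polynomial.eval_X] at hY
  simpa [mul_sub, Finset.sum_sub_distrib] using hY

end Specialization

end EscapeRate
end

noncomputable section

namespace EscapeRate

open MvPolynomial

/-! ### The Jacobian does not vanish on the generic fibre -/

section Jacobian

variable {k : Type*} [Field k] [CharZero k] {N d : ℕ}

open scoped TensorProduct in
/-- The differentials of the variables are linearly independent over the closure of `k(X)`. -/
theorem linearIndependent_kaehler_toGenericClosure :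
    LinearIndependent (GenericClosure k N) fun i : Fin (N + 1) =>
      KaehlerDifferential.D k (GenericClosure k N) (toGenericClosure k N (X i)) := by
  have h1 : Algebra.FormallyEtale (MvPolynomial (Fin (N + 1)) k)
      (FractionRing (MvPolynomial (Fin (N + 1)) k)) :=
    Algebra.FormallyEtale.of_isLocalization (nonZeroDivisors _)
  have h2 : Algebra.FormallyEtale (FractionRing (MvPolynomial (Fin (N + 1)) k))
      (GenericClosure k N) := Algebra.FormallyEtale.of_isSeparable _ _
  have h3 : Algebra.FormallyEtale (MvPolynomial (Fin (N + 1)) k) (GenericClosure k N) :=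
    Algebra.FormallyEtale.comp _ (FractionRing (MvPolynomial (Fin (N + 1)) k)) _
  let e := KaehlerDifferential.tensorKaehlerEquivOfFormallyEtale k
    (MvPolynomial (Fin (N + 1)) k) (GenericClosure k N)
  let b := ((KaehlerDifferential.mvPolynomialBasis k (Fin (N + 1))).baseChange
    (GenericClosure k N)).map e
  convert b.linearIndependent using 1
  funext i
  simp only [b, e, Module.Basis.map_apply, Module.Basis.baseChange_apply,
    KaehlerDifferential.mvPolynomialBasis_apply]
  rw [← LinearEquiv.symm_apply_eq]
  exact KaehlerDifferential.tensorKaehlerEquivOfFormallyEtale_symm_D_algebraMap _ _ _ _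

theorem derivation_aeval {R S M : Type*} [CommRing R] [CommRing S] [Algebra R S] [AddCommGroup M]
    [Module S M] [Module R M] (D : Derivation R S M) {n : ℕ} (y : Fin n → S)
    (p : MvPolynomial (Fin n) R) :
    D (aeval y p) = ∑ j, aeval y (pderiv j p) • D (y j) := by
  classical
  induction p using MvPolynomial.induction_on with
  | C a => simp
  | add p q hp hq => simp [hp, hq, add_smul, Finset.sum_add_distrib]
  | mul_X p i hp =>
    simp only [map_mul, aeval_X, Derivation.leibniz, hp, smul_eq_mul, map_add, add_smul,
      Finset.sum_add_distrib, mul_smul, Finset.smul_sum, pderiv_X]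
    congr 1
    simp [Pi.single_apply, apply_ite (aeval y), ite_smul]

/-- The Jacobian determinant of `F` does not vanish on the generic fibre. -/
theorem det_pderiv_ne_zero_of_mem_genericFibre {F : Fin (N + 1) → MvPolynomial (Fin (N + 1)) k}
    {Y : Fin (N + 1) → GenericClosure k N} (hY : Y ∈ genericFibre F) :
    (Matrix.of fun i j => aeval Y (pderiv j (F i))).det ≠ 0 := by
  intro h0
  -- Differentiating X_i = F_i(Y), a left kernel vector of the Jacobian would give the relation ∑
  -- v_i dX_i = 0.
  obtain ⟨v, hv, hv0⟩ := Matrix.exists_vecMul_eq_zero_iff.mpr h0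
  refine hv (funext fun i => ?_)
  refine (Fintype.linearIndependent_iff.mp linearIndependent_kaehler_toGenericClosure v ?_) i
  have : ∀ i, KaehlerDifferential.D k (GenericClosure k N) (toGenericClosure k N (X i))
      = ∑ j, aeval Y (pderiv j (F i)) • KaehlerDifferential.D k (GenericClosure k N) (Y j) :=
    fun i => by rw [← hY i, derivation_aeval]
  simp_rw [this, Finset.smul_sum, smul_smul]
  rw [Finset.sum_comm]
  refine Finset.sum_eq_zero fun j _ => ?_
  rw [← Finset.sum_smul]
  have h1 := congrFun hv0 j
  simp only [Matrix.vecMul, dotProduct, Matrix.of_apply, Pi.zero_apply] at h1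
  rw [h1, zero_smul]

end Jacobian

/-! ### Pushforward commutes with specialization -/

section PushforwardSpecialization

variable {k : Type*} [Field k] [CharZero k] {N d : ℕ}
variable {A : Type*} [CommRing A] [Algebra A k] [IsFractionRing A k] [IsIntegrallyClosed A]
variable {F : Fin (N + 1) → MvPolynomial (Fin (N + 1)) A}

/-- The pushforward of a polynomial with coefficients in `A` has coefficients in `A`. -/
theorem IsRegularLift.exists_pushforward_eq (hF : IsRegularLift d F) (hd : 1 ≤ d)
    (Φ : MvPolynomial (Fin (N + 1)) A) :
    ∃ P : MvPolynomial (Fin (N + 1)) A, MvPolynomial.map (algebraMap A k) P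
      = pushforward (fun i => MvPolynomial.map (algebraMap A k) (F i))
          (MvPolynomial.map (algebraMap A k) Φ) := by
  obtain ⟨P, hP⟩ := hF.exists_integralToGenericClosure_eq (k := k) hd Φ
  refine ⟨P, toGenericClosure_injective ?_⟩
  rw [(hF.baseChange (algebraMap A k)).isLift.toGenericClosure_pushforward hd]
  exact hP

theorem integralToGenericClosure_of_map_eq_pushforward (hF : IsRegularLift d F) (hd : 1 ≤ d)
    {Φ P : MvPolynomial (Fin (N + 1)) A}
    (hP : map (algebraMap A k) P = pushforward (fun i => map (algebraMap A k) (F i))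
      (map (algebraMap A k) Φ)) :
    integralToGenericClosure A k N P
      = fibreProd (fun i => map (algebraMap A k) (F i)) (map (algebraMap A k) Φ) := by
  rw [← (hF.baseChange (algebraMap A k)).isLift.toGenericClosure_pushforward hd, ← hP]
  rfl

/-- Values of the specialized pushforward are products over solutions of the specialized system. -/
theorem IsRegularLift.exists_eval_pushforward {L : Type*} [Field L] [IsAlgClosed L]
    (hF : IsRegularLift d F) (hd : 1 ≤ d) (φ : A →+* L)
    {Φ P : MvPolynomial (Fin (N + 1)) A}
    (hP : MvPolynomial.map (algebraMap A k) P
      = pushforward (fun i => MvPolynomial.map (algebraMap A k) (F i))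
        (MvPolynomial.map (algebraMap A k) Φ)) (x : Fin (N + 1) → L) :
    ∃ y : Fin (genericFibre fun i => MvPolynomial.map (algebraMap A k) (F i)).ncard →
        Fin (N + 1) → L, (∀ a i, (F i).eval₂ φ (y a) = x i) ∧
      P.eval₂ φ x = ∏ a, Φ.eval₂ φ (y a) := by
  obtain ⟨ρ, hρ⟩ := exists_specialization (k := k) φ x
  have hfin := (hF.baseChange (algebraMap A k)).isLift.genericFibre_finite hd
  have := hfin.to_subtype
  let e := (Finite.equivFin (genericFibre fun i => MvPolynomial.map (algebraMap A k) (F i))).symm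
  refine ⟨fun a i => ρ (hF.integralPoint hd (e a) i),
    fun a i => eval₂_integralPoint_eq hF hd hρ (e a) i, ?_⟩
  rw [eval₂_eq_finprod hF hd hfin hρ (integralToGenericClosure_of_map_eq_pushforward hF hd hP),
    ← finprod_eq_prod_of_fintype]
  refine finprod_eq_of_bijective e.symm e.symm.bijective fun Y => ?_
  change _ = Φ.eval₂ φ fun i => ρ (hF.integralPoint hd (e (e.symm Y)) i)
  rw [Equiv.apply_symm_apply]

/-- The pushforward commutes with specialization. -/
theorem IsRegularLift.pushforward_map {k' : Type*} [Field k'] [CharZero k']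
    (hF : IsRegularLift d F) (hd : 1 ≤ d) (φ : A →+* k')
    {Φ P : MvPolynomial (Fin (N + 1)) A}
    (hP : MvPolynomial.map (algebraMap A k) P
      = pushforward (fun i => MvPolynomial.map (algebraMap A k) (F i))
        (MvPolynomial.map (algebraMap A k) Φ)) :
    pushforward (fun i => MvPolynomial.map φ (F i)) (MvPolynomial.map φ Φ)
      = MvPolynomial.map φ P := by
  -- Specialize the coefficients by φ but keep X generic: ρ then compares the generic fibres over k
  -- and over k'.
  let ψ : A →+* GenericClosure k' N := (algebraMap k' _).comp φ
  let x : Fin (N + 1) → GenericClosure k' N := fun i => toGenericClosure k' N (X i)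
  obtain ⟨ρ, hρ⟩ := exists_specialization (k := k) ψ x
  have hfin := (hF.baseChange (algebraMap A k)).isLift.genericFibre_finite hd
  have hev : ∀ (y : Fin (N + 1) → GenericClosure k' N) (p : MvPolynomial (Fin (N + 1)) A),
      p.eval₂ ψ y = aeval y (MvPolynomial.map φ p) := fun y p => by
    rw [aeval_def, eval₂_map]
  refine toGenericClosure_injective ?_
  rw [(hF.baseChange φ).isLift.toGenericClosure_pushforward hd]
  have h1 : toGenericClosure k' N (MvPolynomial.map φ P) = P.eval₂ ψ x := by
    rw [toGenericClosure_apply, hev]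
  rw [h1, eval₂_eq_finprod hF hd hfin hρ (integralToGenericClosure_of_map_eq_pushforward hF hd hP),
    fibreProd, ← finprod_set_coe_eq_finprod_mem]
  let T : (genericFibre fun i => MvPolynomial.map (algebraMap A k) (F i)) →
      genericFibre fun i => MvPolynomial.map φ (F i) := fun Y =>
    ⟨fun i => ρ (hF.integralPoint hd Y i), fun i => by
      rw [← hev]; exact eval₂_integralPoint_eq hF hd hρ Y i⟩
  -- The specialized solutions are themselves points of a generic fibre, where the Jacobian is
  -- nonzero; so no two points collide.
  have hinj := integralPoint_injective_of_det_ne_zero hF hd hρ (fun y hy => by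
    have hmem : y ∈ genericFibre fun i => MvPolynomial.map φ (F i) := fun i => by
      rw [← hev]; exact hy i
    have := det_pderiv_ne_zero_of_mem_genericFibre hmem
    have hm : (Matrix.of fun i j => (pderiv j (F i)).eval₂ ψ y) = Matrix.of fun i j =>
        aeval y (pderiv j (MvPolynomial.map φ (F i))) := by
      ext i j
      simp only [Matrix.of_apply, pderiv_map, hev]
    rw [← hm] at this
    exact this)
  have hT : Function.Bijective T := by
    refine ⟨fun Y Z h => hinj (congrArg Subtype.val h), fun y => ?_⟩
    obtain ⟨Y, hY⟩ := exists_integralPoint_eq hF hd hρ (y := y.1) (fun i => by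
      rw [hev]; exact y.2 i)
    exact ⟨Y, Subtype.ext hY⟩
  exact (finprod_eq_of_bijective T hT fun Y => (hev _ Φ)).symm

end PushforwardSpecialization

/-! ### Homogeneity, degree and nonvanishing of the pushforward -/

section Degree

variable {k : Type*} [Field k] [CharZero k] {N d : ℕ}
variable {F : Fin (N + 1) → MvPolynomial (Fin (N + 1)) k}

theorem IsLift.isRegularLift (hF : IsLift d F) : IsRegularLift d F :=
  ⟨hF.1, hF.exists_pow_relation⟩

theorem coeff_bind₁_C_mul_X {σ R : Type*} [CommRing R] (c : R) (p : MvPolynomial σ R)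
    (b : σ →₀ ℕ) :
    coeff b (bind₁ (fun i => C c * X i) p) = c ^ Finsupp.degree b * coeff b p := by
  classical
  induction p using MvPolynomial.induction_on' with
  | monomial u a =>
    have h : ∏ i ∈ u.support, (C c * X i : MvPolynomial σ R) ^ u i
        = C (c ^ Finsupp.degree u) * monomial u 1 := by
      simp_rw [mul_pow]
      rw [Finset.prod_mul_distrib, Finset.prod_pow_eq_pow_sum, monomial_eq, map_pow, C_1, one_mul]
      rfl
    rw [bind₁_monomial, h, coeff_C_mul, coeff_C_mul, coeff_monomial, coeff_monomial]
    split_ifs with hub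
    · rw [hub]; ring
    · ring
  | add p q hp hq => rw [map_add, coeff_add, coeff_add, hp, hq, mul_add]

/-- Replacing X by 2^d X replaces the fibre by twice the fibre, which multiplies the product by 2 to
the power e times the size of the fibre. On the coefficient at b the same substitution acts by
2^(d|b|). The substitution is realized on the fibre by a specialization ρ at the point 2^d X. -/
theorem IsLift.mul_degree_eq (hF : IsLift d F) (hd : 1 ≤ d) {e : ℕ}
    {Φ : MvPolynomial (Fin (N + 1)) k} (hΦ : Φ.IsHomogeneous e) {b : Fin (N + 1) →₀ ℕ}
    (hb : coeff b (pushforward F Φ) ≠ 0) :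
    d * Finsupp.degree b = e * (genericFibre F).ncard := by
  have hfin := hF.genericFibre_finite hd
  have hR := hF.isRegularLift
  have hmap : ∀ p : MvPolynomial (Fin (N + 1)) k, map (algebraMap k k) p = p :=
    fun p => MvPolynomial.map_id p
  have h2 : (2 : GenericClosure k N) ≠ 0 := two_ne_zero
  let x : Fin (N + 1) → GenericClosure k N := fun i => 2 ^ d * toGenericClosure k N (X i)
  obtain ⟨ρ, hρ⟩ := exists_specialization (k := k) (A := k)
    (algebraMap k (GenericClosure k N)) x
  have hP : integralToGenericClosure k k N (pushforward F Φ)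
      = fibreProd (fun i => map (algebraMap k k) (F i)) (map (algebraMap k k) Φ) :=
    integralToGenericClosure_of_map_eq_pushforward hR hd (by simp_rw [hmap])
  have hfin' : (genericFibre fun i => map (algebraMap k k) (F i)).Finite := by
    simp_rw [hmap]; exact hfin
  have hprod := eval₂_eq_finprod hR hd hfin' hρ hP
  let T : (genericFibre fun i => map (algebraMap k k) (F i)) →
      genericFibre fun i => map (algebraMap k k) (F i) := fun Y =>
    ⟨fun i => 2⁻¹ * ρ (hR.integralPoint hd Y i), fun i => by
      have h1 := eval₂_integralPoint_eq hR hd hρ Y i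
      change aeval _ (map (algebraMap k k) (F i)) = _
      rw [hmap, aeval_def, (hF.1 i).eval₂_mul_left, h1, ← mul_assoc, ← mul_pow,
        inv_mul_cancel₀ h2, one_pow, one_mul]⟩
  have := hfin'.to_subtype
  have hT : Function.Bijective T := by
    rw [← Finite.surjective_iff_bijective]
    intro Y
    obtain ⟨Z, hZ⟩ := exists_integralPoint_eq hR hd hρ (y := fun i => 2 * Y.1 i) (fun i => by
      rw [(hF.1 i).eval₂_mul_left]
      have : aeval Y.1 (map (algebraMap k k) (F i)) = _ := Y.2 i
      rw [hmap, aeval_def] at this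
      rw [this])
    refine ⟨Z, Subtype.ext (funext fun i => ?_)⟩
    have := congrFun hZ i
    change 2⁻¹ * ρ (hR.integralPoint hd Z i) = _
    rw [this, ← mul_assoc, inv_mul_cancel₀ h2, one_mul]
  have hscale : (pushforward F Φ).eval₂ (algebraMap k (GenericClosure k N)) x
      = 2 ^ (e * (genericFibre F).ncard) * toGenericClosure k N (pushforward F Φ) := by
    rw [hprod, finprod_eq_of_bijective (g := fun Y => 2 ^ e * aeval Y.1 Φ) T hT (fun Y => by
      simp only [T]
      rw [aeval_def, hΦ.eval₂_mul_left, ← mul_assoc, ← mul_pow, mul_inv_cancel₀ h2, one_pow,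
        one_mul])]
    rw [finprod_mul_distrib (Set.toFinite _) (Set.toFinite _),
      finprod_set_coe_eq_finprod_mem (f := fun Y => aeval Y Φ)
        (genericFibre fun i => map (algebraMap k k) (F i))]
    have hmapF : (fun i => map (algebraMap k k) (F i)) = F := funext fun i => hmap _
    rw [hF.toGenericClosure_pushforward hd, fibreProd]
    simp_rw [hmapF]
    congr 1
    have := Fintype.ofFinite (genericFibre fun i => map (algebraMap k k) (F i))
    rw [finprod_eq_prod_of_fintype, Finset.prod_const, pow_mul, Finset.card_univ,
      ← Nat.card_eq_fintype_card]
    congr 1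
    change (genericFibre fun i => map (algebraMap k k) (F i)).ncard = _
    rw [hmapF]
  have hpoly : bind₁ (fun i => C ((2 : k) ^ d) * X i) (pushforward F Φ)
      = C ((2 : k) ^ (e * (genericFibre F).ncard)) * pushforward F Φ := by
    refine toGenericClosure_injective ?_
    rw [map_mul, toGenericClosure_C, map_pow (algebraMap k _), map_ofNat, ← hscale, toGenericClosure_apply,
      aeval_bind₁, aeval_def]
    congr 1
    funext i
    simp [x, map_ofNat (algebraMap k (GenericClosure k N)) 2]
  have hcoef := congrArg (coeff b) hpoly
  rw [coeff_C_mul] at hcoef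
  have hb1 : coeff b (bind₁ (fun i => C ((2 : k) ^ d) * X i) (pushforward F Φ))
      = ((2 : k) ^ d) ^ (Finsupp.degree b) * coeff b (pushforward F Φ) :=
    coeff_bind₁_C_mul_X _ _ _
  rw [hb1] at hcoef
  have h3 := mul_right_cancel₀ hb hcoef
  rw [← pow_mul] at h3
  exact Nat.pow_right_injective le_rfl (by exact_mod_cast h3)

/-- A vanishing factor Φ(Y) is impossible, since the coordinates of Y satisfy no algebraic relation
over k. -/
theorem IsLift.pushforward_ne_zero (hF : IsLift d F) (hd : 1 ≤ d)
    {Φ : MvPolynomial (Fin (N + 1)) k} (hΦ : Φ ≠ 0) : pushforward F Φ ≠ 0 := by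
  intro h0
  have h := hF.toGenericClosure_pushforward hd Φ
  rw [h0, map_zero, fibreProd, finprod_mem_eq_finite_toFinset_prod _ (hF.genericFibre_finite hd)]
    at h
  obtain ⟨Y, hY, hY0⟩ := Finset.prod_eq_zero_iff.mp h.symm
  refine hΦ (hF.aeval_injective_of_mem hd ((Set.Finite.mem_toFinset _).mp hY) ?_)
  rw [hY0, map_zero]

/-- The degree of the pushforward. -/
theorem IsLift.exists_isHomogeneous_pushforward (hF : IsLift d F) (hd : 1 ≤ d) {e : ℕ}
    {Φ : MvPolynomial (Fin (N + 1)) k} (hΦ : Φ.IsHomogeneous e) (hΦ0 : Φ ≠ 0) :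
    ∃ e', d * e' = e * (genericFibre F).ncard ∧ (pushforward F Φ).IsHomogeneous e' := by
  obtain ⟨b, hb⟩ := ne_zero_iff.mp (hF.pushforward_ne_zero hd hΦ0)
  refine ⟨b.degree, hF.mul_degree_eq hd hΦ hb, fun c hc => ?_⟩
  have := Nat.eq_of_mul_eq_mul_left (by omega)
    ((hF.mul_degree_eq hd hΦ hc).trans (hF.mul_degree_eq hd hΦ hb).symm)
  rw [← this, Finsupp.degree_eq_weight_one]
  rfl

end Degree

end EscapeRate
end

noncomputable section

namespace EscapeRate

open MvPolynomial

/-! ### The generic fibre has at most d^(N+1) points -/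

section FibreCard

/-- The exponents of degree at most `m` in `n` variables. -/
def exponentsLE (n m : ℕ) : Finset (Fin n →₀ ℕ) :=
  (Finsupp.finite_of_degree_le (σ := Fin n) m).toFinset

theorem mem_exponentsLE {n m : ℕ} {b : Fin n →₀ ℕ} :
    b ∈ exponentsLE n m ↔ Finsupp.degree b ≤ m := by
  simp [exponentsLE]

theorem card_exponentsLE_le (n m : ℕ) : (exponentsLE n m).card ≤ (m + 1) ^ n := by
  have : (exponentsLE n m).card ≤ (Finset.univ : Finset (Fin n → Fin (m + 1))).card := by
    refine Finset.card_le_card_of_injOn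
      (fun b i => Fin.ofNat (m + 1) (b i)) (fun _ _ => Finset.mem_univ _) ?_
    intro a ha b hb hab
    ext i
    have h := congrArg Fin.val (congrFun hab i)
    have h1 : ∀ c ∈ exponentsLE n m, c i < m + 1 := fun c hc =>
      Nat.lt_succ_of_le ((Finsupp.le_degree i c).trans (mem_exponentsLE.mp hc))
    simpa [Fin.ofNat, Nat.mod_eq_of_lt (h1 a ha), Nat.mod_eq_of_lt (h1 b hb)] using h
  simpa using this

/-- Division with remainder by d in every exponent; the quotients have degree at most m + c. -/
theorem card_exponentsLE_mul_le (n m c d : ℕ) (hd : 1 ≤ d) :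
    (exponentsLE n (d * m + c)).card ≤ d ^ n * (exponentsLE n (m + c)).card := by
  classical
  have : NeZero d := ⟨by omega⟩
  have : (exponentsLE n (d * m + c)).card
      ≤ ((Finset.univ : Finset (Fin n → Fin d)) ×ˢ exponentsLE n (m + c)).card := by
    refine Finset.card_le_card_of_injOn
      (fun b => (fun i => Fin.ofNat d (b i), Finsupp.equivFunOnFinite.symm fun i => b i / d)) ?_ ?_
    · intro b hb
      simp only [Finset.coe_product, Set.mem_prod, Finset.mem_coe, Finset.mem_univ, true_and]
      have hb := mem_exponentsLE.mp (Finset.mem_coe.mp hb)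
      rw [mem_exponentsLE, Finsupp.degree_eq_sum]
      rw [Finsupp.degree_eq_sum] at hb
      have h1 : d * ∑ i, b i / d ≤ ∑ i, b i := by
        rw [Finset.mul_sum]
        exact Finset.sum_le_sum fun i _ => Nat.mul_div_le _ _
      have h2 : d * ∑ i, b i / d ≤ d * (m + c) := by nlinarith
      exact Nat.le_of_mul_le_mul_left h2 (by omega)
    · intro a _ b _ hab
      simp only [Prod.mk.injEq] at hab
      ext i
      have h1 := congrArg Fin.val (congrFun hab.1 i)
      have h2 := DFunLike.congr_fun hab.2 i
      simp only [Fin.ofNat, Finsupp.equivFunOnFinite_symm_apply_apply] at h1 h2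
      rw [← Nat.div_add_mod (a i) d, h1, h2, Nat.div_add_mod]
  simpa using this

variable {k : Type*} [Field k] [CharZero k] {N d : ℕ}
variable {F : Fin (N + 1) → MvPolynomial (Fin (N + 1)) k}

theorem totalDegree_aeval_le_of_isHomogeneous (hF : ∀ i, (F i).IsHomogeneous d)
    {p : MvPolynomial (Fin (N + 1)) k} {m : ℕ} (hp : p.totalDegree ≤ m) :
    (aeval F p).totalDegree ≤ d * m := by
  rw [p.as_sum, map_sum]
  refine totalDegree_finsetSum_le fun b hb => ?_
  have h1 : (aeval F (monomial b (coeff b p))).IsHomogeneous (d * Finsupp.degree b) := by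
    rw [aeval_monomial, ← zero_add (d * _)]
    refine (isHomogeneous_C _ _).mul ?_
    rw [Finsupp.degree_eq_sum, Finset.mul_sum, Finsupp.prod_fintype _ _ (by simp)]
    exact IsHomogeneous.prod _ _ _ fun i _ => by
      simpa using (hF i).pow (b i)
  refine h1.totalDegree_le.trans (Nat.mul_le_mul_left _ ?_)
  exact (le_totalDegree hb).trans hp

/-- The comparison of dimensions behind the bound on the size of the generic fibre. -/
theorem IsLift.ncard_mul_card_exponentsLE_le (hF : IsLift d F) (hd : 1 ≤ d) (m : ℕ) :
    (genericFibre F).ncard * (exponentsLE (N + 1) m).card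
      ≤ (exponentsLE (N + 1) (d * m + (genericFibre F).ncard)).card := by
  classical
  have hfin := hF.genericFibre_finite hd
  have := hfin.to_subtype
  set D := (genericFibre F).ncard with hD
  obtain ⟨u, hu⟩ := exists_int_vector_ne_zero
    (fun p : {p : genericFibre F × genericFibre F // p.1 ≠ p.2} => p.1.1.1 - p.1.2.1)
    (fun p h0 => p.2 (Subtype.ext (sub_eq_zero.mp h0)))
  let l : MvPolynomial (Fin (N + 1)) k := ∑ i, C (u i : k) * X i
  have hl : l.totalDegree ≤ 1 := by
    refine totalDegree_finsetSum_le fun i _ => ?_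
    refine (totalDegree_mul _ _).trans ?_
    rw [totalDegree_C, totalDegree_X]
  have hlinj : Function.Injective fun Y : genericFibre F => aeval Y.1 l := by
    intro Y Z hYZ
    by_contra hne
    refine hu ⟨(Y, Z), hne⟩ ?_
    have h : aeval Y.1 l - aeval Z.1 l = 0 := sub_eq_zero.mpr hYZ
    simp only [l, map_sum, map_mul, aeval_X, map_intCast] at h
    simpa [mul_sub, Finset.sum_sub_distrib] using h
  let E := exponentsLE (N + 1) m
  let a : (Fin D × E → k) → Fin D → MvPolynomial (Fin (N + 1)) k :=
    fun c i => ∑ b : E, monomial b.1 (c (i, b))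
  -- The map (a_i) ↦ ∑_{i<D} a_i(F) l^i. At a point Y of the fibre its value is ∑ a_i(X) l(Y)^i; as
  -- l takes D distinct values on the fibre, a polynomial of degree less than D is determined, so
  -- the map is injective. Its values have degree at most dm + D.
  let T₀ : (Fin D × E → k) →ₗ[k] MvPolynomial (Fin (N + 1)) k :=
    { toFun := fun c => ∑ i : Fin D, aeval F (a c i) * l ^ (i : ℕ)
      map_add' := fun c c' => by
        simp [a, Finset.sum_add_distrib, add_mul]
      map_smul' := fun r c => by
        simp only [a, Pi.smul_apply, RingHom.id_apply, Finset.smul_sum, ← smul_mul_assoc]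
        refine Finset.sum_congr rfl fun i _ => ?_
        rw [← map_smul, Finset.smul_sum]
        simp [smul_monomial] }
  have hT₀ : ∀ c, T₀ c = 0 → c = 0 := by
    intro c hc
    have ha : ∀ i, a c i = 0 := by
      let q : Polynomial (GenericClosure k N) :=
        ∑ i : Fin D, Polynomial.C (toGenericClosure k N (a c i)) * Polynomial.X ^ (i : ℕ)
      have hq : q = 0 := by
        have := Fintype.ofFinite (genericFibre F)
        by_contra hq0
        refine hq0 (Polynomial.eq_zero_of_natDegree_lt_card_of_eval_eq_zero q hlinj
          (fun Y => ?_) ?_)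
        · have h := congrArg (aeval Y.1) hc
          simp only [T₀, LinearMap.coe_mk, AddHom.coe_mk, map_sum, map_mul, map_pow, map_zero,
            aeval_comp_of_mem_genericFibre Y.2] at h
          simpa [q, Polynomial.eval_finsetSum] using h
        · have hcard : Fintype.card (genericFibre F) = D := by
            rw [← Nat.card_eq_fintype_card]; rfl
          rw [hcard]
          exact (Polynomial.natDegree_lt_iff_degree_lt hq0).mpr (Polynomial.degree_sum_fin_lt _)
      intro i
      have := congrArg (fun p => Polynomial.coeff p (i : ℕ)) hq
      simp only [q, Polynomial.finsetSum_coeff, Polynomial.coeff_C_mul, Polynomial.coeff_X_pow,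
        Polynomial.coeff_zero, Fin.val_inj] at this
      refine toGenericClosure_injective ?_
      simpa using this
    funext ⟨i, b⟩
    have := congrArg (coeff b.1) (ha i)
    simpa [a, coeff_sum, coeff_monomial, Subtype.val_inj] using this
  let E' := exponentsLE (N + 1) (d * m + D)
  let T : (Fin D × E → k) →ₗ[k] (E' → k) :=
    LinearMap.pi fun b => (lcoeff k b.1).comp T₀
  have hTinj : Function.Injective T := by
    rw [← LinearMap.ker_eq_bot, LinearMap.ker_eq_bot']
    intro c hc
    refine hT₀ c (MvPolynomial.ext _ _ fun b => ?_)
    rw [coeff_zero]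
    by_cases hb : b ∈ E'
    · exact congrFun hc ⟨b, hb⟩
    · refine coeff_eq_zero_of_totalDegree_lt ?_
      have hb' := not_le.mp (mt mem_exponentsLE.mpr hb)
      refine lt_of_le_of_lt ?_ hb'
      refine totalDegree_finsetSum_le fun i _ => (totalDegree_mul _ _).trans (add_le_add ?_ ?_)
      · refine totalDegree_aeval_le_of_isHomogeneous hF.1 (totalDegree_finsetSum_le fun b _ => ?_)
        exact (totalDegree_monomial_le _ _).trans (mem_exponentsLE.mp b.2)
      · refine (totalDegree_pow _ _).trans ?_
        nlinarith [i.2]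
  have := LinearMap.finrank_le_finrank_of_injective hTinj
  simpa [E, E'] using this

/-- A weak form of Bézout's theorem: the generic fibre has at most `d ^ (N + 1)` points. -/
theorem IsLift.ncard_genericFibre_le (hF : IsLift d F) (hd : 1 ≤ d) :
    (genericFibre F).ncard ≤ d ^ (N + 1) := by
  set D := (genericFibre F).ncard with hD
  set f : ℕ → ℕ := fun m => (exponentsLE (N + 1) m).card with hf
  by_contra! hlt
  -- If D exceeded d^(N+1), this would force the polynomially bounded count `f` to grow
  -- exponentially along multiples of D.
  have hstep : ∀ m, D * f m ≤ d ^ (N + 1) * f (m + D) := fun m =>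
    (hF.ncard_mul_card_exponentsLE_le hd m).trans (card_exponentsLE_mul_le _ _ _ _ hd)
  have hpos : 0 < (d : ℝ) ^ (N + 1) := by positivity
  set r : ℝ := D / (d : ℝ) ^ (N + 1) with hr
  have hr1 : 1 < r := by
    rw [hr, one_lt_div hpos]; exact_mod_cast hlt
  have hgrow : ∀ j : ℕ, r ^ j ≤ f (j * D) := fun j => by
    induction j with
    | zero =>
      have : 1 ≤ f 0 := Finset.card_pos.mpr ⟨0, mem_exponentsLE.mpr (by simp)⟩
      simpa using this
    | succ j ih =>
      have h1 : (D : ℝ) * f (j * D) ≤ (d : ℝ) ^ (N + 1) * f ((j + 1) * D) := by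
        have := hstep (j * D)
        rw [← Nat.succ_mul] at this
        exact_mod_cast this
      calc r ^ (j + 1) = r * r ^ j := pow_succ' _ _
        _ ≤ r * f (j * D) := by gcongr
        _ = (D : ℝ) * f (j * D) / (d : ℝ) ^ (N + 1) := by rw [hr]; ring
        _ ≤ f ((j + 1) * D) := by rw [div_le_iff₀ hpos, mul_comm]; linarith
  have hpoly : ∀ j : ℕ, 1 ≤ j → r ^ j ≤ ((D : ℝ) + 1) ^ (N + 1) * (j : ℝ) ^ (N + 1) := fun j hj => by
    refine (hgrow j).trans ?_
    have h1 : (f (j * D) : ℝ) ≤ ((j * D + 1 : ℕ) : ℝ) ^ (N + 1) := by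
      exact_mod_cast card_exponentsLE_le (N + 1) (j * D)
    refine h1.trans ?_
    rw [← mul_pow]
    have hj' : (1 : ℝ) ≤ j := by exact_mod_cast hj
    refine pow_le_pow_left₀ (by positivity) ?_ _
    push_cast
    nlinarith
  have hlim := tendsto_pow_const_div_const_pow_of_one_lt (N + 1) hr1
  have hC : 0 < 1 / ((D : ℝ) + 1) ^ (N + 1) := by positivity
  obtain ⟨j, hj1, hj2⟩ := ((hlim.eventually_lt_const hC).and (eventually_ge_atTop 1)).exists
  have hrj : 0 < r ^ j := by positivity
  rw [div_lt_div_iff₀ hrj (by positivity)] at hj1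
  have := hpoly j hj2
  linarith

end FibreCard

end EscapeRate
end

noncomputable section

namespace EscapeRate

open MvPolynomial MeasureTheory

/-! ### Volume of the set where a complex polynomial is small -/

section SmallValues

theorem norm_coeff_prod_X_sub_C_le (s : Multiset ℂ) (i : ℕ) :
    ‖((s.map fun a => Polynomial.X - Polynomial.C a).prod).coeff i‖
      ≤ (s.map fun a => 1 + ‖a‖).prod := by
  induction s using Multiset.induction_on generalizing i with
  | empty =>
    simp only [Multiset.map_zero, Multiset.prod_zero, Polynomial.coeff_one]
    split_ifs <;> simp
  | cons a s ih =>
    rw [Multiset.map_cons, Multiset.prod_cons, Multiset.map_cons, Multiset.prod_cons, sub_mul,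
      Polynomial.coeff_sub, Polynomial.coeff_C_mul, add_mul, one_mul]
    refine (norm_sub_le _ _).trans (add_le_add ?_ ?_)
    · cases i with
      | zero =>
        rw [Polynomial.coeff_X_mul_zero, norm_zero]
        exact (norm_nonneg _).trans (ih 0)
      | succ i => rw [Polynomial.coeff_X_mul]; exact ih i
    · rw [norm_mul]
      exact mul_le_mul_of_nonneg_left (ih i) (norm_nonneg _)

/-- A polynomial is not small away from small discs around its roots. -/
theorem le_norm_eval_of_forall_roots {p : Polynomial ℂ} {e : ℕ}
    (hp : p.natDegree ≤ e) {η : ℝ} (hη0 : 0 < η) (hη1 : η ≤ 1) {z : ℂ}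
    (hz : ∀ a ∈ p.roots, η * (1 + ‖a‖) ≤ ‖z - a‖) (i : ℕ) :
    η ^ e * ‖p.coeff i‖ ≤ ‖p.eval z‖ := by
  have hsp := (IsAlgClosed.splits p).eq_prod_roots
  have hcard : p.roots.card = p.natDegree := IsAlgClosed.card_roots_eq_natDegree
  set l := p.leadingCoeff
  have h1 : ‖p.coeff i‖ ≤ ‖l‖ * (p.roots.map fun a => 1 + ‖a‖).prod := by
    conv_lhs => rw [hsp]
    rw [Polynomial.coeff_C_mul, norm_mul]
    exact mul_le_mul_of_nonneg_left (norm_coeff_prod_X_sub_C_le _ _) (norm_nonneg _)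
  have h2 : ‖p.eval z‖ = ‖l‖ * (p.roots.map fun a => ‖z - a‖).prod := by
    conv_lhs => rw [hsp]
    rw [Polynomial.eval_mul, Polynomial.eval_C, norm_mul, Polynomial.eval_multiset_prod,
      ← normHom_apply, ← normHom_apply, map_multiset_prod, Multiset.map_map, Multiset.map_map]
    simp
  have h3 : (p.roots.map fun a => η * (1 + ‖a‖)).prod ≤ (p.roots.map fun a => ‖z - a‖).prod :=
    Multiset.prod_map_le_prod_map₀ _ _ (fun a _ => by positivity) hz
  rw [Multiset.prod_map_mul, Multiset.map_const', Multiset.prod_replicate, hcard] at h3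
  have hnn : 0 ≤ (p.roots.map fun a => 1 + ‖a‖).prod :=
    Multiset.prod_nonneg (by simp only [Multiset.mem_map]; rintro _ ⟨a, _, rfl⟩; positivity)
  calc η ^ e * ‖p.coeff i‖ ≤ η ^ p.natDegree * (‖l‖ * (p.roots.map fun a => 1 + ‖a‖).prod) := by
        refine mul_le_mul (pow_le_pow_of_le_one hη0.le hη1 hp) h1 (norm_nonneg _) (by positivity)
    _ = ‖l‖ * (η ^ p.natDegree * (p.roots.map fun a => 1 + ‖a‖).prod) := by ring
    _ ≤ ‖p.eval z‖ := by
        rw [h2]; exact mul_le_mul_of_nonneg_left h3 (norm_nonneg _)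

/-- The set of points of a disc where a univariate polynomial is small has small area. -/
theorem volume_univariate_small_le (p : Polynomial ℂ) {e : ℕ} (hp : p.natDegree ≤ e) {η r : ℝ}
    (hη0 : 0 < η) (hη1 : η ≤ 1 / 2) (hr : 1 ≤ r) (i : ℕ) :
    volume {z : ℂ | ‖z‖ ≤ r ∧ ‖p.eval z‖ < η ^ e * ‖p.coeff i‖}
      ≤ e * ENNReal.ofReal (4 * η) ^ 2 * (ENNReal.ofReal r ^ 2 * NNReal.pi) := by
  classical
  rcases eq_or_ne p 0 with rfl | hp0
  · simp
  have hsub : {z : ℂ | ‖z‖ ≤ r ∧ ‖p.eval z‖ < η ^ e * ‖p.coeff i‖}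
      ⊆ ⋃ a ∈ p.roots.toFinset, Metric.ball a (4 * η * r) := by
    rintro z ⟨hzr, hz⟩
    have hex : ∃ a ∈ p.roots, ‖z - a‖ < η * (1 + ‖a‖) := by
      by_contra! hcon
      exact not_le.mpr hz (le_norm_eval_of_forall_roots hp hη0 (by linarith) hcon i)
    obtain ⟨a, ha, hza⟩ := hex
    simp only [Set.mem_iUnion, Multiset.mem_toFinset]
    refine ⟨a, ha, ?_⟩
    rw [mem_ball_iff_norm]
    have h1 : ‖a‖ ≤ ‖z‖ + ‖z - a‖ := by
      have := norm_sub_le z (z - a)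
      simpa using this
    -- As η ≤ 1/2, a root a this close to z has |a| ≤ 2r + 1, so every relevant disc has radius at
    -- most 4ηr whatever the root.
    have h2 : η * (1 + ‖a‖) ≤ 1 / 2 * (1 + ‖a‖) := by gcongr
    have h3 : ‖a‖ ≤ 2 * r + 1 := by linarith
    refine hza.trans_le ?_
    nlinarith
  have hcard : (p.roots.toFinset.card : ENNReal) ≤ e := by
    exact_mod_cast (Multiset.toFinset_card_le _).trans ((Polynomial.card_roots' p).trans hp)
  calc volume {z : ℂ | ‖z‖ ≤ r ∧ ‖p.eval z‖ < η ^ e * ‖p.coeff i‖}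
      ≤ ∑ a ∈ p.roots.toFinset, volume (Metric.ball a (4 * η * r)) :=
        (measure_mono hsub).trans (measure_biUnion_finset_le _ _)
    _ = p.roots.toFinset.card * (ENNReal.ofReal (4 * η * r) ^ 2 * NNReal.pi) := by
        simp [Complex.volume_ball]
    _ ≤ e * (ENNReal.ofReal (4 * η * r) ^ 2 * NNReal.pi) := by gcongr
    _ = _ := by
        rw [ENNReal.ofReal_mul (by positivity : 0 ≤ 4 * η)]; ring

theorem volume_pi_closedBall_complex (n : ℕ) {r : ℝ} (hr : 0 ≤ r) :
    volume (Metric.closedBall (0 : Fin n → ℂ) r) = (ENNReal.ofReal r ^ 2 * NNReal.pi) ^ n := by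
  rw [closedBall_pi _ hr, volume_pi_pi]
  simp [Complex.volume_closedBall]

/-- The set of points of a polydisc where a polynomial is small has small volume. -/
theorem volume_small_le {n : ℕ} (P : MvPolynomial (Fin n) ℂ) {e : ℕ} (hP : P.totalDegree ≤ e)
    {η r : ℝ} (hη0 : 0 < η) (hη1 : η ≤ 1 / 2) (hr : 1 ≤ r) (m : Fin n →₀ ℕ) :
    volume {y : Fin n → ℂ | ‖y‖ ≤ r ∧ ‖eval y P‖ < η ^ (n * e) * ‖coeff m P‖}
      ≤ n * e * ENNReal.ofReal (4 * η) ^ 2 * (ENNReal.ofReal r ^ 2 * NNReal.pi) ^ n := by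
  induction n with
  | zero =>
    have : {y : Fin 0 → ℂ | ‖y‖ ≤ r ∧ ‖eval y P‖ < η ^ (0 * e) * ‖coeff m P‖} = ∅ := by
      ext y
      simp only [zero_mul, pow_zero, one_mul, Set.mem_ofPred_eq, Set.mem_empty_iff_false, iff_false,
        not_and, not_lt]
      intro _
      obtain ⟨c, rfl⟩ := C_surjective (Fin 0) P
      rw [eval_C, Subsingleton.elim m 0, coeff_zero_C]
    rw [this]
    simp
  | succ n ih =>
    set V := ENNReal.ofReal r ^ 2 * NNReal.pi with hV
    set c := (e : ENNReal) * ENNReal.ofReal (4 * η) ^ 2 with hc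
    let Q := finSuccEquiv ℂ n P
    let i := m 0
    let m' := m.tail
    have hcoef : coeff m' (Q.coeff i) = coeff m P := by
      rw [finSuccEquiv_coeff_coeff, Finsupp.cons_tail]
    have hQi : (Q.coeff i).totalDegree ≤ e := by
      by_cases h0 : Q.coeff i = 0
      · rw [h0]; simp
      · have := totalDegree_coeff_finSuccEquiv_add_le P i h0
        exact (le_self_add.trans this).trans hP
    have ih' := ih (Q.coeff i) hQi m'
    rw [hcoef] at ih'
    -- Expand P in powers of y₀. Where P is small, either the coefficient of y₀^i is already small
    -- (`B'`, by induction) or P is small relative to that coefficient (`W`, by the univariate bound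
    -- on slices and Fubini).
    set B' := {y : Fin n → ℂ | ‖y‖ ≤ r ∧ ‖eval y (Q.coeff i)‖ < η ^ (n * e) * ‖coeff m P‖}
    let W : Set (ℂ × (Fin n → ℂ)) := {p | ‖p.1‖ ≤ r ∧ ‖p.2‖ ≤ r ∧
      ‖eval (Fin.cons p.1 p.2 : Fin (n + 1) → ℂ) P‖ < η ^ e * ‖eval p.2 (Q.coeff i)‖}
    have hWmeas : MeasurableSet W := by
      have hc1 : Continuous fun p : ℂ × (Fin n → ℂ) => (Fin.cons p.1 p.2 : Fin (n + 1) → ℂ) := by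
        refine continuous_pi fun j => ?_
        refine Fin.cases ?_ (fun j => ?_) j
        · simpa using continuous_fst
        · simp only [Fin.cons_succ]
          fun_prop
      have h1 : IsClosed {p : ℂ × (Fin n → ℂ) | ‖p.1‖ ≤ r} :=
        isClosed_le (continuous_norm.comp continuous_fst) continuous_const
      have h2 : IsClosed {p : ℂ × (Fin n → ℂ) | ‖p.2‖ ≤ r} :=
        isClosed_le (continuous_norm.comp continuous_snd) continuous_const
      have h3 : IsOpen {p : ℂ × (Fin n → ℂ) | ‖eval (Fin.cons p.1 p.2 : Fin (n + 1) → ℂ) P‖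
          < η ^ e * ‖eval p.2 (Q.coeff i)‖} :=
        isOpen_lt (continuous_norm.comp ((MvPolynomial.continuous_eval P).comp hc1))
          (continuous_const.mul (continuous_norm.comp
            ((MvPolynomial.continuous_eval _).comp continuous_snd)))
      exact h1.measurableSet.inter (h2.measurableSet.inter h3.measurableSet)
    have hW : volume W ≤ c * V ^ (n + 1) := by
      rw [Measure.volume_eq_prod, Measure.prod_apply_symm hWmeas]
      calc ∫⁻ w : Fin n → ℂ, volume ((fun z : ℂ => (z, w)) ⁻¹' W)
          ≤ ∫⁻ w : Fin n → ℂ, (Metric.closedBall (0 : Fin n → ℂ) r).indicator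
              (fun _ => c * V) w := by
            refine lintegral_mono fun w => ?_
            by_cases hw : ‖w‖ ≤ r
            · rw [Set.indicator_of_mem (by simpa using hw)]
              refine (measure_mono ?_).trans (volume_univariate_small_le
                (Q.map (eval w)) (e := e) ?_ hη0 hη1 hr i)
              · rintro z ⟨h1, _, h3⟩
                refine ⟨h1, ?_⟩
                rw [eval_eq_eval_mv_eval'] at h3
                rwa [Polynomial.coeff_map]
              · refine Polynomial.natDegree_map_le.trans ?_
                rw [natDegree_finSuccEquiv]
                exact (degreeOf_le_totalDegree _ _).trans hP
            · have : (fun z : ℂ => (z, w)) ⁻¹' W = ∅ := by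
                ext z
                simp only [Set.mem_preimage, Set.mem_empty_iff_false, iff_false]
                exact fun h => hw h.2.1
              rw [this]; simp
        _ = c * V ^ (n + 1) := by
            rw [lintegral_indicator_const Metric.isClosed_closedBall.measurableSet,
              volume_pi_closedBall_complex _ (by linarith), ← hV]
            ring
    have hmp := volume_preserving_piFinSuccAbove (fun _ : Fin (n + 1) => ℂ) 0
    have hsub : {y : Fin (n + 1) → ℂ | ‖y‖ ≤ r ∧
        ‖eval y P‖ < η ^ ((n + 1) * e) * ‖coeff m P‖}
        ⊆ (MeasurableEquiv.piFinSuccAbove (fun _ : Fin (n + 1) => ℂ) 0) ⁻¹'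
          (Metric.closedBall (0 : ℂ) r ×ˢ B' ∪ W) := by
      rintro y ⟨hy1, hy2⟩
      have hy0 : ‖y 0‖ ≤ r := (norm_le_pi_norm y 0).trans hy1
      have hyt : ‖Fin.tail y‖ ≤ r := by
        rw [pi_norm_le_iff_of_nonneg (by linarith)]
        exact fun j => (norm_le_pi_norm y j.succ).trans hy1
      change ((y 0, Fin.tail y) : ℂ × (Fin n → ℂ)) ∈ Metric.closedBall (0 : ℂ) r ×ˢ B' ∪ W
      by_cases hB : Fin.tail y ∈ B'
      · left
        exact ⟨by simpa using hy0, hB⟩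
      · right
        refine ⟨hy0, hyt, ?_⟩
        have h1 : η ^ (n * e) * ‖coeff m P‖ ≤ ‖eval (Fin.tail y) (Q.coeff i)‖ := by
          by_contra! hlt
          exact hB ⟨hyt, hlt⟩
        simp only [Fin.cons_self_tail]
        refine hy2.trans_le ?_
        rw [add_mul, one_mul, pow_add, mul_comm (η ^ (n * e)), mul_assoc]
        gcongr
    calc volume {y : Fin (n + 1) → ℂ | ‖y‖ ≤ r ∧ ‖eval y P‖ < η ^ ((n + 1) * e) * ‖coeff m P‖}
        ≤ volume (Metric.closedBall (0 : ℂ) r ×ˢ B' ∪ W) := by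
          refine (measure_mono hsub).trans ?_
          rw [hmp.measure_preimage_equiv]
      _ ≤ volume (Metric.closedBall (0 : ℂ) r ×ˢ B') + volume W := measure_union_le _ _
      _ ≤ V * (n * c * V ^ n) + c * V ^ (n + 1) := by
          refine add_le_add ?_ hW
          rw [Measure.volume_eq_prod, Measure.prod_prod, Complex.volume_closedBall, ← hV]
          refine mul_le_mul_right ?_ V
          rw [hc, ← mul_assoc]
          exact ih'
      _ = ((n + 1 : ℕ) : ENNReal) * e * ENNReal.ofReal (4 * η) ^ 2 * V ^ (n + 1) := by
          rw [hc]; push_cast; ring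

/-- Volume is a multiple of the Hausdorff measure in the real dimension 2n, which scales by the
corresponding power of the Lipschitz constant. -/
theorem volume_image_le_of_lipschitzOn {n : ℕ} {f : (Fin n → ℂ) → Fin n → ℂ}
    {s : Set (Fin n → ℂ)} {K : NNReal} (hf : LipschitzOnWith K f s) :
    volume (f '' s) ≤ (K : ENNReal) ^ (2 * n) * volume s := by
  have hfr : Module.finrank ℝ (Fin n → ℂ) = 2 * n := by
    rw [Module.finrank_pi_fintype]; simp [mul_comm]
  let μ : Measure (Fin n → ℂ) := Measure.hausdorffMeasure (Module.finrank ℝ (Fin n → ℂ) : ℝ)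
  have hμ : (volume : Measure (Fin n → ℂ)) = (volume : Measure (Fin n → ℂ)).addHaarScalarFactor μ • μ :=
    Measure.isAddLeftInvariant_eq_smul _ _
  have h1 : μ (f '' s) ≤ (K : ENNReal) ^ (2 * n) * μ s := by
    have := hf.hausdorffMeasure_image_le (d := (Module.finrank ℝ (Fin n → ℂ) : ℝ)) (by positivity)
    rw [ENNReal.rpow_natCast, hfr] at this
    simpa [μ, hfr] using this
  rw [hμ, Measure.smul_apply, Measure.smul_apply, mul_smul_comm]
  gcongr

/-- There is a point of the unit polydisc at all of whose preimages `P` is not small. -/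
theorem exists_forall_preimage_le {n : ℕ} (P : MvPolynomial (Fin n) ℂ) {e : ℕ}
    (hP : P.totalDegree ≤ e) {η r : ℝ} (hη0 : 0 < η) (hη1 : η ≤ 1 / 2) (hr : 1 ≤ r)
    (m : Fin n →₀ ℕ) {f : (Fin n → ℂ) → Fin n → ℂ} {K : NNReal}
    (hf : LipschitzOnWith K f (Metric.closedBall 0 r))
    (hsmall : (K : ℝ) ^ (2 * n) * (n * e * (4 * η) ^ 2 * r ^ (2 * n)) < 1) :
    ∃ x : Fin n → ℂ, ‖x‖ ≤ 1 ∧ ∀ y, ‖y‖ ≤ r → f y = x →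
      η ^ (n * e) * ‖coeff m P‖ ≤ ‖eval y P‖ := by
  by_contra! hcon
  set E := {y : Fin n → ℂ | ‖y‖ ≤ r ∧ ‖eval y P‖ < η ^ (n * e) * ‖coeff m P‖} with hE
  -- Otherwise every point of the unit polydisc has a bad preimage, and the image of the bad set is
  -- too small to cover the polydisc.
  have hsub : Metric.closedBall (0 : Fin n → ℂ) 1 ⊆ f '' E := fun x hx => by
    obtain ⟨y, hy1, hy2, hy3⟩ := hcon x (by simpa using hx)
    exact ⟨y, ⟨hy1, hy3⟩, hy2⟩
  have hEf : LipschitzOnWith K f E := hf.mono fun y hy => by simpa using hy.1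
  have h1 := (measure_mono hsub).trans ((volume_image_le_of_lipschitzOn hEf).trans
    (mul_le_mul_right (volume_small_le P hP hη0 hη1 hr m) _))
  rw [volume_pi_closedBall_complex _ zero_le_one] at h1
  simp only [ENNReal.ofReal_one, one_pow, one_mul] at h1
  have hpi : ((NNReal.pi : ENNReal)) ^ n ≠ 0 := by
    refine pow_ne_zero _ ?_
    rw [ENNReal.coe_ne_zero]
    exact NNReal.pi_pos.ne'
  have hpi' : ((NNReal.pi : ENNReal)) ^ n ≠ ⊤ := ENNReal.pow_ne_top ENNReal.coe_ne_top
  have h2 : (K : ENNReal) ^ (2 * n) * (n * e * ENNReal.ofReal (4 * η) ^ 2 *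
      (ENNReal.ofReal r ^ 2 * NNReal.pi) ^ n)
      = ENNReal.ofReal ((K : ℝ) ^ (2 * n) * (n * e * (4 * η) ^ 2 * r ^ (2 * n)))
        * (NNReal.pi : ENNReal) ^ n := by
    rw [ENNReal.ofReal_mul (p := (K : ℝ) ^ (2 * n)) (by positivity),
      ENNReal.ofReal_mul (q := r ^ (2 * n)) (by positivity),
      ENNReal.ofReal_mul (q := (4 * η) ^ 2) (by positivity),
      ENNReal.ofReal_mul (p := (n : ℝ)) (by positivity),
      ENNReal.ofReal_pow (by positivity), ENNReal.ofReal_pow (p := 4 * η) (by positivity),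
      ENNReal.ofReal_pow (p := r) (by positivity), ENNReal.ofReal_natCast, ENNReal.ofReal_natCast,
      ENNReal.ofReal_coe_nnreal, mul_pow _ _ n, ← pow_mul (ENNReal.ofReal r)]
    ring
  rw [h2] at h1
  have h3 : ENNReal.ofReal ((K : ℝ) ^ (2 * n) * (n * e * (4 * η) ^ 2 * r ^ (2 * n))) < 1 :=
    ENNReal.ofReal_lt_one.mpr hsmall
  have h4 := (ENNReal.mul_lt_mul_iff_left hpi hpi').mpr h3
  rw [one_mul] at h4
  exact absurd h1 (not_le.mpr h4)

end SmallValues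

end EscapeRate
end

noncomputable section
namespace EscapeRate
open MvPolynomial

/-! ### Coefficient norms -/

section CoeffNorm

variable {k : Type*} [Field k] (v : AbsoluteValue k ℝ) {n : ℕ} (Φ : MvPolynomial (Fin n) k)

theorem finite_range_abv_coeff : (Set.range fun m => v (Φ.coeff m)).Finite := by
  refine ((Φ.support.finite_toSet.image fun m => v (Φ.coeff m)).insert 0).subset ?_
  rintro _ ⟨m, rfl⟩
  by_cases h : Φ.coeff m = 0
  · left; simp [h]
  · right; exact ⟨m, by simpa using h, rfl⟩

theorem le_coeffNorm (m : Fin n →₀ ℕ) : v (Φ.coeff m) ≤ coeffNorm v Φ :=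
  le_ciSup (finite_range_abv_coeff v Φ).bddAbove m

theorem exists_coeffNorm_eq : ∃ m, coeffNorm v Φ = v (Φ.coeff m) := by
  obtain ⟨m, hm⟩ := (Set.range_nonempty fun m => v (Φ.coeff m)).csSup_mem
    (finite_range_abv_coeff v Φ)
  exact ⟨m, hm.symm⟩

theorem coeffNorm_nonneg : 0 ≤ coeffNorm v Φ := by
  obtain ⟨m, hm⟩ := exists_coeffNorm_eq v Φ
  rw [hm]; exact v.nonneg _

variable {v Φ}

theorem coeffNorm_pos_iff : 0 < coeffNorm v Φ ↔ Φ ≠ 0 := by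
  constructor
  · rintro h rfl
    obtain ⟨m, hm⟩ := exists_coeffNorm_eq v (0 : MvPolynomial (Fin n) k)
    rw [hm] at h; simp at h
  · intro h
    obtain ⟨m, hm⟩ := ne_zero_iff.mp h
    exact (v.pos hm).trans_le (le_coeffNorm v Φ m)

theorem coeffNorm_le {c : ℝ} (h : ∀ m, v (Φ.coeff m) ≤ c) : coeffNorm v Φ ≤ c := ciSup_le h

end CoeffNorm

/-! ### Distortion of coefficient norms under pushforward over ℂ -/

section Complex

theorem absComplex_apply (z : ℂ) : absComplex z = ‖z‖ := rfl

variable {n : ℕ}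

theorem norm_coeff_le_coeffNorm (P : MvPolynomial (Fin n) ℂ) (m : Fin n →₀ ℕ) :
    ‖P.coeff m‖ ≤ coeffNorm absComplex P := le_coeffNorm absComplex P m

theorem norm_prod_pow_le {y : Fin n → ℂ} {r : ℝ} (hy : ‖y‖ ≤ r) (m : Fin n →₀ ℕ) :
    ‖∏ i, y i ^ m i‖ ≤ r ^ m.degree := by
  rw [norm_prod, Finsupp.degree_eq_sum, ← Finset.prod_pow_eq_pow_sum]
  refine Finset.prod_le_prod (fun _ _ => norm_nonneg _) fun i _ => ?_
  rw [norm_pow]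
  exact pow_le_pow_left₀ (norm_nonneg _) ((norm_le_pi_norm y i).trans hy) _

theorem norm_prod_pow_sub_le {y z : Fin n → ℂ} {r : ℝ} (hr : 1 ≤ r) (hy : ‖y‖ ≤ r)
    (hz : ‖z‖ ≤ r) (m : Fin n →₀ ℕ) :
    ‖∏ i, y i ^ m i - ∏ i, z i ^ m i‖ ≤ m.degree * r ^ m.degree * ‖y - z‖ := by
  induction hm : m.degree generalizing m with
  | zero =>
    rw [(Finsupp.degree_eq_zero_iff m).mp hm]; simp
  | succ k ih =>
    have hm0 : m ≠ 0 := by rintro rfl; simp at hm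
    obtain ⟨i, hi⟩ : ∃ i, m i ≠ 0 := by
      by_contra! h
      exact hm0 (Finsupp.ext h)
    obtain ⟨m', rfl⟩ : ∃ m', m = m' + Finsupp.single i 1 := by
      refine ⟨m - Finsupp.single i 1, (tsub_add_cancel_of_le ?_).symm⟩
      simpa [Finsupp.single_le_iff] using Nat.one_le_iff_ne_zero.mpr hi
    have hm' : m'.degree = k := by
      rw [map_add, Finsupp.degree_single] at hm; omega
    have key : ∀ w : Fin n → ℂ, ∏ j, w j ^ ((m' + Finsupp.single i 1 : Fin n →₀ ℕ) j)
        = (∏ j, w j ^ m' j) * w i := fun w => by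
      simp only [Finsupp.add_apply, pow_add, Finset.prod_mul_distrib]
      congr 1
      rw [Finset.prod_eq_single i] <;> simp +contextual [eq_comm]
    rw [key, key]
    have h1 := ih m' hm'
    have h2 : ‖y i - z i‖ ≤ ‖y - z‖ := norm_le_pi_norm (y - z) i
    have h3 := norm_prod_pow_le hz m'
    rw [hm'] at h3
    have h4 : ‖y i‖ ≤ r := (norm_le_pi_norm y i).trans hy
    calc ‖(∏ j, y j ^ m' j) * y i - (∏ j, z j ^ m' j) * z i‖
        = ‖(∏ j, y j ^ m' j - ∏ j, z j ^ m' j) * y i + (∏ j, z j ^ m' j) * (y i - z i)‖ := by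
          congr 1; ring
      _ ≤ k * r ^ k * ‖y - z‖ * r + r ^ k * ‖y - z‖ := by
          refine (norm_add_le _ _).trans ?_
          rw [norm_mul, norm_mul]
          gcongr
      _ ≤ k * r ^ k * ‖y - z‖ * r + r ^ k * ‖y - z‖ * r := by
          refine add_le_add le_rfl ?_
          exact le_mul_of_one_le_right (a := r ^ k * ‖y - z‖) (by positivity) hr
      _ = _ := by push_cast; ring

theorem card_support_le {P : MvPolynomial (Fin n) ℂ} {e : ℕ} (hP : P.totalDegree ≤ e) :
    (P.support.card : ℝ) ≤ (e + 1) ^ n := by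
  have : P.support ⊆ exponentsLE n e := fun m hm =>
    mem_exponentsLE.mpr ((le_totalDegree hm).trans hP)
  exact_mod_cast (Finset.card_le_card this).trans (card_exponentsLE_le n e)

theorem norm_eval_le {P : MvPolynomial (Fin n) ℂ} {e : ℕ} (hP : P.totalDegree ≤ e)
    {y : Fin n → ℂ} {r : ℝ} (hr : 1 ≤ r) (hy : ‖y‖ ≤ r) :
    ‖eval y P‖ ≤ (e + 1) ^ n * coeffNorm absComplex P * r ^ e := by
  rw [eval_eq']
  have h0 := coeffNorm_nonneg absComplex P
  calc _ ≤ ∑ m ∈ P.support, coeffNorm absComplex P * r ^ e := by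
        refine norm_sum_le_of_le _ fun m hm => ?_
        rw [norm_mul]
        refine mul_le_mul (norm_coeff_le_coeffNorm P m) ((norm_prod_pow_le hy m).trans
          (pow_le_pow_right₀ hr ((le_totalDegree hm).trans hP))) (norm_nonneg _) h0
    _ ≤ _ := by
        rw [Finset.sum_const, nsmul_eq_mul, mul_assoc]
        gcongr
        exact card_support_le hP

theorem norm_eval_le_of_isHomogeneous {P : MvPolynomial (Fin n) ℂ} {e : ℕ}
    (hP : P.IsHomogeneous e) (y : Fin n → ℂ) :
    ‖eval y P‖ ≤ (e + 1) ^ n * coeffNorm absComplex P * ‖y‖ ^ e := by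
  rw [eval_eq']
  have h0 := coeffNorm_nonneg absComplex P
  calc _ ≤ ∑ m ∈ P.support, coeffNorm absComplex P * ‖y‖ ^ e := by
        refine norm_sum_le_of_le _ fun m hm => ?_
        rw [norm_mul]
        refine mul_le_mul (norm_coeff_le_coeffNorm P m) ?_ (norm_nonneg _) h0
        have := hP (mem_support_iff.mp hm)
        have hm : m.degree = e := by
          rw [← this, Finsupp.degree_eq_weight_one]; rfl
        exact (norm_prod_pow_le le_rfl m).trans_eq (by rw [hm])
    _ ≤ _ := by
        rw [Finset.sum_const, nsmul_eq_mul, mul_assoc]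
        gcongr
        exact card_support_le hP.totalDegree_le

theorem norm_eval_sub_le {P : MvPolynomial (Fin n) ℂ} {e : ℕ} (hP : P.totalDegree ≤ e)
    {y z : Fin n → ℂ} {r : ℝ} (hr : 1 ≤ r) (hy : ‖y‖ ≤ r) (hz : ‖z‖ ≤ r) :
    ‖eval y P - eval z P‖ ≤ (e + 1) ^ n * coeffNorm absComplex P * (e * r ^ e) * ‖y - z‖ := by
  rw [eval_eq', eval_eq', ← Finset.sum_sub_distrib]
  have h0 := coeffNorm_nonneg absComplex P
  calc _ ≤ ∑ m ∈ P.support, coeffNorm absComplex P * (e * r ^ e * ‖y - z‖) := by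
        refine norm_sum_le_of_le _ fun m hm => ?_
        rw [← mul_sub, norm_mul]
        refine mul_le_mul (norm_coeff_le_coeffNorm P m) ((norm_prod_pow_sub_le hr hy hz m).trans ?_)
          (norm_nonneg _) h0
        have : m.degree ≤ e := (le_totalDegree hm).trans hP
        gcongr
    _ ≤ _ := by
        rw [Finset.sum_const, nsmul_eq_mul]
        calc _ ≤ ((e : ℝ) + 1) ^ n * (coeffNorm absComplex P * (e * r ^ e * ‖y - z‖)) := by
              gcongr
              exact card_support_le hP
          _ = _ := by ring

variable {N d : ℕ}

/-- A bound for the preimages of the unit polydisc. -/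
theorem norm_le_of_norm_eval_le_one {F : Fin n → MvPolynomial (Fin n) ℂ} {m : ℕ} (hd : 1 ≤ d)
    (hdm : d ≤ m) {G : Fin n → Fin n → MvPolynomial (Fin n) ℂ}
    (hG : ∀ i l, (G i l).IsHomogeneous (m - d)) (h : ∀ i, X i ^ m = ∑ l, G i l * F l)
    {g : ℝ} (hg : 1 ≤ g) (hGg : ∀ i l, coeffNorm absComplex (G i l) ≤ g) (hn : 1 ≤ n)
    {y : Fin n → ℂ} (hy : ∀ l, ‖eval y (F l)‖ ≤ 1) : ‖y‖ ≤ n * (m + 1) ^ n * g := by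
  have hone : (1 : ℝ) ≤ n * (m + 1) ^ n * g := by
    have h1 : (1 : ℝ) ≤ n := by exact_mod_cast hn
    have h2 : (1 : ℝ) ≤ (m + 1) ^ n := one_le_pow₀ (by linarith [Nat.cast_nonneg (α := ℝ) m])
    exact one_le_mul_of_one_le_of_one_le (one_le_mul_of_one_le_of_one_le h1 h2) hg
  by_cases hy1 : ‖y‖ ≤ 1
  · exact hy1.trans hone
  push Not at hy1
  have hpos : 0 < ‖y‖ := by linarith
  -- Evaluate X_i^m = ∑ G_{il} F_l where all |F_l| ≤ 1; taking the largest coordinate bounds ‖y‖^d.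
  have hi : ∀ i, ‖y i‖ ^ m ≤ n * (m + 1) ^ n * g * ‖y‖ ^ (m - d) := fun i => by
    have := congrArg (eval y) (h i)
    rw [map_pow, eval_X, map_sum] at this
    rw [← norm_pow, this]
    calc _ ≤ ∑ l : Fin n, ((m : ℝ) + 1) ^ n * g * ‖y‖ ^ (m - d) := by
          refine norm_sum_le_of_le _ fun l _ => ?_
          rw [map_mul, norm_mul]
          refine (mul_le_of_le_one_right (norm_nonneg _) (hy l)).trans
            ((norm_eval_le_of_isHomogeneous (hG i l) y).trans ?_)
          have h1 : ((m - d : ℕ) : ℝ) ≤ m := by exact_mod_cast Nat.sub_le _ _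
          have := hGg i l
          have := coeffNorm_nonneg absComplex (G i l)
          gcongr
      _ = _ := by simp; ring
  have hle : ‖y‖ ^ m ≤ n * (m + 1) ^ n * g * ‖y‖ ^ (m - d) := by
    have : Nonempty (Fin n) := ⟨⟨0, hn⟩⟩
    obtain ⟨i, hi'⟩ := Finite.exists_max fun i => ‖y i‖
    have : ‖y‖ = ‖y i‖ := le_antisymm ((pi_norm_le_iff_of_nonneg (norm_nonneg _)).mpr hi')
      (norm_le_pi_norm y i)
    have h2 := hi i
    rwa [← this] at h2
  have hsplit : ‖y‖ ^ m = ‖y‖ ^ d * ‖y‖ ^ (m - d) := by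
    rw [← pow_add]; congr 1; omega
  rw [hsplit] at hle
  exact (le_self_pow₀ hy1.le (by omega)).trans (le_of_mul_le_mul_right hle (by positivity))

theorem lipschitzOnWith_eval {F : Fin n → MvPolynomial (Fin n) ℂ}
    (hF : ∀ i, (F i).IsHomogeneous d) {g : ℝ} (hg : 0 ≤ g)
    (hFg : ∀ i, coeffNorm absComplex (F i) ≤ g) {r : ℝ} (hr : 1 ≤ r) :
    LipschitzOnWith (Real.toNNReal ((d + 1) ^ n * g * (d * r ^ d)))
      (fun y i => eval y (F i)) (Metric.closedBall 0 r) := by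
  refine LipschitzOnWith.of_dist_le_mul fun y hy z hz => ?_
  rw [dist_pi_le_iff (by positivity)]
  intro i
  rw [Real.coe_toNNReal _ (by positivity), dist_eq_norm, dist_eq_norm]
  refine (norm_eval_sub_le (hF i).totalDegree_le hr (by simpa using hy) (by simpa using hz)).trans ?_
  gcongr
  exact hFg i

/-- A lower bound for a polynomial whose values are products of the values of `Φ` along the fibres
of `f`. -/
theorem pow_coeffNorm_le_of_fibres {D : ℕ} {f : (Fin n → ℂ) → Fin n → ℂ}
    {Φ P : MvPolynomial (Fin n) ℂ} {e e' : ℕ} (hΦ : Φ.totalDegree ≤ e) (hP : P.totalDegree ≤ e')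
    (hfib : ∀ x, ∃ y : Fin D → Fin n → ℂ, (∀ a, f (y a) = x) ∧ eval x P = ∏ a, eval (y a) Φ)
    {r η : ℝ} (hr : 1 ≤ r) (hbd : ∀ y, ‖f y‖ ≤ 1 → ‖y‖ ≤ r) {Λ : NNReal}
    (hf : LipschitzOnWith Λ f (Metric.closedBall 0 r)) (hη0 : 0 < η) (hη1 : η ≤ 1 / 2)
    (hsmall : (Λ : ℝ) ^ (2 * n) * (n * e * (4 * η) ^ 2 * r ^ (2 * n)) < 1) :
    (η ^ (n * e) * coeffNorm absComplex Φ) ^ D ≤ (e' + 1) ^ n * coeffNorm absComplex P := by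
  obtain ⟨m, hm⟩ := exists_coeffNorm_eq absComplex Φ
  obtain ⟨x, hx, hxy⟩ := exists_forall_preimage_le Φ hΦ hη0 hη1 hr m hf hsmall
  obtain ⟨y, hy, hyP⟩ := hfib x
  calc (η ^ (n * e) * coeffNorm absComplex Φ) ^ D
      = ∏ _a : Fin D, (η ^ (n * e) * ‖coeff m Φ‖) := by
        rw [hm, absComplex_apply]; simp
    _ ≤ ∏ a, ‖eval (y a) Φ‖ := by
        refine Finset.prod_le_prod (fun _ _ => by positivity) fun a _ => hxy _ (hbd _ ?_) (hy a)
        rw [hy a]; exact hx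
    _ = ‖eval x P‖ := by rw [hyP, norm_prod]
    _ ≤ _ := by simpa using norm_eval_le hP le_rfl hx

/-- The reverse inequality is easier: choose a point of the unit polydisc where P itself is not
small (the preimage lemma with the identity map) and bound Φ from above at its preimages. -/
theorem pow_mul_coeffNorm_le_of_fibres {D : ℕ} {f : (Fin n → ℂ) → Fin n → ℂ}
    {Φ P : MvPolynomial (Fin n) ℂ} {e e' : ℕ} (hΦ : Φ.totalDegree ≤ e) (hP : P.totalDegree ≤ e')
    (hfib : ∀ x, ∃ y : Fin D → Fin n → ℂ, (∀ a, f (y a) = x) ∧ eval x P = ∏ a, eval (y a) Φ)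
    {r η : ℝ} (hr : 1 ≤ r) (hbd : ∀ y, ‖f y‖ ≤ 1 → ‖y‖ ≤ r) (hη0 : 0 < η) (hη1 : η ≤ 1 / 2)
    (hsmall : n * e' * (4 * η) ^ 2 < 1) :
    η ^ (n * e') * coeffNorm absComplex P
      ≤ ((e + 1) ^ n * coeffNorm absComplex Φ * r ^ e) ^ D := by
  obtain ⟨m, hm⟩ := exists_coeffNorm_eq absComplex P
  obtain ⟨x, hx, hxy⟩ := exists_forall_preimage_le P hP hη0 hη1 le_rfl m (f := id) (K := 1)
    LipschitzWith.id.lipschitzOnWith (by simpa using hsmall)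
  obtain ⟨y, hy, hyP⟩ := hfib x
  calc η ^ (n * e') * coeffNorm absComplex P ≤ ‖eval x P‖ := by
        rw [hm]; exact hxy x hx rfl
    _ = ∏ a, ‖eval (y a) Φ‖ := by rw [hyP, norm_prod]
    _ ≤ ∏ _a : Fin D, ((e + 1) ^ n * coeffNorm absComplex Φ * r ^ e) := by
        refine Finset.prod_le_prod (fun _ _ => norm_nonneg _) fun a _ =>
          norm_eval_le hΦ hr (hbd _ ?_)
        rw [hy a]; exact hx
    _ = _ := by simp

/-- Bookkeeping for `abs_log_coeffNorm_sub_le_of_fibres`: w8, wn, wΛ, wr, we, we' stand for the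
logarithms of 8, n, Λ, r, e + 1, e' + 1. -/
theorem lower_error_le {n D e w8 wn wΛ wr we we' : ℝ} (hn : 1 ≤ n) (hD : 0 ≤ D) (he : 0 ≤ e)
    (hΛ : 0 ≤ wΛ) (hr : 0 ≤ wr) (hwe : 0 ≤ we) (h8 : w8 ≤ 3) (hwn : wn ≤ n) (hwe' : we' ≤ D + we) :
    D * (n * e * (w8 + (wn + (n * wΛ + n * wr) + we))) + n * we'
      ≤ 10 * (n * (n + D + 1) * (D + 1)) * ((e + 1) * (wΛ + wr + 1 + we)) := by
  have hn0 : 0 ≤ n := by linarith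
  have hX0 : 0 ≤ wΛ + wr + 1 + we := by positivity
  have h1 : w8 + (wn + (n * wΛ + n * wr) + we) ≤ (3 + n) * (wΛ + wr + 1 + we) := by
    linarith [mul_nonneg hn0 hwe]
  have h2 : we' ≤ (D + 1) * (wΛ + wr + 1 + we) := by
    linarith [mul_nonneg hD hwe, mul_nonneg hD hr, mul_nonneg hD hΛ]
  generalize wΛ + wr + 1 + we = X at *
  have hDn : 0 ≤ D * n := by positivity
  calc _ ≤ D * (n * e * ((3 + n) * X)) + n * ((D + 1) * X) := by gcongr
    _ = D * n * (3 + n) * (e * X) + n * (D + 1) * (1 * X) := by ring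
    _ ≤ D * n * (3 + n) * ((e + 1) * X) + n * (D + 1) * ((e + 1) * X) := by
        gcongr <;> linarith
    _ = (D * n * (3 + n) + n * (D + 1)) * ((e + 1) * X) := by ring
    _ ≤ _ := by
        refine mul_le_mul_of_nonneg_right ?_ (by positivity)
        have h4 : 0 ≤ n * n * D := by positivity
        have h5 : 0 ≤ n * D * D := by positivity
        linarith [mul_nonneg hn0 hn0]

theorem upper_error_le {n D e w8 wn wΛ wr we e' we' : ℝ} (hn : 1 ≤ n) (hD : 0 ≤ D) (he : 0 ≤ e)
    (hΛ : 0 ≤ wΛ) (hr : 0 ≤ wr) (hwe : 0 ≤ we) (he' : e' ≤ e * D)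
    (h80 : 0 ≤ w8) (h8 : w8 ≤ 3) (hwn0 : 0 ≤ wn) (hwn : wn ≤ n) (hwe0' : 0 ≤ we')
    (hwe' : we' ≤ D + we) :
    n * e' * (w8 + (wn + we')) + D * (n * we + e * wr)
      ≤ 10 * (n * (n + D + 1) * (D + 1)) * ((e + 1) * (wΛ + wr + 1 + we)) := by
  have hn0 : 0 ≤ n := by linarith
  have hX0 : 0 ≤ wΛ + wr + 1 + we := by positivity
  have h1 : w8 + (wn + we') ≤ (3 + n + D) * (wΛ + wr + 1 + we) := by
    linarith [mul_nonneg hn0 hwe, mul_nonneg hD hwe, mul_nonneg hn0 hr, mul_nonneg hD hr,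
      mul_nonneg hn0 hΛ, mul_nonneg hD hΛ]
  have h2 : we ≤ wΛ + wr + 1 + we := by linarith
  have h3 : wr ≤ wΛ + wr + 1 + we := by linarith
  generalize wΛ + wr + 1 + we = X at *
  calc _ ≤ n * (e * D) * ((3 + n + D) * X) + D * (n * X + e * X) := by gcongr
    _ = (n * D * (3 + n + D) + D) * (e * X) + D * n * (1 * X) := by ring
    _ ≤ (n * D * (3 + n + D) + D) * ((e + 1) * X) + D * n * ((e + 1) * X) := by
        gcongr <;> linarith
    _ = (n * D * (3 + n + D) + D + D * n) * ((e + 1) * X) := by ring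
    _ ≤ _ := by
        refine mul_le_mul_of_nonneg_right ?_ (by positivity)
        have h4 : 0 ≤ n * n * D := by positivity
        have h5 : 0 ≤ n * D * D := by positivity
        linarith [mul_nonneg hn0 hn0, mul_nonneg (sub_nonneg.mpr hn) hD]

/-- The parameter η may be taken as the inverse of a polynomial in Λ, r and the degree. Its
logarithm enters multiplied by the degree, whence an error of order e log e. Nonvanishing of P comes
out of the lower bound. -/
theorem abs_log_coeffNorm_sub_le_of_fibres {D : ℕ} (hn : 1 ≤ n) {f : (Fin n → ℂ) → Fin n → ℂ}
    {Φ P : MvPolynomial (Fin n) ℂ} {e e' : ℕ} (hΦ : Φ.totalDegree ≤ e) (hP : P.totalDegree ≤ e')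
    (he' : e' ≤ e * D)
    (hfib : ∀ x, ∃ y : Fin D → Fin n → ℂ, (∀ a, f (y a) = x) ∧ eval x P = ∏ a, eval (y a) Φ)
    {r : ℝ} (hr : 1 ≤ r) (hbd : ∀ y, ‖f y‖ ≤ 1 → ‖y‖ ≤ r) {Λ : NNReal} (hΛ : 1 ≤ Λ)
    (hf : LipschitzOnWith Λ f (Metric.closedBall 0 r)) (hΦ0 : Φ ≠ 0) :
    P ≠ 0 ∧ |Real.log (coeffNorm absComplex P) - D * Real.log (coeffNorm absComplex Φ)|
      ≤ 10 * (n * (n + D + 1) * (D + 1)) * (e + 1) * (Real.log Λ + Real.log r + 1 + Real.log (e + 1)) := by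
  have hn' : (1 : ℝ) ≤ n := by exact_mod_cast hn
  have hΛ' : (1 : ℝ) ≤ Λ := by exact_mod_cast hΛ
  have he'r : (e' : ℝ) ≤ e * D := by exact_mod_cast he'
  have he0 : (0 : ℝ) ≤ e := e.cast_nonneg
  have he0' : (0 : ℝ) ≤ e' := e'.cast_nonneg
  have hD0 : (0 : ℝ) ≤ D := D.cast_nonneg
  have hMΦ : 0 < coeffNorm absComplex Φ := coeffNorm_pos_iff.mpr hΦ0
  set MΦ := coeffNorm absComplex Φ
  -- With η = 1/(8nc(E+1)) the volume condition becomes E/(4n(E+1)²) < 1. It is used with c = Λ^n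
  -- r^n for the lower bound and c = 1 for the upper one.
  have small : ∀ c E : ℝ, 1 ≤ c → 0 ≤ E →
      0 < 1 / (8 * (n * c * (E + 1))) ∧ 1 / (8 * (n * c * (E + 1))) ≤ 1 / 2 ∧
      c ^ 2 * (n * E * (4 * (1 / (8 * (n * c * (E + 1))))) ^ 2) < 1 := by
    intro c E hc hE
    have h1 : 1 ≤ n * c * (E + 1) := one_le_mul_of_one_le_of_one_le
      (one_le_mul_of_one_le_of_one_le hn' hc) (by linarith)
    refine ⟨by positivity, ?_, ?_⟩
    · rw [div_le_div_iff₀ (by positivity) (by norm_num)]; linarith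
    · have : c ^ 2 * (n * E * (4 * (1 / (8 * (n * c * (E + 1))))) ^ 2)
          = E / (4 * n * (E + 1) ^ 2) := by
        field_simp; norm_num
      rw [this, div_lt_one (by positivity)]
      nlinarith [mul_nonneg (sub_nonneg.mpr hn') (sq_nonneg (E + 1))]
  -- the lower bound
  obtain ⟨a1, a2, a3⟩ := small ((Λ : ℝ) ^ n * r ^ n) e (one_le_mul_of_one_le_of_one_le
    (one_le_pow₀ hΛ') (one_le_pow₀ hr)) he0
  set η := 1 / (8 * (n * ((Λ : ℝ) ^ n * r ^ n) * ((e : ℝ) + 1))) with hη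
  have low := pow_coeffNorm_le_of_fibres hΦ hP hfib hr hbd hf a1 a2 (by
    refine lt_of_eq_of_lt ?_ a3; ring)
  obtain ⟨b1, b2, b3⟩ := small 1 e' le_rfl he0'
  set η' := 1 / (8 * (n * 1 * ((e' : ℝ) + 1))) with hη'
  have upp := pow_mul_coeffNorm_le_of_fibres hΦ hP hfib hr hbd b1 b2 (by simpa using b3)
  have hMP : 0 < coeffNorm absComplex P := by
    by_contra! hcon
    have h1 : 0 < (η ^ (n * e) * MΦ) ^ D := by positivity
    have h2 : ((e' : ℝ) + 1) ^ n * coeffNorm absComplex P ≤ 0 :=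
      mul_nonpos_of_nonneg_of_nonpos (by positivity) hcon
    linarith
  refine ⟨coeffNorm_pos_iff.mp hMP, ?_⟩
  set MP := coeffNorm absComplex P
  have low' := Real.log_le_log (by positivity) low
  have upp' := Real.log_le_log (by positivity) upp
  have hr0 : r ≠ 0 := by positivity
  have hΛ0 : (Λ : ℝ) ≠ 0 := by positivity
  have hn0 : (n : ℝ) ≠ 0 := by positivity
  have l1 : Real.log η = -(Real.log 8 + (Real.log n + (n * Real.log Λ + n * Real.log r)
      + Real.log (e + 1))) := by
    rw [hη, one_div, Real.log_inv, Real.log_mul (by norm_num) (by positivity),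
      Real.log_mul (by positivity) (by positivity), Real.log_mul hn0 (by positivity),
      Real.log_mul (by positivity) (by positivity), Real.log_pow, Real.log_pow]
  have l2 : Real.log η' = -(Real.log 8 + (Real.log n + Real.log (e' + 1))) := by
    rw [hη', one_div, Real.log_inv, Real.log_mul (by norm_num) (by positivity), mul_one,
      Real.log_mul hn0 (by positivity)]
  rw [Real.log_pow, Real.log_mul (by positivity) hMΦ.ne', Real.log_pow, l1,
    Real.log_mul (by positivity) hMP.ne', Real.log_pow] at low'
  rw [Real.log_mul (by positivity) hMP.ne', Real.log_pow, l2, Real.log_pow,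
    Real.log_mul (by positivity) (by positivity), Real.log_mul (by positivity) hMΦ.ne',
    Real.log_pow, Real.log_pow] at upp'
  have g8 : Real.log 8 ≤ 3 := by
    have : (8 : ℝ) = 2 ^ 3 := by norm_num
    rw [this, Real.log_pow]
    have := Real.log_two_lt_d9
    push_cast; linarith
  have gn : Real.log n ≤ n := (Real.log_le_sub_one_of_pos (by positivity)).trans (by linarith)
  have gn0 : 0 ≤ Real.log n := Real.log_nonneg hn'
  have g80 : 0 ≤ Real.log 8 := Real.log_nonneg (by norm_num)
  have gl : 0 ≤ Real.log ((e : ℝ) + 1) := Real.log_nonneg (by linarith)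
  have gl' : 0 ≤ Real.log ((e' : ℝ) + 1) := Real.log_nonneg (by linarith)
  have gΛ : 0 ≤ Real.log Λ := Real.log_nonneg hΛ'
  have gr : 0 ≤ Real.log r := Real.log_nonneg hr
  have ge' : Real.log ((e' : ℝ) + 1) ≤ D + Real.log (e + 1) := by
    have h1 : (e' : ℝ) + 1 ≤ (D + 1) * (e + 1) := by nlinarith
    have h2 := Real.log_le_log (by positivity) h1
    rw [Real.log_mul (by positivity) (by positivity)] at h2
    have h3 : Real.log ((D : ℝ) + 1) ≤ D :=
      (Real.log_le_sub_one_of_pos (by positivity)).trans (by linarith)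
    linarith
  generalize Real.log 8 = w8 at *
  generalize Real.log Λ = wΛ at *
  generalize Real.log r = wr at *
  generalize Real.log (n : ℝ) = wn at *
  generalize Real.log ((e : ℝ) + 1) = we at *
  generalize Real.log ((e' : ℝ) + 1) = we' at *
  rw [mul_assoc _ ((e : ℝ) + 1), abs_le]
  push_cast at low' upp'
  constructor
  · linarith [lower_error_le hn' hD0 he0 gΛ gr gl g8 gn ge']
  · linarith [upper_error_le hn' hD0 he0 gΛ gr gl he'r g80 g8 gn0 gn gl' ge']

/-- The distortion of the logarithmic size of a form under pushforward. -/
theorem exists_abs_log_coeffNorm_sub_le (n D d m : ℕ) (hn : 1 ≤ n) (hd : 1 ≤ d) (hdm : d ≤ m) :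
    ∃ C : ℝ, 0 ≤ C ∧ ∀ (F : Fin n → MvPolynomial (Fin n) ℂ)
      (G : Fin n → Fin n → MvPolynomial (Fin n) ℂ) (g : ℝ),
      (∀ i, (F i).IsHomogeneous d) → (∀ i l, (G i l).IsHomogeneous (m - d)) →
      (∀ i, X i ^ m = ∑ l, G i l * F l) → 1 ≤ g → (∀ i, coeffNorm absComplex (F i) ≤ g) →
      (∀ i l, coeffNorm absComplex (G i l) ≤ g) →
      ∀ (Φ P : MvPolynomial (Fin n) ℂ) (e e' : ℕ), Φ.totalDegree ≤ e → P.totalDegree ≤ e' →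
      e' ≤ e * D → (∀ x : Fin n → ℂ, ∃ y : Fin D → Fin n → ℂ,
        (∀ a i, eval (y a) (F i) = x i) ∧ eval x P = ∏ a, eval (y a) Φ) → Φ ≠ 0 →
      P ≠ 0 ∧ |Real.log (coeffNorm absComplex P) - D * Real.log (coeffNorm absComplex Φ)|
        ≤ C * (e + 1) * (Real.log g + 1 + Real.log (e + 1)) := by
  -- Preimages of the unit polydisc lie in the ball of radius c₁g, on which F is Lipschitz with
  -- constant c₂g(c₁g)^d. Both logarithms are linear in log g.
  set c₁ : ℝ := n * (m + 1) ^ n with hc₁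
  have hn' : (1 : ℝ) ≤ n := by exact_mod_cast hn
  have hd' : (1 : ℝ) ≤ d := by exact_mod_cast hd
  have hc₁1 : 1 ≤ c₁ := one_le_mul_of_one_le_of_one_le hn'
    (one_le_pow₀ (by linarith [Nat.cast_nonneg (α := ℝ) m]))
  set c₂ : ℝ := (d + 1) ^ n * d with hc₂
  have hc₂1 : 1 ≤ c₂ := one_le_mul_of_one_le_of_one_le (one_le_pow₀ (by linarith)) hd'
  set c : ℝ := (Real.log c₂ + (d + 1) * Real.log c₁) + (d + 2) with hc
  have hl1 := Real.log_nonneg hc₁1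
  have hl2 := Real.log_nonneg hc₂1
  have hcd : (d : ℝ) + 2 ≤ c := by
    have : 0 ≤ (d + 1) * Real.log c₁ := by positivity
    linarith
  refine ⟨10 * (n * (n + D + 1) * (D + 1)) * c, by positivity, ?_⟩
  intro F G g hF hG hrel hg hFg hGg Φ P e e' hΦ hP he' hfib hΦ0
  have hr1 : 1 ≤ c₁ * g := one_le_mul_of_one_le_of_one_le hc₁1 hg
  set Λ : NNReal := Real.toNNReal ((d + 1) ^ n * g * (d * (c₁ * g) ^ d)) with hΛ
  have hΛv : (Λ : ℝ) = c₂ * g * (c₁ * g) ^ d := by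
    rw [hΛ, Real.coe_toNNReal _ (by positivity), hc₂]; ring
  have hΛ1 : 1 ≤ Λ := by
    rw [← NNReal.coe_le_coe, hΛv]
    exact one_le_mul_of_one_le_of_one_le (one_le_mul_of_one_le_of_one_le hc₂1 hg)
      (one_le_pow₀ hr1)
  obtain ⟨h1, h2⟩ := abs_log_coeffNorm_sub_le_of_fibres (f := fun y i => eval y (F i)) hn hΦ hP he'
    (fun x => by
      obtain ⟨y, hy1, hy2⟩ := hfib x
      exact ⟨y, fun a => funext (hy1 a), hy2⟩) hr1
    (fun y hy => norm_le_of_norm_eval_le_one hd hdm hG hrel hg hGg hn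
      fun l => (norm_le_pi_norm (fun i => eval y (F i)) l).trans hy) hΛ1
    (lipschitzOnWith_eval hF (by linarith) hFg hr1) hΦ0
  refine ⟨h1, h2.trans ?_⟩
  have hlg := Real.log_nonneg hg
  have hle : 0 ≤ Real.log ((e : ℝ) + 1) :=
    Real.log_nonneg (by linarith [Nat.cast_nonneg (α := ℝ) e])
  have : Real.log Λ + Real.log (c₁ * g) + 1 + Real.log (e + 1)
      ≤ c * (Real.log g + 1 + Real.log (e + 1)) := by
    rw [hΛv, Real.log_mul (x := c₂ * g) (by positivity) (by positivity),
      Real.log_mul (x := c₂) (by positivity) (by positivity), Real.log_pow]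
    have e1 := Real.log_mul (x := c₁) (y := g) (by positivity) (by positivity)
    have hc0 : 0 ≤ c - (d + 2) := by linarith
    have hcd1 : 0 ≤ c - 1 := by linarith
    rw [e1]
    generalize Real.log g = lg at *
    generalize Real.log c₁ = l1 at *
    generalize Real.log c₂ = l2 at *
    linarith [mul_nonneg hc0 hlg, mul_nonneg hcd1 hle]
  calc _ ≤ 10 * (n * (n + D + 1) * (D + 1)) * (e + 1) *
        (c * (Real.log g + 1 + Real.log (e + 1))) := by gcongr
    _ = _ := by ring

end Complex

end EscapeRate
end

noncomputable section
namespace EscapeRate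
open MvPolynomial

/-! ### Specialization at s = t through the local ring of rational functions regular at t -/

section Specialize

variable {K : Type*} [Field K] (σ : K →+* ℂ) (t : ℂ)

/-- `evalAt` uses the reduced fraction; this frees it to use any fraction whose denominator does not
vanish at t. -/
theorem evalAt_eq_div {r : RatFunc K} {p q : Polynomial K}
    (h : r = algebraMap _ (RatFunc K) p / algebraMap _ (RatFunc K) q) (hq : q.eval₂ σ t ≠ 0) :
    r.denom.eval₂ σ t ≠ 0 ∧ evalAt σ t r = p.eval₂ σ t / q.eval₂ σ t := by
  have hq0 : q ≠ 0 := by rintro rfl; simp at hq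
  have h1 : r.denom.eval₂ σ t ≠ 0 := by
    obtain ⟨c, hc⟩ : r.denom ∣ q := (RatFunc.denom_dvd hq0).mpr ⟨p, h⟩
    rw [hc, Polynomial.eval₂_mul] at hq
    exact left_ne_zero_of_mul hq
  refine ⟨h1, ?_⟩
  have h2 := congrArg (Polynomial.eval₂ σ t) ((RatFunc.num_mul_eq_mul_denom_iff hq0).mpr h)
  rw [Polynomial.eval₂_mul, Polynomial.eval₂_mul] at h2
  rw [evalAt, div_eq_div_iff h1 hq, h2]

theorem evalAt_zero : evalAt σ t 0 = 0 := by simp [evalAt]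

theorem evalAt_algebraMap (p : Polynomial K) :
    evalAt σ t (algebraMap _ (RatFunc K) p) = p.eval₂ σ t := by simp [evalAt]

/-- The rational functions without a pole at `t`. -/
def regularAt : ValuationSubring (RatFunc K) where
  carrier := {r | r.denom.eval₂ σ t ≠ 0}
  mul_mem' {a b} ha hb := by
    refine (evalAt_eq_div σ t (p := a.num * b.num) (q := a.denom * b.denom) ?_ ?_).1
    · rw [map_mul, map_mul, mul_div_mul_comm, RatFunc.num_div_denom, RatFunc.num_div_denom]
    · rw [Polynomial.eval₂_mul]; exact mul_ne_zero ha hb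
  one_mem' := by simp
  add_mem' {a b} ha hb := by
    refine (evalAt_eq_div σ t (p := a.num * b.denom + a.denom * b.num) (q := a.denom * b.denom)
      ?_ ?_).1
    · simp only [map_mul, map_add]
      have h1 := RatFunc.algebraMap_ne_zero a.denom_ne_zero
      have h2 := RatFunc.algebraMap_ne_zero b.denom_ne_zero
      rw [← div_add_div _ _ h1 h2, RatFunc.num_div_denom, RatFunc.num_div_denom]
    · rw [Polynomial.eval₂_mul]; exact mul_ne_zero ha hb
  zero_mem' := by simp
  neg_mem' {a} ha := by
    refine (evalAt_eq_div σ t (p := -a.num) (q := a.denom) ?_ ha).1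
    rw [map_neg, neg_div, RatFunc.num_div_denom]
  -- Coprime numerator and denominator cannot both vanish at t. As a valuation ring, `regularAt` is
  -- integrally closed with fraction field K(s), as the descent of fibre products requires.
  mem_or_inv_mem' r := by
    by_cases h : r.denom.eval₂ σ t = 0
    · right
      refine (evalAt_eq_div σ t (p := r.denom) (q := r.num) ?_ ?_).1
      · conv_lhs => rw [← RatFunc.num_div_denom r, inv_div]
      · intro h'
        obtain ⟨u, v, huv⟩ := r.isCoprime_num_denom
        have := congrArg (Polynomial.eval₂ σ t) huv
        simp [Polynomial.eval₂_add, Polynomial.eval₂_mul, h, h'] at this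
    · exact Or.inl h

theorem mem_regularAt {r : RatFunc K} : r ∈ regularAt σ t ↔ r.denom.eval₂ σ t ≠ 0 := Iff.rfl

/-- Evaluation at `t` of a rational function without a pole at `t`. -/
def evalHom : regularAt σ t →+* ℂ where
  toFun r := evalAt σ t r.1
  map_one' := by simp [evalAt]
  map_zero' := evalAt_zero σ t
  map_mul' a b := by
    have h := evalAt_eq_div σ t (r := a.1 * b.1) (p := a.1.num * b.1.num)
      (q := a.1.denom * b.1.denom) (by
        rw [map_mul, map_mul, mul_div_mul_comm, RatFunc.num_div_denom, RatFunc.num_div_denom])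
      (by rw [Polynomial.eval₂_mul]; exact mul_ne_zero a.2 b.2)
    refine h.2.trans ?_
    rw [Polynomial.eval₂_mul, Polynomial.eval₂_mul, mul_div_mul_comm]; rfl
  map_add' a b := by
    have h := evalAt_eq_div σ t (r := a.1 + b.1)
      (p := a.1.num * b.1.denom + a.1.denom * b.1.num) (q := a.1.denom * b.1.denom) (by
        simp only [map_mul, map_add]
        have h1 := RatFunc.algebraMap_ne_zero a.1.denom_ne_zero
        have h2 := RatFunc.algebraMap_ne_zero b.1.denom_ne_zero
        rw [← div_add_div _ _ h1 h2, RatFunc.num_div_denom, RatFunc.num_div_denom])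
      (by rw [Polynomial.eval₂_mul]; exact mul_ne_zero a.2 b.2)
    refine h.2.trans ?_
    rw [Polynomial.eval₂_mul, Polynomial.eval₂_add, Polynomial.eval₂_mul, Polynomial.eval₂_mul,
      ← div_add_div _ _ a.2 b.2]
    rfl

variable {n : ℕ}

theorem coeff_specialize (Φ : MvPolynomial (Fin n) (RatFunc K)) (m : Fin n →₀ ℕ) :
    coeff m (specialize σ t Φ) = evalAt σ t (coeff m Φ) := by
  classical
  simp only [specialize, coeff_sum, coeff_monomial]
  rw [Finset.sum_ite_eq']
  split_ifs with h
  · rfl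
  · rw [notMem_support_iff.mp h, evalAt_zero]

/-- No coefficient of `Φ` has a pole at `t`. -/
def CoeffsRegularAt (Φ : MvPolynomial (Fin n) (RatFunc K)) : Prop :=
  ∀ m, coeff m Φ ∈ regularAt σ t

variable {σ t}

theorem CoeffsRegularAt.exists_map_eq {Φ : MvPolynomial (Fin n) (RatFunc K)}
    (h : CoeffsRegularAt σ t Φ) : ∃ P : MvPolynomial (Fin n) (regularAt σ t),
      MvPolynomial.map (algebraMap (regularAt σ t) (RatFunc K)) P = Φ := by
  refine mem_range_map_iff_coeffs_subset.mpr fun r hr => ?_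
  obtain ⟨m, -, rfl⟩ := mem_coeffs_iff.mp (Finset.mem_coe.mp hr)
  exact ⟨⟨_, h m⟩, rfl⟩

theorem coeffsRegularAt_map (P : MvPolynomial (Fin n) (regularAt σ t)) :
    CoeffsRegularAt σ t (MvPolynomial.map (algebraMap (regularAt σ t) (RatFunc K)) P) := by
  intro m
  rw [coeff_map]
  exact (coeff m P).2

theorem specialize_map (P : MvPolynomial (Fin n) (regularAt σ t)) :
    specialize σ t (MvPolynomial.map (algebraMap (regularAt σ t) (RatFunc K)) P)
      = MvPolynomial.map (evalHom σ t) P := by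
  ext m
  rw [coeff_specialize, coeff_map, coeff_map]
  rfl

theorem map_regularAt_injective : Function.Injective
    (MvPolynomial.map (σ := Fin n) (algebraMap (regularAt σ t) (RatFunc K))) :=
  map_injective _ (IsFractionRing.injective _ _)

theorem isHomogeneous_specialize {Φ : MvPolynomial (Fin n) (RatFunc K)} {e : ℕ}
    (h : Φ.IsHomogeneous e) : (specialize σ t Φ).IsHomogeneous e := by
  intro m hm
  refine h (d := m) fun h0 => hm ?_
  rw [coeff_specialize, h0, evalAt_zero]

variable [CharZero K] {N d : ℕ} {F : Fin (N + 1) → MvPolynomial (Fin (N + 1)) (RatFunc K)}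
  {G : Fin (N + 1) → Fin (N + 1) → MvPolynomial (Fin (N + 1)) (RatFunc K)} {m : ℕ}

theorem sum_specialize_mul (hF : ∀ i, CoeffsRegularAt σ t (F i))
    (hG : ∀ i l, CoeffsRegularAt σ t (G i l)) (h : ∀ i, X i ^ m = ∑ l, G i l * F l) (i) :
    X i ^ m = ∑ l, specialize σ t (G i l) * specialize σ t (F l) := by
  choose F' hF' using fun i => (hF i).exists_map_eq
  choose G' hG' using fun i l => (hG i l).exists_map_eq
  have h' : X i ^ m = ∑ l, G' i l * F' l := map_regularAt_injective (by
    simp only [map_pow, map_X, map_sum, map_mul, hF', hG', h i])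
  have := congrArg (MvPolynomial.map (evalHom σ t)) h'
  simpa only [map_pow, map_X, map_sum, map_mul, ← specialize_map, hF', hG'] using this

/-- Pushforward commutes with specialization. -/
theorem specialize_pushforward (hd : 1 ≤ d) (hdm : d ≤ m) (hFh : ∀ i, (F i).IsHomogeneous d)
    (hGh : ∀ i l, (G i l).IsHomogeneous (m - d)) (h : ∀ i, X i ^ m = ∑ l, G i l * F l)
    (hF : ∀ i, CoeffsRegularAt σ t (F i)) (hG : ∀ i l, CoeffsRegularAt σ t (G i l))
    {Φ : MvPolynomial (Fin (N + 1)) (RatFunc K)} (hΦ : CoeffsRegularAt σ t Φ) :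
    CoeffsRegularAt σ t (pushforward F Φ) ∧
    specialize σ t (pushforward F Φ)
      = pushforward (fun i => specialize σ t (F i)) (specialize σ t Φ) ∧
    ∀ x : Fin (N + 1) → ℂ, ∃ y : Fin (genericFibre F).ncard → Fin (N + 1) → ℂ,
      (∀ a i, eval (y a) (specialize σ t (F i)) = x i) ∧
      eval x (specialize σ t (pushforward F Φ)) = ∏ a, eval (y a) (specialize σ t Φ) := by
  -- Everything is defined over the local ring at t, and specialization is base change along
  -- `evalHom`.
  obtain ⟨F', rfl⟩ : ∃ F' : Fin (N + 1) → MvPolynomial (Fin (N + 1)) (regularAt σ t),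
      F = fun i => MvPolynomial.map (algebraMap (regularAt σ t) (RatFunc K)) (F' i) := by
    choose F' hF' using fun i => (hF i).exists_map_eq
    exact ⟨F', funext fun i => (hF' i).symm⟩
  choose G' hG' using fun i l => (hG i l).exists_map_eq
  obtain ⟨Φ, rfl⟩ := hΦ.exists_map_eq
  have hinj := IsFractionRing.injective (regularAt σ t) (RatFunc K)
  have hreg : IsRegularLift d F' := ⟨fun i => (hFh i).of_map hinj, m, hdm, G',
    fun i l => IsHomogeneous.of_map hinj (by rw [hG']; exact hGh i l), fun i =>
      map_regularAt_injective (by simp only [map_pow, map_X, map_sum, map_mul, hG', h i])⟩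
  obtain ⟨P, hP⟩ := hreg.exists_pushforward_eq (k := RatFunc K) hd Φ
  have h1 : pushforward (fun i => specialize σ t (MvPolynomial.map (algebraMap (regularAt σ t)
      (RatFunc K)) (F' i))) (specialize σ t (MvPolynomial.map (algebraMap (regularAt σ t)
      (RatFunc K)) Φ)) = MvPolynomial.map (evalHom σ t) P := by
    simp only [specialize_map]
    exact hreg.pushforward_map hd (evalHom σ t) hP
  rw [← hP]
  refine ⟨coeffsRegularAt_map P, by rw [h1, specialize_map], fun x => ?_⟩
  obtain ⟨y, hy1, hy2⟩ := hreg.exists_eval_pushforward hd (evalHom σ t) hP x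
  refine ⟨y, fun a i => ?_, ?_⟩
  · rw [specialize_map, eval_map]; exact hy1 a i
  · simp only [specialize_map, eval_map]; exact hy2

end Specialize

end EscapeRate
end

noncomputable section
namespace EscapeRate
open MvPolynomial Bornology

/-! ### Growth of specializations as t tends to infinity -/

section Growth

variable {K : Type*} [Field K]

/-- The quotient is the reversed polynomial evaluated at 1/t. -/
theorem tendsto_eval₂_div_pow (σ : K →+* ℂ) (p : Polynomial K) :
    Tendsto (fun t : ℂ => p.eval₂ σ t / t ^ p.natDegree) (cobounded ℂ)
      (𝓝 (σ p.leadingCoeff)) := by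
  have h1 : Tendsto (fun t : ℂ => p.reverse.eval₂ σ t⁻¹) (cobounded ℂ)
      (𝓝 (σ p.leadingCoeff)) := by
    have h2 : Tendsto (fun z : ℂ => p.reverse.eval₂ σ z) (𝓝 0) (𝓝 (p.reverse.eval₂ σ 0)) := by
      have := ((p.reverse.map σ).continuous).tendsto 0
      simpa [Polynomial.eval_map] using this
    rw [Polynomial.eval₂_at_zero, Polynomial.coeff_zero_reverse] at h2
    exact h2.comp tendsto_inv₀_cobounded
  refine h1.congr' ?_
  filter_upwards [eventually_ne_cobounded (0 : ℂ)] with t ht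
  have := invertibleOfNonzero ht
  have h3 := Polynomial.eval₂_reverse_mul_pow σ t p
  rw [invOf_eq_inv] at h3
  rw [eq_div_iff (pow_ne_zero _ ht), h3]

theorem tendsto_log_norm_cobounded : Tendsto (fun t : ℂ => Real.log ‖t‖) (cobounded ℂ) atTop :=
  Real.tendsto_log_atTop.comp tendsto_norm_cobounded_atTop

theorem eventually_eval₂_ne_zero (σ : K →+* ℂ) {p : Polynomial K} (hp : p ≠ 0) :
    ∀ᶠ t in cobounded ℂ, p.eval₂ σ t ≠ 0 := by
  have h := (tendsto_eval₂_div_pow σ p).eventually (isOpen_ne.mem_nhds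
    ((map_ne_zero σ).mpr (Polynomial.leadingCoeff_ne_zero.mpr hp)))
  filter_upwards [h] with t ht h0
  exact ht (by rw [h0, zero_div])

theorem eventually_mem_regularAt (σ : K →+* ℂ) (r : RatFunc K) :
    ∀ᶠ t in cobounded ℂ, r ∈ regularAt σ t :=
  eventually_eval₂_ne_zero σ r.denom_ne_zero

theorem tendsto_log_norm_evalAt_sub (σ : K →+* ℂ) {r : RatFunc K} (hr : r ≠ 0) :
    ∃ c : ℝ, Tendsto (fun t : ℂ => Real.log ‖evalAt σ t r‖ - r.intDegree * Real.log ‖t‖)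
      (cobounded ℂ) (𝓝 c) := by
  have key : ∀ {p : Polynomial K}, p ≠ 0 → Tendsto (fun t : ℂ => Real.log ‖p.eval₂ σ t‖
      - p.natDegree * Real.log ‖t‖) (cobounded ℂ) (𝓝 (Real.log ‖σ p.leadingCoeff‖)) := by
    intro p hp
    have hne : ‖σ p.leadingCoeff‖ ≠ 0 :=
      norm_ne_zero_iff.mpr ((map_ne_zero σ).mpr (Polynomial.leadingCoeff_ne_zero.mpr hp))
    have h1 := (Real.continuousAt_log hne).tendsto.comp (tendsto_eval₂_div_pow σ p).norm
    refine h1.congr' ?_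
    filter_upwards [eventually_ne_cobounded (0 : ℂ), eventually_eval₂_ne_zero σ hp] with t ht hpt
    simp only [Function.comp_apply, norm_div, norm_pow]
    rw [Real.log_div (norm_ne_zero_iff.mpr hpt) (pow_ne_zero _ (norm_ne_zero_iff.mpr ht)),
      Real.log_pow]
  refine ⟨_, ((key (RatFunc.num_ne_zero hr)).sub (key r.denom_ne_zero)).congr' ?_⟩
  filter_upwards [eventually_eval₂_ne_zero σ (RatFunc.num_ne_zero hr),
    eventually_eval₂_ne_zero σ r.denom_ne_zero] with t h1 h2
  rw [evalAt, norm_div, Real.log_div (norm_ne_zero_iff.mpr h1) (norm_ne_zero_iff.mpr h2),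
    RatFunc.intDegree]
  push_cast
  ring

theorem exists_eventually_abs_log_norm_evalAt_sub_le (σ : K →+* ℂ) {r : RatFunc K} (hr : r ≠ 0) :
    ∃ c : ℝ, ∀ᶠ t in cobounded ℂ, evalAt σ t r ≠ 0 ∧
      |Real.log ‖evalAt σ t r‖ - r.intDegree * Real.log ‖t‖| ≤ c := by
  obtain ⟨c, hc⟩ := tendsto_log_norm_evalAt_sub σ hr
  refine ⟨|c| + 1, ?_⟩
  filter_upwards [hc.abs.eventually (ge_mem_nhds (lt_add_one |c|)),
    eventually_eval₂_ne_zero σ (RatFunc.num_ne_zero hr),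
    eventually_eval₂_ne_zero σ r.denom_ne_zero] with t h1 h2 h3
  exact ⟨div_ne_zero h2 h3, h1⟩

theorem absInfty_of_ne_zero {r : RatFunc K} (hr : r ≠ 0) :
    absInfty K r = Real.exp r.intDegree := if_neg hr

variable {n : ℕ}

theorem exists_log_coeffNorm_absInfty_eq {Φ : MvPolynomial (Fin n) (RatFunc K)} (hΦ : Φ ≠ 0) :
    ∃ m, coeff m Φ ≠ 0 ∧ Real.log (coeffNorm (absInfty K) Φ) = (coeff m Φ).intDegree := by
  obtain ⟨m, hm⟩ := exists_coeffNorm_eq (absInfty K) Φ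
  have h := coeffNorm_pos_iff (v := absInfty K) |>.mpr hΦ
  rw [hm] at h
  have hne : coeff m Φ ≠ 0 := fun h0 => by simp [h0] at h
  exact ⟨m, hne, by rw [hm, absInfty_of_ne_zero hne, Real.log_exp]⟩

theorem intDegree_le_log_coeffNorm_absInfty {Φ : MvPolynomial (Fin n) (RatFunc K)}
    {m : Fin n →₀ ℕ} (hm : coeff m Φ ≠ 0) :
    ((coeff m Φ).intDegree : ℝ) ≤ Real.log (coeffNorm (absInfty K) Φ) := by
  have := Real.log_le_log ((absInfty K).pos hm) (le_coeffNorm (absInfty K) Φ m)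
  rwa [absInfty_of_ne_zero hm, Real.log_exp] at this

theorem eventually_coeffsRegularAt (σ : K →+* ℂ) (Φ : MvPolynomial (Fin n) (RatFunc K)) :
    ∀ᶠ t in cobounded ℂ, CoeffsRegularAt σ t Φ := by
  have := (Φ.support.eventually_all (l := cobounded ℂ)
    (p := fun m t => coeff m Φ ∈ regularAt σ t)).mpr
    fun m _ => eventually_mem_regularAt σ (coeff m Φ)
  filter_upwards [this] with t ht m
  by_cases hm : m ∈ Φ.support
  · exact ht m hm
  · rw [notMem_support_iff.mp hm]; exact zero_mem _

/-- The size of a specialization, up to a bounded factor. -/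
theorem exists_eventually_abs_log_coeffNorm_specialize_sub_le (σ : K →+* ℂ)
    {Φ : MvPolynomial (Fin n) (RatFunc K)} (hΦ : Φ ≠ 0) :
    ∃ c : ℝ, ∀ᶠ t in cobounded ℂ, specialize σ t Φ ≠ 0 ∧
      |Real.log (coeffNorm absComplex (specialize σ t Φ))
        - Real.log (coeffNorm (absInfty K) Φ) * Real.log ‖t‖| ≤ c := by
  have h : ∀ m : Φ.support, ∃ c : ℝ, ∀ᶠ t in cobounded ℂ, evalAt σ t (coeff m Φ) ≠ 0 ∧
      |Real.log ‖evalAt σ t (coeff m Φ)‖ - (coeff m Φ).intDegree * Real.log ‖t‖| ≤ c := fun m =>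
    exists_eventually_abs_log_norm_evalAt_sub_le σ (mem_support_iff.mp m.2)
  choose c hc using h
  -- This constant depends on Φ without control, so along the iterates it is not uniform in j; the
  -- arithmetic estimates below repair this.
  refine ⟨∑ m, |c m|, ?_⟩
  have hle : ∀ m, c m ≤ ∑ m, |c m| := fun m => (le_abs_self _).trans
    (Finset.single_le_sum (f := fun m => |c m|) (fun _ _ => abs_nonneg _) (Finset.mem_univ m))
  filter_upwards [eventually_all.mpr hc, tendsto_log_norm_cobounded.eventually_ge_atTop 0]
    with t ht hL
  obtain ⟨m, hm0, hm⟩ := exists_log_coeffNorm_absInfty_eq hΦ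
  obtain ⟨h1, h2⟩ := ht ⟨m, mem_support_iff.mpr hm0⟩
  have hle' := hle ⟨m, mem_support_iff.mpr hm0⟩
  have hne : specialize σ t Φ ≠ 0 := fun h0 => h1 (by
    rw [← coeff_specialize, h0, coeff_zero])
  refine ⟨hne, ?_⟩
  rw [abs_le] at h2 ⊢
  constructor
  · have := Real.log_le_log (norm_pos_iff.mpr h1) ((coeff_specialize σ t Φ m) ▸
      norm_coeff_le_coeffNorm (specialize σ t Φ) m)
    rw [hm]
    linarith [h2.1]
  · obtain ⟨b, hb⟩ := exists_coeffNorm_eq absComplex (specialize σ t Φ)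
    have hb0 : coeff b (specialize σ t Φ) ≠ 0 := fun h0 => by
      have := coeffNorm_pos_iff (v := absComplex) |>.mpr hne
      rw [hb, h0] at this; simp at this
    have hb1 : coeff b Φ ≠ 0 := fun h0 => hb0 (by rw [coeff_specialize, h0, evalAt_zero])
    have h3 := abs_le.mp (ht ⟨b, mem_support_iff.mpr hb1⟩).2
    rw [hb, absComplex_apply, coeff_specialize]
    have h4 := mul_le_mul_of_nonneg_right (intDegree_le_log_coeffNorm_absInfty hb1) hL
    linarith [h3.2, hle ⟨b, mem_support_iff.mpr hb1⟩]

end Growth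

end EscapeRate
end

noncomputable section
namespace EscapeRate
open MvPolynomial Bornology

/-! ### Forms over 𝓞_K[s]: Cauchy's estimate and the product formula -/

section IntegralForms

open NumberField

/-- Cauchy's estimate for the coefficients of a polynomial. -/
theorem norm_coeff_le_of_forall_norm_eq {p : Polynomial ℂ} {R B : ℝ} (hR : 1 ≤ R)
    (h : ∀ t : ℂ, ‖t‖ = R → ‖p.eval t‖ ≤ B) (k : ℕ) : ‖p.coeff k‖ ≤ B := by
  have hB : 0 ≤ B := (norm_nonneg _).trans (h R (by simp [abs_of_nonneg (zero_le_one.trans hR)]))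
  -- Rescale to the unit circle and use Parseval. The factor R^k, at least 1, is thrown away.
  set q := p.comp (Polynomial.C (R : ℂ) * Polynomial.X) with hq
  have h1 : Real.circleAverage (fun θ ↦ ‖q.eval θ‖ ^ 2) 0 1 ≤ B ^ 2 := by
    refine Real.circleAverage_mono_on_of_le_circle ?_ fun x hx => ?_
    · exact ContinuousOn.circleIntegrable zero_le_one (Continuous.continuousOn (by fun_prop))
    · refine pow_le_pow_left₀ (norm_nonneg _) ?_ 2
      rw [hq, Polynomial.eval_comp]
      refine h _ ?_
      have : ‖x‖ = 1 := by simpa using hx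
      simp [this, abs_of_nonneg (zero_le_one.trans hR)]
  rw [← Polynomial.sum_sq_norm_coeff_eq_circleAverage] at h1
  have h2 : ‖q.coeff k‖ ^ 2 ≤ B ^ 2 := by
    by_cases hk : k ∈ q.support
    · exact (Finset.single_le_sum (f := fun i => ‖q.coeff i‖ ^ 2)
        (fun _ _ => by positivity) hk).trans h1
    · rw [Polynomial.notMem_support_iff.mp hk]; simp; positivity
  have h3 : ‖q.coeff k‖ ≤ B := (pow_le_pow_iff_left₀ (norm_nonneg _) hB two_ne_zero).mp h2
  rw [hq, Polynomial.comp_C_mul_X_coeff, norm_mul, norm_pow, Complex.norm_real,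
    Real.norm_of_nonneg (by linarith)] at h3
  exact (le_mul_of_one_le_right (norm_nonneg _) (one_le_pow₀ hR)).trans h3

variable {K : Type*} [Field K] [NumberField K]

/-- Liouville's inequality: the norm is a nonzero integer, so no conjugate can be very small while
the others are bounded. -/
theorem norm_embedding_ge_of_forall_le {a : 𝓞 K} (ha : a ≠ 0) {B : ℝ}
    (h : ∀ τ : K →+* ℂ, ‖τ a‖ ≤ Real.exp B) (hB : 0 ≤ B) (σ : K →+* ℂ) :
    Real.exp (-(Module.finrank ℚ K * B)) ≤ ‖σ a‖ := by
  have h1 : (1 : ℝ) ≤ ‖Algebra.norm ℚ (a : K)‖ := by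
    have h2 : Algebra.norm ℤ a ≠ 0 := Algebra.norm_ne_zero_iff.mpr ha
    rw [← Algebra.coe_norm_int, ← Rat.norm_cast_real, Rat.cast_intCast, Real.norm_eq_abs]
    exact_mod_cast Int.one_le_abs h2
  have h3 := norm_norm_le_norm_mul_house_pow (a : K) σ
  have hh : house (a : K) ≤ Real.exp B :=
    (pi_norm_le_iff_of_nonneg (Real.exp_pos B).le).mpr h
  have h4 : house (a : K) ^ (Module.finrank ℚ K - 1) ≤ Real.exp (Module.finrank ℚ K * B) := by
    calc _ ≤ Real.exp B ^ (Module.finrank ℚ K - 1) :=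
          pow_le_pow_left₀ (norm_nonneg _) hh _
      _ ≤ Real.exp B ^ Module.finrank ℚ K :=
          pow_le_pow_right₀ (Real.one_le_exp hB) (Nat.sub_le _ _)
      _ = _ := by rw [← Real.exp_nat_mul]
  rw [Real.exp_neg, inv_le_iff_one_le_mul₀ (Real.exp_pos _)]
  exact h1.trans (h3.trans (by gcongr))

theorem norm_sum_range_mul_pow_le {a : ℕ → ℂ} {A : ℝ} (ha : ∀ k, ‖a k‖ ≤ A) {t : ℂ}
    (ht : 2 ≤ ‖t‖) (M : ℕ) : ‖∑ k ∈ Finset.range M, a k * t ^ k‖ ≤ 2 * A * ‖t‖ ^ M / ‖t‖ := by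
  have hA : 0 ≤ A := (norm_nonneg _).trans (ha 0)
  have h1 : ‖∑ k ∈ Finset.range M, a k * t ^ k‖ ≤ A * ∑ k ∈ Finset.range M, ‖t‖ ^ k := by
    rw [Finset.mul_sum]
    refine norm_sum_le_of_le _ fun k _ => ?_
    rw [norm_mul, norm_pow]
    gcongr
    exact ha k
  refine h1.trans ?_
  rw [geom_sum_eq (by linarith), mul_div_assoc', div_le_div_iff₀ (by linarith) (by linarith)]
  have : 0 ≤ ‖t‖ ^ M := by positivity
  nlinarith [mul_nonneg hA this]

variable {n : ℕ}

/-- A form with coefficients in `𝓞_K[s]` whose conjugates are bounded on a circle has specializations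
of the expected size. -/
theorem exists_abs_log_coeffNorm_map_sub_le (σ : K →+* ℂ)
    {Q : MvPolynomial (Fin n) (Polynomial (𝓞 K))} (hQ : Q ≠ 0) {R B : ℝ} (hR : 1 ≤ R) (hB : 0 ≤ B)
    (h : ∀ (τ : K →+* ℂ) (t : ℂ), ‖t‖ = R → ∀ b,
      ‖(coeff b Q).eval₂ (τ.comp (algebraMap (𝓞 K) K)) t‖ ≤ Real.exp B) :
    ∃ M : ℕ, ∀ t : ℂ, (Module.finrank ℚ K + 2) * (B + 2) ≤ Real.log ‖t‖ →
      |Real.log (coeffNorm absComplex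
        (MvPolynomial.map (Polynomial.eval₂RingHom (σ.comp (algebraMap (𝓞 K) K)) t) Q))
        - M * Real.log ‖t‖| ≤ (Module.finrank ℚ K + 2) * (B + 2) := by
  set κ := Module.finrank ℚ K with hκ
  have hcoef : ∀ (τ : K →+* ℂ) b k, ‖τ ((coeff b Q).coeff k : 𝓞 K)‖ ≤ Real.exp B := by
    intro τ b k
    have := norm_coeff_le_of_forall_norm_eq
      (p := (coeff b Q).map (τ.comp (algebraMap (𝓞 K) K))) hR (B := Real.exp B) (fun t ht => by
        rw [Polynomial.eval_map]; exact h τ t ht b) k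
    rwa [Polynomial.coeff_map] at this
  have hne : Q.support.Nonempty := support_nonempty.mpr hQ
  -- A coefficient of maximal degree M in s. Its leading coefficient is a nonzero algebraic integer
  -- and makes t^M dominate.
  obtain ⟨b₀, hb₀, hmax⟩ := Finset.exists_max_image Q.support (fun b => (coeff b Q).natDegree) hne
  set M := (coeff b₀ Q).natDegree with hM
  have hMle : ∀ b, (coeff b Q).natDegree ≤ M := fun b => by
    by_cases hb : b ∈ Q.support
    · exact hmax b hb
    · rw [notMem_support_iff.mp hb]; simp
  set a : 𝓞 K := (coeff b₀ Q).coeff M with ha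
  have ha0 : a ≠ 0 := Polynomial.leadingCoeff_ne_zero.mpr (mem_support_iff.mp hb₀)
  have halow := norm_embedding_ge_of_forall_le ha0 (fun τ => hcoef τ b₀ M) hB σ
  refine ⟨M, fun t ht => ?_⟩
  set L := Real.log ‖t‖ with hL
  have hκ0 : (0 : ℝ) ≤ κ := κ.cast_nonneg
  have hL4 : 4 ≤ L := by nlinarith
  have htpos : 0 < ‖t‖ := by
    by_contra! h0
    have : ‖t‖ = 0 := le_antisymm h0 (norm_nonneg _)
    rw [this, Real.log_zero] at hL; linarith
  have htL : ‖t‖ = Real.exp L := (Real.exp_log htpos).symm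
  have ht2 : 2 ≤ ‖t‖ := by
    rw [htL]; linarith [Real.add_one_le_exp L]
  have hexp : ∀ b, (coeff b Q).eval₂ (σ.comp (algebraMap (𝓞 K) K)) t
      = (∑ k ∈ Finset.range M, σ ((coeff b Q).coeff k : 𝓞 K) * t ^ k)
        + σ ((coeff b Q).coeff M : 𝓞 K) * t ^ M := fun b => by
    rw [Polynomial.eval₂_eq_sum_range' _ (Nat.lt_succ_of_le (hMle b)), Finset.sum_range_succ]
    rfl
  set q := MvPolynomial.map (Polynomial.eval₂RingHom (σ.comp (algebraMap (𝓞 K) K)) t) Q with hq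
  have hqc : ∀ b, coeff b q = (coeff b Q).eval₂ (σ.comp (algebraMap (𝓞 K) K)) t := fun b => by
    rw [hq, coeff_map]; rfl
  have hupp : coeffNorm absComplex q ≤ 2 * Real.exp B * ‖t‖ ^ M := by
    refine coeffNorm_le fun b => ?_
    rw [absComplex_apply, hqc, hexp]
    refine (norm_add_le _ _).trans ?_
    have h1 := norm_sum_range_mul_pow_le (hcoef σ b) ht2 M
    have h2 : 2 * Real.exp B * ‖t‖ ^ M / ‖t‖ ≤ Real.exp B * ‖t‖ ^ M := by
      rw [div_le_iff₀ htpos]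
      have : 0 ≤ Real.exp B * ‖t‖ ^ M := by positivity
      nlinarith
    rw [norm_mul, norm_pow]
    have h3 := mul_le_mul_of_nonneg_right (hcoef σ b M) (pow_nonneg htpos.le M)
    linarith
  have hlow : Real.exp (-(κ * B)) / 2 * ‖t‖ ^ M ≤ coeffNorm absComplex q := by
    refine le_trans ?_ (norm_coeff_le_coeffNorm q b₀)
    rw [hqc, hexp]
    have h1 := norm_sum_range_mul_pow_le (hcoef σ b₀) ht2 M
    have h2 : 2 * Real.exp B * ‖t‖ ^ M / ‖t‖ ≤ Real.exp (-(κ * B)) / 2 * ‖t‖ ^ M := by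
      rw [div_le_iff₀ htpos]
      -- The threshold on log|t| is set for this: the lower order terms take away at most half of
      -- the leading one.
      have h4 : 4 * Real.exp B ≤ Real.exp (-(κ * B)) * ‖t‖ := by
        rw [htL, ← Real.exp_add]
        have h5 : (4 : ℝ) ≤ Real.exp 3 := by linarith [Real.add_one_le_exp (3 : ℝ)]
        calc 4 * Real.exp B ≤ Real.exp 3 * Real.exp B := by gcongr
          _ = Real.exp (3 + B) := (Real.exp_add _ _).symm
          _ ≤ _ := Real.exp_le_exp.mpr (by nlinarith)
      have : 0 ≤ ‖t‖ ^ M := by positivity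
      nlinarith
    have h3 := mul_le_mul_of_nonneg_right halow (pow_nonneg htpos.le M)
    have h4 := norm_sub_le_norm_add (σ (a : K) * t ^ M)
      (∑ k ∈ Finset.range M, σ ((coeff b₀ Q).coeff k : 𝓞 K) * t ^ k)
    rw [norm_mul, norm_pow] at h4
    rw [add_comm]
    linarith
  have hpos : 0 < coeffNorm absComplex q := lt_of_lt_of_le (by positivity) hlow
  have l1 := Real.log_le_log hpos hupp
  have l2 := Real.log_le_log (by positivity) hlow
  rw [Real.log_mul (by positivity) (by positivity), Real.log_mul (by norm_num) (by positivity),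
    Real.log_exp, Real.log_pow] at l1
  rw [Real.log_mul (by positivity) (by positivity), Real.log_div (by positivity) (by norm_num),
    Real.log_exp, Real.log_pow] at l2
  have l3 : Real.log 2 ≤ 1 := by linarith [Real.log_two_lt_d9]
  rw [abs_le]
  constructor
  · linarith [mul_nonneg hκ0 hB]
  · linarith [mul_nonneg hκ0 hB]

end IntegralForms

end EscapeRate
end

noncomputable section
namespace EscapeRate
open MvPolynomial Bornology

/-! ### Perturbed linear recursions and the comparison of limits -/

section Recursion

/-- Absorbs the linear growth of log(e_j + 1) into √d^j; 5/4 is a convenient number below √2. -/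
theorem natCast_add_one_le_four_mul_pow {q : ℝ} (hq : 5 / 4 ≤ q) (j : ℕ) : (j : ℝ) + 1 ≤ 4 * q ^ j := by
  have h1 := one_add_mul_le_pow (a := (1 / 4 : ℝ)) (by norm_num) j
  have h2 : (1 + 1 / 4 : ℝ) ^ j ≤ q ^ j := pow_le_pow_left₀ (by norm_num) (by linarith) j
  linarith

theorem five_quarters_le_sqrt {d : ℕ} (hd : 2 ≤ d) : (5 / 4 : ℝ) ≤ √d := by
  have : (2 : ℝ) ≤ d := by exact_mod_cast hd
  exact Real.le_sqrt_of_sq_le (by linarith)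

/-- The growth of the degrees of iterated pushforwards. -/
theorem exists_degree_mul_le {d D N : ℕ} (hd : 2 ≤ d) (hD : D ≤ d ^ (N + 1)) {e : ℕ → ℕ}
    (he : ∀ j, d * e (j + 1) = e j * D) : ∃ C : ℝ, 0 ≤ C ∧ ∀ (j : ℕ) (L : ℝ), 1 ≤ L →
      ((e j : ℝ) + 1) * (L + Real.log (e j + 1)) ≤ C * L * ((d : ℝ) ^ (N + 1) * (√d)⁻¹) ^ j := by
  have hd' : (2 : ℝ) ≤ d := by exact_mod_cast hd
  -- Degrees grow by at most d^N per step, a factor d slower than δ = d^(N+1). Half of this gain, a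
  -- factor √d, pays for the logarithm, and the other half remains as decay.
  have hstep : ∀ j, e (j + 1) ≤ e j * d ^ N := fun j => by
    refine Nat.le_of_mul_le_mul_left ?_ (show 0 < d by omega)
    rw [he]
    calc e j * D ≤ e j * d ^ (N + 1) := Nat.mul_le_mul_left _ hD
      _ = _ := by ring
  have hgrow : ∀ j, (e j : ℝ) + 1 ≤ (e 0 + 1) * ((d : ℝ) ^ N) ^ j := fun j => by
    induction j with
    | zero => simp
    | succ j ih =>
      have h1 : (e (j + 1) : ℝ) ≤ e j * (d : ℝ) ^ N := by exact_mod_cast hstep j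
      have h2 : (1 : ℝ) ≤ (d : ℝ) ^ N := one_le_pow₀ (by linarith)
      calc (e (j + 1) : ℝ) + 1 ≤ (e j + 1) * (d : ℝ) ^ N := by linarith
        _ ≤ (e 0 + 1) * ((d : ℝ) ^ N) ^ j * (d : ℝ) ^ N := by gcongr
        _ = _ := by ring
  have h0 : (0 : ℝ) ≤ e 0 := Nat.cast_nonneg _
  refine ⟨(e 0 + 1) * (1 + e 0 + N * d) * 4, by positivity, fun j L hL => ?_⟩
  have hlog : Real.log ((e j : ℝ) + 1) ≤ (e 0 + N * d) * (j + 1) := by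
    have h1 := Real.log_le_log (by positivity) (hgrow j)
    rw [Real.log_mul (by positivity) (by positivity), Real.log_pow, Real.log_pow] at h1
    have h2 : Real.log ((e 0 : ℝ) + 1) ≤ e 0 :=
      (Real.log_le_sub_one_of_pos (by positivity)).trans (by linarith)
    have h3 : Real.log d ≤ d := (Real.log_le_sub_one_of_pos (by positivity)).trans (by linarith)
    have h4 : (j : ℝ) * (N * Real.log d) ≤ j * (N * d) := by gcongr
    have h5 : 0 ≤ (e 0 : ℝ) * j := by positivity
    have h6 : 0 ≤ (N : ℝ) * d := by positivity
    linarith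
  have hsum : L + Real.log ((e j : ℝ) + 1) ≤ (1 + e 0 + N * d) * (4 * √d ^ j) * L := by
    have h1 := natCast_add_one_le_four_mul_pow (five_quarters_le_sqrt hd) j
    have hj : (0 : ℝ) ≤ j := j.cast_nonneg
    have hc : (0 : ℝ) ≤ e 0 + N * d := by positivity
    calc L + Real.log ((e j : ℝ) + 1) ≤ L * (j + 1) + (e 0 + N * d) * (j + 1) * L := by
          refine add_le_add (le_mul_of_one_le_right (by linarith) (by linarith)) ?_
          exact hlog.trans (le_mul_of_one_le_right (by positivity) hL)
      _ = (1 + e 0 + N * d) * (j + 1) * L := by ring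
      _ ≤ _ := by gcongr
  have hs : (√(d : ℝ)) ≠ 0 := by
    have := five_quarters_le_sqrt hd
    positivity
  have hkey : ((d : ℝ) ^ N) ^ j * √d ^ j = ((d : ℝ) ^ (N + 1) * (√d)⁻¹) ^ j := by
    rw [← mul_pow]
    congr 1
    rw [pow_succ, mul_assoc]
    congr 1
    rw [eq_mul_inv_iff_mul_eq₀ hs, Real.mul_self_sqrt (by positivity)]
  calc _ ≤ ((e 0 + 1) * ((d : ℝ) ^ N) ^ j) * ((1 + e 0 + N * d) * (4 * √d ^ j) * L) := by
        have : 0 ≤ Real.log ((e j : ℝ) + 1) :=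
          Real.log_nonneg (by linarith [Nat.cast_nonneg (α := ℝ) (e j)])
        gcongr
        exact hgrow j
    _ = (e 0 + 1) * (1 + e 0 + N * d) * 4 * L * (((d : ℝ) ^ N) ^ j * √d ^ j) := by ring
    _ = _ := by rw [hkey]

variable {a : ℕ → ℝ} {D δ s M : ℝ}

/-- After division by δ^j the perturbations sum to at most a geometric series. The explicit constant
gives the bound on a fixed circle for all j at once. -/
theorem abs_le_mul_pow_of_recursion (hD0 : 0 ≤ D) (hD : D ≤ δ) (hδ : 1 ≤ δ) (hs0 : 0 ≤ s)
    (hs1 : s < 1) (hM : 0 ≤ M) (h : ∀ j, |a (j + 1) - D * a j| ≤ M * (δ * s) ^ j) (j : ℕ) :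
    |a j| ≤ (|a 0| + M / (1 - s)) * δ ^ j := by
  have key : ∀ j, |a j| ≤ (|a 0| + M * ∑ i ∈ Finset.range j, s ^ i) * δ ^ j := fun j => by
    induction j with
    | zero => simp
    | succ j ih =>
      have h1 : |a (j + 1)| ≤ |a (j + 1) - D * a j| + D * |a j| := by
        calc |a (j + 1)| = |(a (j + 1) - D * a j) + D * a j| := by congr 1; ring
          _ ≤ _ := by
            refine (abs_add_le _ _).trans ?_
            rw [abs_mul, abs_of_nonneg hD0]
      have h2 : D * |a j| ≤ δ * ((|a 0| + M * ∑ i ∈ Finset.range j, s ^ i) * δ ^ j) := by gcongr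
      have h3 : M * (δ * s) ^ j ≤ M * s ^ j * δ ^ (j + 1) := by
        rw [mul_pow, mul_assoc, mul_comm (s ^ j)]
        gcongr
        omega
      rw [Finset.sum_range_succ]
      calc _ ≤ _ := h1.trans (add_le_add (h j) h2)
        _ ≤ M * s ^ j * δ ^ (j + 1) + δ * ((|a 0| + M * ∑ i ∈ Finset.range j, s ^ i) * δ ^ j) := by
          gcongr
        _ = _ := by ring
  refine (key j).trans ?_
  gcongr
  rw [div_eq_mul_inv]
  gcongr
  rw [← tsum_geometric_of_lt_one hs0 hs1]
  exact (summable_geometric_of_lt_one hs0 hs1).sum_le_tsum _ fun _ _ => by positivity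

/-- Convergence of a perturbed linear recursion. -/
theorem exists_tendsto_of_recursion (hD0 : 0 ≤ D) (hD : D ≤ δ) (hδ : 1 ≤ δ) (hs0 : 0 ≤ s)
    (hs1 : s < 1) (hM : 0 ≤ M) (h : ∀ j, |a (j + 1) - D * a j| ≤ M * (δ * s) ^ j) :
    ∃ α, Tendsto (fun j => a j / δ ^ j) atTop (𝓝 α) ∧
      (D = δ → ∀ j, |a j / δ ^ j - α| ≤ M * s ^ j / (1 - s)) ∧ (D < δ → α = 0) := by
  have hδ0 : 0 < δ := by linarith
  have hstep : ∀ j, |a (j + 1) / δ ^ (j + 1) - D / δ * (a j / δ ^ j)| ≤ M * s ^ j := fun j => by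
    have h1 : a (j + 1) / δ ^ (j + 1) - D / δ * (a j / δ ^ j)
        = (a (j + 1) - D * a j) / δ ^ (j + 1) := by
      rw [pow_succ]; field_simp
    rw [h1, abs_div, abs_of_pos (show 0 < δ ^ (j + 1) by positivity), div_le_iff₀ (by positivity)]
    refine (h j).trans ?_
    rw [mul_pow, mul_assoc, mul_comm (δ ^ j)]
    gcongr
    omega
  rcases hD.eq_or_lt with heq | hlt
  -- For D = δ the normalized sequence has geometrically decaying increments.
  · have hdist : ∀ j, dist (a j / δ ^ j) (a (j + 1) / δ ^ (j + 1)) ≤ M * s ^ j := fun j => by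
      have := hstep j
      rw [heq, div_self hδ0.ne', one_mul] at this
      rwa [dist_comm, Real.dist_eq]
    obtain ⟨α, hα⟩ := cauchySeq_tendsto_of_complete (cauchySeq_of_le_geometric s M hs1 hdist)
    refine ⟨α, hα, fun _ j => ?_, fun hlt => absurd heq hlt.ne⟩
    rw [← Real.dist_eq]
    exact dist_le_of_le_geometric_of_tendsto s M hs1 hdist hα j
  · refine ⟨0, ?_, fun heq => absurd heq hlt.ne, fun _ => rfl⟩
    have hρ1 : D / δ < 1 := (div_lt_one hδ0).mpr hlt
    have hρ0 : 0 ≤ D / δ := by positivity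
    -- For D < δ, any r between max(D/δ, s) and 1 is a decay rate for the normalized sequence.
    obtain ⟨r, hr1, hr2⟩ := exists_between (max_lt hρ1 hs1)
    have hrρ : D / δ < r := (le_max_left _ _).trans_lt hr1
    have hrs : s < r := (le_max_right _ _).trans_lt hr1
    have hr0 : 0 < r := hs0.trans_lt hrs
    set B := max |a 0| (M / (r - D / δ)) with hB
    have hB0 : 0 ≤ B := (abs_nonneg _).trans (le_max_left _ _)
    have hBM : M ≤ B * (r - D / δ) := by
      rw [← div_le_iff₀ (by linarith)]
      exact le_max_right _ _
    have hbd : ∀ j, |a j / δ ^ j| ≤ B * r ^ j := fun j => by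
      induction j with
      | zero => simp [hB]
      | succ j ih =>
        calc |a (j + 1) / δ ^ (j + 1)|
            = |(a (j + 1) / δ ^ (j + 1) - D / δ * (a j / δ ^ j)) + D / δ * (a j / δ ^ j)| := by
              congr 1; ring
          _ ≤ M * s ^ j + D / δ * |a j / δ ^ j| := by
              refine (abs_add_le _ _).trans ?_
              rw [abs_mul (D / δ), abs_of_nonneg hρ0]
              gcongr
              exact hstep j
          _ ≤ B * (r - D / δ) * r ^ j + D / δ * (B * r ^ j) := by gcongr
          _ = _ := by ring
    refine squeeze_zero_norm hbd ?_
    simpa using (tendsto_pow_atTop_nhds_zero_of_lt_one hr0.le hr2).const_mul B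

/-- Comparison of the limits of two sequences that are close for few indices. -/
theorem abs_sub_mul_le_rpow {d n : ℕ} (hd : 2 ≤ d) (hn : 1 ≤ n) {A B : ℕ → ℝ} {α β C M L p : ℝ}
    (hC : 1 ≤ C) (hL : C ≤ L) (hM : 0 ≤ M) (hp : 1 - 1 / (2 * n) ≤ p)
    (hclose : ∀ j, C * ((d : ℝ) ^ n) ^ j ≤ L → |A j - B j * L| ≤ C)
    (hA : ∀ j, |A j - α| ≤ M * L * (√d)⁻¹ ^ j) (hB : ∀ j, |B j - β| ≤ M * (√d)⁻¹ ^ j) :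
    |α - β * L| ≤ (2 * M * √d * C + C) * L ^ p := by
  have hd' : (2 : ℝ) ≤ d := by exact_mod_cast hd
  have hn' : (1 : ℝ) ≤ n := by exact_mod_cast hn
  have hL1 : 1 ≤ L := hC.trans hL
  have hC0 : 0 < C := by linarith
  have hs0 : 0 < √(d : ℝ) := by have := five_quarters_le_sqrt hd; linarith
  -- The largest j for which the comparison applies. Then d^(n(j+1)) > L/C, so d^(-j/2) is at most
  -- √d (L/C)^(-1/(2n)).
  obtain ⟨j, hj1, hj2⟩ := exists_nat_pow_near (x := L / C) (y := (d : ℝ) ^ n)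
    ((one_le_div hC0).mpr hL) (one_lt_pow₀ (by linarith) (by omega))
  have h1 := hclose j (by rwa [mul_comm, ← le_div_iff₀ hC0])
  have hx0 : 0 < L / C := by positivity
  have hpow : (L / C) ^ (1 / (2 * n : ℝ)) ≤ √d ^ (j + 1) := by
    have h2 : ((d : ℝ) ^ n) ^ (j + 1) = (√d ^ (j + 1)) ^ (2 * n : ℝ) := by
      have : (2 * n : ℝ) = ((2 * n : ℕ) : ℝ) := by push_cast; ring
      rw [this, Real.rpow_natCast, ← pow_mul, ← pow_mul,
        show (j + 1) * (2 * n) = 2 * (n * (j + 1)) by ring, pow_mul (√(d : ℝ)) 2,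
        Real.sq_sqrt (by positivity)]
    rw [h2] at hj2
    calc (L / C) ^ (1 / (2 * n : ℝ)) ≤ ((√d ^ (j + 1)) ^ (2 * n : ℝ)) ^ (1 / (2 * n : ℝ)) :=
          Real.rpow_le_rpow hx0.le hj2.le (by positivity)
      _ = _ := by
          rw [← Real.rpow_mul (by positivity), mul_one_div_cancel (by positivity), Real.rpow_one]
  have hsj : L * (√d)⁻¹ ^ j ≤ √d * C * L ^ p := by
    have h3 : (√(d : ℝ))⁻¹ ^ j = √d / √d ^ (j + 1) := by
      rw [pow_succ, inv_pow]; field_simp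
    have h4 : L / C * (L / C) ^ (-(1 / (2 * n : ℝ))) ≤ L ^ p := by
      nth_rewrite 1 [← Real.rpow_one (L / C)]
      rw [← Real.rpow_add hx0]
      have h5 : (1 : ℝ) / (2 * n) ≤ 1 := by
        rw [div_le_one (by positivity)]; linarith
      calc (L / C) ^ (1 + -(1 / (2 * n : ℝ))) ≤ L ^ (1 + -(1 / (2 * n : ℝ))) :=
            Real.rpow_le_rpow hx0.le (div_le_self (by linarith) hC) (by linarith)
        _ ≤ L ^ p := Real.rpow_le_rpow_of_exponent_le hL1 (by linarith)
    have h6 : (√(d : ℝ) ^ (j + 1))⁻¹ ≤ (L / C) ^ (-(1 / (2 * n : ℝ))) := by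
      rw [Real.rpow_neg hx0.le]
      exact inv_anti₀ (by positivity) hpow
    calc L * (√d)⁻¹ ^ j = √d * C * (L / C * (√(d : ℝ) ^ (j + 1))⁻¹) := by
          rw [h3]; field_simp
      _ ≤ √d * C * (L / C * (L / C) ^ (-(1 / (2 * n : ℝ)))) := by gcongr
      _ ≤ _ := by gcongr
  have hp0 : 0 ≤ p := by
    refine le_trans ?_ hp
    have : (1 : ℝ) / (2 * n) ≤ 1 := by
      rw [div_le_one (by positivity)]; linarith
    linarith
  have hLp : 1 ≤ L ^ p := Real.one_le_rpow hL1 hp0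
  have hBL : |B j * L - β * L| ≤ M * (L * (√d)⁻¹ ^ j) := by
    rw [← sub_mul, abs_mul, abs_of_nonneg (show 0 ≤ L by linarith)]
    calc _ ≤ M * (√d)⁻¹ ^ j * L := by gcongr; exact hB j
      _ = _ := by ring
  have hAL := hA j
  have e1 : M * (L * (√d)⁻¹ ^ j) ≤ M * (√d * C * L ^ p) := by gcongr
  have e2 : C ≤ C * L ^ p := le_mul_of_one_le_right hC0.le hLp
  rw [abs_le] at *
  constructor <;> linarith [hAL.1, hAL.2, h1.1, h1.2, hBL.1, hBL.2]

end Recursion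

end EscapeRate
end

noncomputable section
namespace EscapeRate
open MvPolynomial Bornology

/-! ### Degrees of the iterates -/

section Iterate

variable {k : Type*} [Field k] [CharZero k] {N d : ℕ}
  {F : Fin (N + 1) → MvPolynomial (Fin (N + 1)) k}

theorem IsLift.iterate_pushforward_ne_zero (hF : IsLift d F) (hd : 1 ≤ d)
    {Φ : MvPolynomial (Fin (N + 1)) k} (hΦ0 : Φ ≠ 0) (j : ℕ) : (pushforward F)^[j] Φ ≠ 0 := by
  induction j with
  | zero => exact hΦ0
  | succ j ih =>
    rw [Function.iterate_succ_apply']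
    exact hF.pushforward_ne_zero hd ih

/-- The degrees of the iterated pushforwards. -/
theorem IsLift.exists_degree_iterate (hF : IsLift d F) (hd : 1 ≤ d) {e : ℕ}
    {Φ : MvPolynomial (Fin (N + 1)) k} (hΦ : Φ.IsHomogeneous e) (hΦ0 : Φ ≠ 0) :
    ∃ e : ℕ → ℕ, (∀ j, d * e (j + 1) = e j * (genericFibre F).ncard) ∧
      ∀ j, ((pushforward F)^[j] Φ).IsHomogeneous (e j) := by
  have hne := hF.iterate_pushforward_ne_zero hd hΦ0
  have hex : ∀ j, ∃ e, ((pushforward F)^[j] Φ).IsHomogeneous e := fun j => by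
    induction j with
    | zero => exact ⟨e, hΦ⟩
    | succ j ih =>
      obtain ⟨e, he⟩ := ih
      rw [Function.iterate_succ_apply']
      obtain ⟨e', -, he'⟩ := hF.exists_isHomogeneous_pushforward hd he (hne j)
      exact ⟨e', he'⟩
  choose e he using hex
  refine ⟨e, fun j => ?_, he⟩
  obtain ⟨e', h1, h2⟩ := hF.exists_isHomogeneous_pushforward hd (he j) (hne j)
  have h3 := he (j + 1)
  have h4 := hne (j + 1)
  rw [Function.iterate_succ_apply'] at h3 h4
  rwa [h3.inj_right h2 h4]

end Iterate

/-! ### The recursions for the iterates, over ℂ and at infinity -/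

section Steps

variable {K : Type*} [Field K] {n : ℕ}

theorem exists_eventually_coeffNorm_specialize_le (σ : K →+* ℂ)
    (Φ : MvPolynomial (Fin n) (RatFunc K)) : ∃ c : ℝ, 0 ≤ c ∧
      ∀ᶠ t in cobounded ℂ, coeffNorm absComplex (specialize σ t Φ) ≤ Real.exp (c * Real.log ‖t‖) := by
  by_cases hΦ : Φ = 0
  · refine ⟨0, le_rfl, Eventually.of_forall fun t => coeffNorm_le fun m => ?_⟩
    rw [coeff_specialize, hΦ, coeff_zero, evalAt_zero]
    simp
  · obtain ⟨c, hc⟩ := exists_eventually_abs_log_coeffNorm_specialize_sub_le σ hΦ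
    refine ⟨|c| + |Real.log (coeffNorm (absInfty K) Φ)|, by positivity, ?_⟩
    filter_upwards [hc, tendsto_log_norm_cobounded.eventually_ge_atTop 1] with t ⟨h1, h2⟩ hL
    rw [← Real.log_le_iff_le_exp (coeffNorm_pos_iff.mpr h1)]
    have h3 := (abs_le.mp h2).2
    have h4 : c ≤ |c| * Real.log ‖t‖ :=
      (le_abs_self c).trans (le_mul_of_one_le_right (abs_nonneg _) hL)
    have h5 := mul_le_mul_of_nonneg_right (le_abs_self (Real.log (coeffNorm (absInfty K) Φ)))
      (zero_le_one.trans hL)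
    linarith

variable [CharZero K] {N d : ℕ} {F : Fin (N + 1) → MvPolynomial (Fin (N + 1)) (RatFunc K)}

/-- Specializations of iterated pushforwards, and their sizes up to a controlled error. -/
theorem IsLift.exists_eventually_iterate (hF : IsLift d F) (hd : 2 ≤ d) (σ : K →+* ℂ) {e : ℕ}
    {Φ : MvPolynomial (Fin (N + 1)) (RatFunc K)} (hΦ : Φ.IsHomogeneous e) (hΦ0 : Φ ≠ 0) :
    ∃ C : ℝ, 0 ≤ C ∧ ∀ᶠ t in cobounded ℂ, ∀ j,
      CoeffsRegularAt σ t ((pushforward F)^[j] Φ) ∧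
      specialize σ t ((pushforward F)^[j] Φ)
        = (pushforward fun i => specialize σ t (F i))^[j] (specialize σ t Φ) ∧
      specialize σ t ((pushforward F)^[j] Φ) ≠ 0 ∧
      |Real.log (coeffNorm absComplex (specialize σ t ((pushforward F)^[j + 1] Φ)))
        - (genericFibre F).ncard
          * Real.log (coeffNorm absComplex (specialize σ t ((pushforward F)^[j] Φ)))|
        ≤ C * Real.log ‖t‖ * ((d : ℝ) ^ (N + 1) * (√d)⁻¹) ^ j := by
  set D := (genericFibre F).ncard with hD
  have hd1 : 1 ≤ d := by omega
  obtain ⟨e, he, hhom⟩ := hF.exists_degree_iterate hd1 hΦ hΦ0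
  obtain ⟨C₁, hC₁, hdeg⟩ := exists_degree_mul_le hd (hF.ncard_genericFibre_le hd1) he
  obtain ⟨m, hdm, G, hG, hrel⟩ := hF.exists_pow_relation
  obtain ⟨C₂, hC₂, hstep⟩ := exists_abs_log_coeffNorm_sub_le (N + 1) D d m (by omega) hd1 hdm
  choose cF hcF0 hcF using fun i => exists_eventually_coeffNorm_specialize_le σ (F i)
  choose cG hcG0 hcG using fun i l => exists_eventually_coeffNorm_specialize_le σ (G i l)
  set c := ∑ i, cF i + ∑ i, ∑ l, cG i l with hc
  have hsF : 0 ≤ ∑ i, cF i := Finset.sum_nonneg fun i _ => hcF0 i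
  have hsG : ∀ i, 0 ≤ ∑ l, cG i l := fun i => Finset.sum_nonneg fun l _ => hcG0 i l
  have hc0 : 0 ≤ c := add_nonneg hsF (Finset.sum_nonneg fun i _ => hsG i)
  have hcFle : ∀ i, cF i ≤ c := fun i =>
    (Finset.single_le_sum (fun i _ => hcF0 i) (Finset.mem_univ i)).trans
      (le_add_of_nonneg_right (Finset.sum_nonneg fun i _ => hsG i))
  have hcGle : ∀ i l, cG i l ≤ c := fun i l =>
    ((Finset.single_le_sum (fun l _ => hcG0 i l) (Finset.mem_univ l)).trans
      (Finset.single_le_sum (fun i _ => hsG i) (Finset.mem_univ i))).trans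
      (le_add_of_nonneg_left hsF)
  refine ⟨C₂ * (c + 1) * C₁, by positivity, ?_⟩
  -- These conditions concern F, G and Φ but no iterate, so one neighbourhood of infinity serves all
  -- j.
  filter_upwards [eventually_all.mpr hcF, eventually_all.mpr fun i => eventually_all.mpr (hcG i),
    eventually_all.mpr fun i => eventually_coeffsRegularAt σ (F i),
    eventually_all.mpr fun i => eventually_all.mpr fun l => eventually_coeffsRegularAt σ (G i l),
    eventually_coeffsRegularAt σ Φ, exists_eventually_abs_log_coeffNorm_specialize_sub_le σ hΦ0
      |>.choose_spec, tendsto_log_norm_cobounded.eventually_ge_atTop 1]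
    with t hFt hGt hFr hGr hΦr hΦt hL
  have hpush : ∀ {Ψ}, CoeffsRegularAt σ t Ψ → _ := fun {Ψ} hΨ =>
    specialize_pushforward hd1 hdm hF.1 hG hrel hFr hGr (Φ := Ψ) hΨ
  have hmain : ∀ j, CoeffsRegularAt σ t ((pushforward F)^[j] Φ) ∧
      specialize σ t ((pushforward F)^[j] Φ)
        = (pushforward fun i => specialize σ t (F i))^[j] (specialize σ t Φ) := fun j => by
    induction j with
    | zero => exact ⟨hΦr, rfl⟩
    | succ j ih =>
      obtain ⟨h1, h2, -⟩ := hpush ih.1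
      rw [Function.iterate_succ_apply', Function.iterate_succ_apply', ← ih.2]
      exact ⟨h1, h2⟩
  have hone : ∀ j, specialize σ t ((pushforward F)^[j] Φ) ≠ 0 →
      specialize σ t ((pushforward F)^[j + 1] Φ) ≠ 0 ∧
      |Real.log (coeffNorm absComplex (specialize σ t ((pushforward F)^[j + 1] Φ)))
        - D * Real.log (coeffNorm absComplex (specialize σ t ((pushforward F)^[j] Φ)))|
        ≤ C₂ * (c + 1) * C₁ * Real.log ‖t‖ * ((d : ℝ) ^ (N + 1) * (√d)⁻¹) ^ j := fun j hj => by
    obtain ⟨-, -, hfib⟩ := hpush (hmain j).1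
    rw [← Function.iterate_succ_apply' (pushforward F)] at hfib
    have hL0 : 0 ≤ Real.log ‖t‖ := by linarith
    obtain ⟨h1, h2⟩ := hstep (fun i => specialize σ t (F i)) (fun i l => specialize σ t (G i l))
      (Real.exp (c * Real.log ‖t‖)) (fun i => isHomogeneous_specialize (hF.1 i))
      (fun i l => isHomogeneous_specialize (hG i l)) (sum_specialize_mul hFr hGr hrel)
      (Real.one_le_exp (by positivity))
      (fun i => (hFt i).trans (Real.exp_le_exp.mpr (by gcongr; exact hcFle i)))
      (fun i l => (hGt i l).trans (Real.exp_le_exp.mpr (by gcongr; exact hcGle i l)))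
      (specialize σ t ((pushforward F)^[j] Φ)) (specialize σ t ((pushforward F)^[j + 1] Φ))
      (e j) (e (j + 1)) (isHomogeneous_specialize (hhom j)).totalDegree_le
      (isHomogeneous_specialize (hhom (j + 1))).totalDegree_le
      ((Nat.le_mul_of_pos_left _ hd1).trans (he j).le) hfib hj
    refine ⟨h1, h2.trans ?_⟩
    rw [Real.log_exp]
    have hle : 0 ≤ Real.log ((e j : ℝ) + 1) :=
      Real.log_nonneg (by linarith [Nat.cast_nonneg (α := ℝ) (e j)])
    calc C₂ * (e j + 1) * (c * Real.log ‖t‖ + 1 + Real.log (e j + 1))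
        ≤ C₂ * (e j + 1) * ((c + 1) * (Real.log ‖t‖ + Real.log (e j + 1))) := by
          gcongr
          linarith [mul_nonneg hc0 hle]
      _ = C₂ * (c + 1) * ((e j + 1) * (Real.log ‖t‖ + Real.log (e j + 1))) := by ring
      _ ≤ C₂ * (c + 1) * (C₁ * Real.log ‖t‖ * ((d : ℝ) ^ (N + 1) * (√d)⁻¹) ^ j) := by
          exact mul_le_mul_of_nonneg_left (hdeg j _ hL) (by positivity)
      _ = _ := by ring
  have hne : ∀ j, specialize σ t ((pushforward F)^[j] Φ) ≠ 0 := fun j => by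
    induction j with
    | zero => exact hΦt.1
    | succ j ih => exact (hone j ih).1
  exact fun j => ⟨(hmain j).1, (hmain j).2, hne j, (hone j (hne j)).2⟩

/-- Divide by log|t|, which is unbounded. This turns asymptotic statements over ℂ into exact ones at
infinity. -/
theorem le_of_eventually_mul_log_norm_le {x A B : ℝ}
    (h : ∀ᶠ t in cobounded ℂ, x * Real.log ‖t‖ ≤ A * Real.log ‖t‖ + B) : x ≤ A := by
  by_contra! hlt
  obtain ⟨t, h1, h2⟩ := (h.and (tendsto_log_norm_cobounded.eventually_gt_atTop
    (B / (x - A)))).exists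
  rw [div_lt_iff₀ (by linarith)] at h2
  linarith

/-- The growth of the degrees in `s` of iterated pushforwards. -/
theorem IsLift.exists_abs_log_absInfty_iterate_sub_le (hF : IsLift d F) (hd : 2 ≤ d)
    (σ : K →+* ℂ) {e : ℕ} {Φ : MvPolynomial (Fin (N + 1)) (RatFunc K)} (hΦ : Φ.IsHomogeneous e)
    (hΦ0 : Φ ≠ 0) :
    ∃ C : ℝ, 0 ≤ C ∧ ∀ j, |Real.log (coeffNorm (absInfty K) ((pushforward F)^[j + 1] Φ))
        - (genericFibre F).ncard * Real.log (coeffNorm (absInfty K) ((pushforward F)^[j] Φ))|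
        ≤ C * ((d : ℝ) ^ (N + 1) * (√d)⁻¹) ^ j := by
  obtain ⟨C, hC, hev⟩ := hF.exists_eventually_iterate hd σ hΦ hΦ0
  refine ⟨C, hC, fun j => ?_⟩
  have hne := hF.iterate_pushforward_ne_zero (by omega) hΦ0
  obtain ⟨c₀, h₀⟩ := exists_eventually_abs_log_coeffNorm_specialize_sub_le σ (hne j)
  obtain ⟨c₁, h₁⟩ := exists_eventually_abs_log_coeffNorm_specialize_sub_le σ (hne (j + 1))
  set D : ℝ := ((genericFibre F).ncard : ℝ)
  have hD : 0 ≤ D := Nat.cast_nonneg _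
  rw [abs_le']
  constructor <;>
  -- For fixed j, replace the archimedean sizes by b_j log|t| + O(1) in their recursion and compare
  -- the coefficients of log|t|.
  · refine le_of_eventually_mul_log_norm_le (B := c₁ + D * c₀) ?_
    filter_upwards [hev, h₀, h₁] with t ht ht₀ ht₁
    have a1 := abs_le.mp (ht j).2.2.2
    have a2 := abs_le.mp ht₀.2
    have a3 := abs_le.mp ht₁.2
    have a4 := mul_le_mul_of_nonneg_left a2.1 hD
    have a5 := mul_le_mul_of_nonneg_left a2.2 hD
    linarith [a1.1, a1.2, a3.1, a3.2]

end Steps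

end EscapeRate
end

noncomputable section
namespace EscapeRate
open MvPolynomial Bornology

/-! ### Denominators of the iterates -/

section IntegralModel

variable {k : Type*} [Field k] [CharZero k] {N d : ℕ}
  {F : Fin (N + 1) → MvPolynomial (Fin (N + 1)) k}

theorem fibreProd_C_mul (hfin : (genericFibre F).Finite) (c : k)
    (Φ : MvPolynomial (Fin (N + 1)) k) :
    fibreProd F (C c * Φ) = algebraMap k _ c ^ (genericFibre F).ncard * fibreProd F Φ := by
  simp only [fibreProd]
  rw [finprod_mem_eq_finite_toFinset_prod _ hfin, finprod_mem_eq_finite_toFinset_prod _ hfin,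
    Set.ncard_eq_toFinset_card _ hfin, ← Finset.prod_const, ← Finset.prod_mul_distrib]
  exact Finset.prod_congr rfl fun Y _ => by simp

variable {A : Type*} [CommRing A] [IsDomain A] [Algebra A k] [IsFractionRing A k]
  [IsIntegrallyClosed A]

/-- Iterated pushforwards have denominators whose size is controlled. -/
theorem IsLift.exists_integral_iterate (hF : IsLift d F) (hd : 2 ≤ d) {e : ℕ}
    {Φ : MvPolynomial (Fin (N + 1)) k} (hΦ : Φ.IsHomogeneous e) (hΦ0 : Φ ≠ 0) :
    ∃ R : A, R ≠ 0 ∧ ∃ (E : ℕ → ℕ) (c : ℕ), (∀ j, E j ≤ c * (d ^ (N + 1)) ^ j) ∧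
      ∃ Q : ℕ → MvPolynomial (Fin (N + 1)) A, ∀ j, MvPolynomial.map (algebraMap A k) (Q j)
        = C (algebraMap A k R ^ E j) * (pushforward F)^[j] Φ := by
  have hd1 : 1 ≤ d := by omega
  have hinj : Function.Injective (algebraMap A k) := IsFractionRing.injective A k
  have hfin := hF.genericFibre_finite hd1
  set D := (genericFibre F).ncard with hD
  have hDle : D ≤ d ^ (N + 1) := hF.ncard_genericFibre_le hd1
  obtain ⟨e, he, hhom⟩ := hF.exists_degree_iterate hd1 hΦ hΦ0
  obtain ⟨m, hdm, R₁, hR₁, G, hG, hrel⟩ := hF.exists_pow_relation_integral (A := A)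
  obtain ⟨R₀, hR₀, Φ', hΦ'⟩ := exists_common_denom (A := A) (fun _ : Unit => Φ)
  set R := R₀ * R₁ with hR
  have hR0 : algebraMap A k R ≠ 0 := by
    rw [Ne, map_eq_zero_iff _ hinj]; exact mul_ne_zero hR₀ hR₁
  have hrel' : ∀ i, C (algebraMap A k R) * (X i : MvPolynomial (Fin (N + 1)) k) ^ m
      = ∑ l, MvPolynomial.map (algebraMap A k) (C R₀ * G i l) * F l := fun i => by
    rw [hR, map_mul, C_mul, mul_assoc, hrel i, Finset.mul_sum]
    exact Finset.sum_congr rfl fun l _ => by rw [map_mul, MvPolynomial.map_C, mul_assoc]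
  have hG' : ∀ i l, (C R₀ * G i l).IsHomogeneous (m - d) := fun i l => by
    simpa using (isHomogeneous_C (Fin (N + 1)) R₀).mul (hG i l)
  -- The factor R^(E_j) is raised to the power D by the product over the fibre, and clearing the
  -- denominators of the fibre costs a further e_j D. Start at 1: one factor R clears Φ.
  let E : ℕ → ℕ := fun j => Nat.rec 1 (fun j E => D * (E + e j)) j
  have hE : ∀ j, E (j + 1) = D * (E j + e j) := fun j => rfl
  have hQ : ∀ j, ∃ Q : MvPolynomial (Fin (N + 1)) A, MvPolynomial.map (algebraMap A k) Q
      = C (algebraMap A k R ^ E j) * (pushforward F)^[j] Φ := fun j => by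
    induction j with
    | zero =>
      refine ⟨C R₁ * Φ' (), ?_⟩
      rw [map_mul, hΦ', MvPolynomial.map_C, ← mul_assoc, ← C_mul, ← map_mul, mul_comm R₁]
      simp [E, hR]
    | succ j ih =>
      obtain ⟨Q, hQ⟩ := ih
      have hQh : Q.IsHomogeneous (e j) := IsHomogeneous.of_map hinj (by
        rw [hQ]; simpa using (isHomogeneous_C (Fin (N + 1)) (algebraMap A k R ^ E j)).mul (hhom j))
      obtain ⟨P, hP⟩ := exists_integral_fibreProd hd1 hdm hG' hrel' hfin (Or.inr hQh)
      refine ⟨P, toGenericClosure_injective ?_⟩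
      change integralToGenericClosure A k N P = _
      rw [hP, hQ, fibreProd_C_mul hfin, map_mul (toGenericClosure k N), toGenericClosure_C, Function.iterate_succ_apply',
        hF.toGenericClosure_pushforward hd1, ← mul_assoc, hE, ← hD,
        map_pow (algebraMap k (GenericClosure k N)), map_pow (algebraMap k (GenericClosure k N)),
        ← pow_mul, ← pow_add]
      congr 2
      ring
  -- The added term 2e_j closes the induction: 2e_{j+1} ≤ d e_{j+1} = D e_j, so the sum is at most
  -- multiplied by D.
  have hbd : ∀ j, E j + 2 * e j ≤ (1 + 2 * e 0) * (d ^ (N + 1)) ^ j := fun j => by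
    induction j with
    | zero => simp [E]
    | succ j ih =>
      have h1 : 2 * e (j + 1) ≤ e j * D := by
        rw [← he]; exact Nat.mul_le_mul_right _ hd
      calc E (j + 1) + 2 * e (j + 1) ≤ D * (E j + e j) + e j * D := by rw [hE]; omega
        _ = D * (E j + 2 * e j) := by ring
        _ ≤ d ^ (N + 1) * ((1 + 2 * e 0) * (d ^ (N + 1)) ^ j) := Nat.mul_le_mul hDle ih
        _ = _ := by ring
  choose Q hQ using hQ
  exact ⟨R, mul_ne_zero hR₀ hR₁, E, 1 + 2 * e 0, fun j => (Nat.le_add_right _ _).trans (hbd j),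
    Q, hQ⟩

end IntegralModel

end EscapeRate
end

noncomputable section
namespace EscapeRate
open MvPolynomial Bornology

/-! ### Uniform comparison of the early iterates over a number field -/

section Arithmetic

open NumberField

theorem coeffNorm_C_mul {k : Type*} [Field k] (v : AbsoluteValue k ℝ) {n : ℕ} (c : k)
    (Φ : MvPolynomial (Fin n) k) : coeffNorm v (C c * Φ) = v c * coeffNorm v Φ := by
  simp only [coeffNorm, coeff_C_mul, map_mul]
  exact (Real.mul_iSup_of_nonneg (v.nonneg c) _).symm

variable (K : Type*) [Field K] [NumberField K]

/-- The inclusion of `𝓞_K[s]` in `K(s)`. -/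
def integersToRatFunc : Polynomial (𝓞 K) →+* RatFunc K :=
  (algebraMap (Polynomial K) (RatFunc K)).comp (Polynomial.mapRingHom (algebraMap (𝓞 K) K))

theorem integersToRatFunc_injective : Function.Injective (integersToRatFunc K) :=
  (RatFunc.algebraMap_injective K).comp
    (Polynomial.map_injective _ (IsFractionRing.injective (𝓞 K) K))

variable {K} in
theorem exists_integers_map_eq_C_mul (f : Polynomial K) : ∃ a : 𝓞 K, (a : K) ≠ 0 ∧
    ∃ p : Polynomial (𝓞 K), p.map (algebraMap (𝓞 K) K) = Polynomial.C (a : K) * f := by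
  obtain ⟨a, ha, hp⟩ := IsLocalization.integerNormalization_spec (nonZeroDivisors (𝓞 K)) f
  refine ⟨a, ?_, _, hp.trans ?_⟩
  · rw [Ne, map_eq_zero_iff _ (IsFractionRing.injective (𝓞 K) K)]
    exact nonZeroDivisors.ne_zero ha
  · ext i
    rw [Polynomial.coeff_C_mul, Polynomial.coeff_smul, Algebra.smul_def]

/-- Numerator and denominator are each cleared by a constant from 𝓞_K. This admits 𝓞_K[s] as the
ring A in `IsLift.exists_integral_iterate`. -/
theorem isFractionRing_integersToRatFunc :
    letI := (integersToRatFunc K).toAlgebra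
    IsFractionRing (Polynomial (𝓞 K)) (RatFunc K) := by
  let := (integersToRatFunc K).toAlgebra
  have hinj : Function.Injective (algebraMap (Polynomial (𝓞 K)) (RatFunc K)) :=
    integersToRatFunc_injective K
  have := (faithfulSMul_iff_algebraMap_injective (Polynomial (𝓞 K)) (RatFunc K)).mpr hinj
  refine IsFractionRing.of_field _ _ fun z => ?_
  obtain ⟨a, ha, p, hp⟩ := exists_integers_map_eq_C_mul z.num
  obtain ⟨b, hb, q, hq⟩ := exists_integers_map_eq_C_mul z.denom
  refine ⟨Polynomial.C b * p, Polynomial.C a * q, ?_⟩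
  change z = integersToRatFunc K _ / integersToRatFunc K _
  have hC : ∀ {x : K}, x ≠ 0 → algebraMap (Polynomial K) (RatFunc K) (Polynomial.C x) ≠ 0 :=
    fun hx => RatFunc.algebraMap_ne_zero (Polynomial.C_ne_zero.mpr hx)
  simp only [integersToRatFunc, RingHom.comp_apply, Polynomial.coe_mapRingHom,
    Polynomial.map_C, hp, hq, map_mul]
  have := RatFunc.algebraMap_ne_zero z.denom_ne_zero
  have := hC ha
  have := hC hb
  conv_lhs => rw [← RatFunc.num_div_denom z]
  field_simp

variable {K}

theorem evalAt_integersToRatFunc (σ : K →+* ℂ) (t : ℂ) (f : Polynomial (𝓞 K)) :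
    evalAt σ t (integersToRatFunc K f) = f.eval₂ (σ.comp (algebraMap (𝓞 K) K)) t := by
  rw [integersToRatFunc, RingHom.comp_apply, evalAt_algebraMap, Polynomial.coe_mapRingHom,
    Polynomial.eval₂_map]

variable {N d : ℕ} {F : Fin (N + 1) → MvPolynomial (Fin (N + 1)) (RatFunc K)}

theorem IsLift.exists_integers_iterate (hF : IsLift d F) (hd : 2 ≤ d) {e : ℕ}
    {Φ : MvPolynomial (Fin (N + 1)) (RatFunc K)} (hΦ : Φ.IsHomogeneous e) (hΦ0 : Φ ≠ 0) :
    ∃ R : Polynomial (𝓞 K), R ≠ 0 ∧ ∃ (E : ℕ → ℕ) (c : ℕ),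
      (∀ j, E j ≤ c * (d ^ (N + 1)) ^ j) ∧
      ∃ Q : ℕ → MvPolynomial (Fin (N + 1)) (Polynomial (𝓞 K)), ∀ j,
        MvPolynomial.map (integersToRatFunc K) (Q j)
          = C (integersToRatFunc K R ^ E j) * (pushforward F)^[j] Φ := by
  let := (integersToRatFunc K).toAlgebra
  have := isFractionRing_integersToRatFunc K
  exact hF.exists_integral_iterate (A := Polynomial (𝓞 K)) hd hΦ hΦ0

theorem map_eval₂RingHom_eq (σ : K →+* ℂ) {t : ℂ} {n : ℕ}
    {Φ : MvPolynomial (Fin n) (RatFunc K)} (hΦ : CoeffsRegularAt σ t Φ)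
    {R : Polynomial (𝓞 K)} {E : ℕ} {Q : MvPolynomial (Fin n) (Polynomial (𝓞 K))}
    (hQ : MvPolynomial.map (integersToRatFunc K) Q = C (integersToRatFunc K R ^ E) * Φ) :
    MvPolynomial.map (Polynomial.eval₂RingHom (σ.comp (algebraMap (𝓞 K) K)) t) Q
      = C (evalAt σ t (integersToRatFunc K R) ^ E) * specialize σ t Φ := by
  ext b
  have hR : integersToRatFunc K R ∈ regularAt σ t := by
    rw [mem_regularAt]; simp [integersToRatFunc]
  have h1 := congrArg (coeff b) hQ
  rw [coeff_map, coeff_C_mul] at h1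
  rw [coeff_map, coeff_C_mul, coeff_specialize]
  change (coeff b Q).eval₂ _ t = _
  rw [← evalAt_integersToRatFunc, h1]
  have := map_mul (evalHom σ t) (⟨_, hR⟩ ^ E) ⟨_, hΦ b⟩
  rwa [map_pow] at this

/-- The size of the specializations of the first few iterates. -/
theorem IsLift.exists_eventually_abs_log_sub_mul_le (hF : IsLift d F) (hd : 2 ≤ d)
    (σ : K →+* ℂ) {e : ℕ} {Φ : MvPolynomial (Fin (N + 1)) (RatFunc K)} (hΦ : Φ.IsHomogeneous e)
    (hΦ0 : Φ ≠ 0) :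
    ∃ C : ℝ, 1 ≤ C ∧ ∀ᶠ t in cobounded ℂ, ∀ j, C * ((d : ℝ) ^ (N + 1)) ^ j ≤ Real.log ‖t‖ →
      |Real.log (coeffNorm absComplex (specialize σ t ((pushforward F)^[j] Φ)))
        - Real.log (coeffNorm (absInfty K) ((pushforward F)^[j] Φ)) * Real.log ‖t‖|
        ≤ C * ((d : ℝ) ^ (N + 1)) ^ j := by
  have hd1 : 1 ≤ d := by omega
  have hd' : (1 : ℝ) ≤ d := by exact_mod_cast hd1
  have hne := hF.iterate_pushforward_ne_zero hd1 hΦ0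
  obtain ⟨R, hR, E, c, hE, Q, hQ⟩ := hF.exists_integers_iterate hd hΦ hΦ0
  set δ : ℝ := (d : ℝ) ^ (N + 1) with hδ
  have hδ1 : 1 ≤ δ := one_le_pow₀ hd'
  have hE' : ∀ j, (E j : ℝ) ≤ c * δ ^ j := fun j => by
    rw [hδ]; exact_mod_cast hE j
  set r := integersToRatFunc K R with hr
  have hr0 : r ≠ 0 := by
    rw [hr, Ne, map_eq_zero_iff _ (integersToRatFunc_injective K)]; exact hR
  choose C hC hiter using fun τ : K →+* ℂ => hF.exists_eventually_iterate hd τ hΦ hΦ0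
  choose c₀ h₀ using fun τ : K →+* ℂ =>
    exists_eventually_abs_log_coeffNorm_specialize_sub_le τ hΦ0
  choose c₁ h₁ using fun τ : K →+* ℂ => exists_eventually_abs_log_norm_evalAt_sub_le τ hr0
  -- K has finitely many embeddings, so one radius works for all of them.
  obtain ⟨R₀, -, hR₀⟩ := hasBasis_cobounded_norm.eventually_iff.mp
    ((((eventually_all.mpr hiter).and (eventually_all.mpr h₀)).and (eventually_all.mpr h₁)).and
      (tendsto_log_norm_cobounded.eventually_ge_atTop 1))
  -- the circle on which all conjugates are bounded
  set ϱ := max R₀ 1 with hϱ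
  have hϱ1 : 1 ≤ ϱ := le_max_right _ _
  set s : ℝ := (√d)⁻¹ with hs
  have hsq := five_quarters_le_sqrt hd
  have hs0 : 0 ≤ s := by positivity
  have hs1 : s < 1 := inv_lt_one_of_one_lt₀ (by linarith)
  set L₀ := Real.log ϱ with hL₀
  have hL₀0 : 0 ≤ L₀ := Real.log_nonneg hϱ1
  set n₀ := Real.log (coeffNorm (absInfty K) Φ) with hn₀
  -- On the circle, the first summand bounds the contribution of R^(E_j) and the second that of the
  -- iterate, both per unit of δ^j.
  set B₁ : (K →+* ℂ) → ℝ := fun τ => c * (|c₁ τ| + |(r.intDegree : ℝ)| * L₀) +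
    (|c₀ τ| + |n₀| * L₀ + C τ * L₀ / (1 - s)) with hB₁
  have hB₁0 : ∀ τ, 0 ≤ B₁ τ := fun τ => by
    have h1 : 0 < 1 - s := by linarith
    have := hC τ
    positivity
  set B := ∑ τ, B₁ τ with hB
  have hB0 : 0 ≤ B := Finset.sum_nonneg fun τ _ => hB₁0 τ
  have hDle : ((genericFibre F).ncard : ℝ) ≤ δ := by
    rw [hδ]; exact_mod_cast hF.ncard_genericFibre_le hd1
  have hcircle : ∀ j (τ : K →+* ℂ) (t : ℂ), ‖t‖ = ϱ → ∀ b,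
      ‖(coeff b (Q j)).eval₂ (τ.comp (algebraMap (𝓞 K) K)) t‖ ≤ Real.exp (B * δ ^ j) := by
    intro j τ t ht b
    obtain ⟨⟨⟨hit, hz⟩, ho⟩, hL⟩ := hR₀ (show R₀ ≤ ‖t‖ by rw [ht]; exact le_max_left _ _)
    have hb := congrArg (coeff b) (map_eval₂RingHom_eq τ (hit τ j).1 (hQ j))
    rw [coeff_map, coeff_C_mul] at hb
    change (coeff b (Q j)).eval₂ _ t = _ at hb
    rw [hb, norm_mul, norm_pow]
    rw [ht, ← hL₀] at hL
    have hLt : Real.log ‖t‖ = L₀ := by rw [ht]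
    have hrec := abs_le_mul_pow_of_recursion
      (a := fun j => Real.log (coeffNorm absComplex (specialize τ t ((pushforward F)^[j] Φ))))
      (Nat.cast_nonneg _) hDle hδ1 hs0 hs1 (M := C τ * L₀) (mul_nonneg (hC τ) hL₀0)
      (fun j => by rw [← hLt]; exact (hit τ j).2.2.2) j
    have hz' : |Real.log (coeffNorm absComplex (specialize τ t Φ))| ≤ |c₀ τ| + |n₀| * L₀ := by
      have h1 := (hz τ).2
      rw [hLt] at h1
      have h2 : |n₀ * L₀| = |n₀| * L₀ := by rw [abs_mul, abs_of_nonneg hL₀0]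
      calc _ = |(Real.log (coeffNorm absComplex (specialize τ t Φ)) - n₀ * L₀) + n₀ * L₀| := by
            congr 1; ring
        _ ≤ |c₀ τ| + |n₀| * L₀ := (abs_add_le _ _).trans
            (add_le_add (h1.trans (le_abs_self _)) h2.le)
    have ho' : ‖evalAt τ t r‖ ≤ Real.exp (|c₁ τ| + |(r.intDegree : ℝ)| * L₀) := by
      rw [← Real.log_le_iff_le_exp (norm_pos_iff.mpr (ho τ).1)]
      have h1 := (abs_le.mp (ho τ).2).2
      rw [hLt] at h1
      have h2 := mul_le_mul_of_nonneg_right (le_abs_self (r.intDegree : ℝ)) hL₀0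
      linarith [le_abs_self (c₁ τ)]
    have hpow : ‖evalAt τ t r‖ ^ E j
        ≤ Real.exp (c * (|c₁ τ| + |(r.intDegree : ℝ)| * L₀) * δ ^ j) := by
      calc _ ≤ Real.exp (|c₁ τ| + |(r.intDegree : ℝ)| * L₀) ^ E j := by gcongr
        _ = Real.exp (E j * (|c₁ τ| + |(r.intDegree : ℝ)| * L₀)) := (Real.exp_nat_mul _ _).symm
        _ ≤ _ := by
            refine Real.exp_le_exp.mpr ?_
            calc _ ≤ c * δ ^ j * (|c₁ τ| + |(r.intDegree : ℝ)| * L₀) := by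
                  gcongr; exact hE' j
              _ = _ := by ring
    have hco : ‖coeff b (specialize τ t ((pushforward F)^[j] Φ))‖
        ≤ Real.exp ((|c₀ τ| + |n₀| * L₀ + C τ * L₀ / (1 - s)) * δ ^ j) := by
      refine (norm_coeff_le_coeffNorm _ b).trans ?_
      rw [← Real.log_le_iff_le_exp (coeffNorm_pos_iff.mpr (hit τ j).2.2.1)]
      refine (le_abs_self _).trans (hrec.trans ?_)
      gcongr
      exact hz'
    calc _ ≤ Real.exp (c * (|c₁ τ| + |(r.intDegree : ℝ)| * L₀) * δ ^ j) *
          Real.exp ((|c₀ τ| + |n₀| * L₀ + C τ * L₀ / (1 - s)) * δ ^ j) := by gcongr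
      _ = Real.exp (B₁ τ * δ ^ j) := by rw [← Real.exp_add, hB₁]; congr 1; ring
      _ ≤ _ := by
          refine Real.exp_le_exp.mpr ?_
          gcongr
          exact Finset.single_le_sum (fun τ _ => hB₁0 τ) (Finset.mem_univ τ)
  set κ : ℝ := (Module.finrank ℚ K : ℝ) with hκ
  have hκ0 : 0 ≤ κ := Nat.cast_nonneg _
  have hQ0 : ∀ j, Q j ≠ 0 := fun j h0 => by
    have := hQ j
    rw [h0, map_zero] at this
    exact mul_ne_zero (C_ne_zero.mpr (pow_ne_zero _ hr0)) (hne j) this.symm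
  have hC'1 : 1 ≤ (κ + 2) * (B + 2) + c * |c₁ σ| := by
    have h1 : 0 ≤ (c : ℝ) * |c₁ σ| := by positivity
    have h2 := mul_nonneg hκ0 hB0
    linarith
  refine ⟨(κ + 2) * (B + 2) + c * |c₁ σ|, hC'1, ?_⟩
  rw [hasBasis_cobounded_norm.eventually_iff]
  refine ⟨R₀, trivial, fun t ht j hj => ?_⟩
  have hδj : 1 ≤ δ ^ j := one_le_pow₀ hδ1
  -- M, the degree in s of the integral form, may depend on j; the error does so only through B δ^j.
  obtain ⟨M, hM⟩ := exists_abs_log_coeffNorm_map_sub_le σ (hQ0 j) hϱ1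
    (mul_nonneg hB0 (by positivity)) (hcircle j)
  set C' := (κ + 2) * (B + 2) + c * |c₁ σ| with hC'
  have hbase : (κ + 2) * (B * δ ^ j + 2) ≤ (κ + 2) * (B + 2) * δ ^ j := by
    rw [mul_assoc]
    gcongr
    linarith
  have hcc : 0 ≤ (c : ℝ) * |c₁ σ| * δ ^ j := by positivity
  have hlarge : ∀ u : ℂ, R₀ ≤ ‖u‖ → C' * δ ^ j ≤ Real.log ‖u‖ →
      |Real.log (coeffNorm absComplex (specialize σ u ((pushforward F)^[j] Φ)))
        - (M - E j * r.intDegree) * Real.log ‖u‖| ≤ C' * δ ^ j := by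
    intro u hu huL
    obtain ⟨⟨⟨hit, -⟩, ho⟩, hL⟩ := hR₀ hu
    have h1 := hM u (by rw [hC'] at huL; linarith)
    rw [map_eval₂RingHom_eq σ (hit σ j).1 (hQ j), coeffNorm_C_mul, absComplex_apply, norm_pow,
      Real.log_mul (pow_ne_zero _ (norm_ne_zero_iff.mpr (ho σ).1))
        (coeffNorm_pos_iff.mpr (hit σ j).2.2.1).ne', Real.log_pow] at h1
    have h2 : |(E j : ℝ) * (Real.log ‖evalAt σ u r‖ - r.intDegree * Real.log ‖u‖)|
        ≤ c * |c₁ σ| * δ ^ j := by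
      rw [abs_mul, Nat.abs_cast]
      calc _ ≤ c * δ ^ j * |c₁ σ| :=
            mul_le_mul (hE' j) ((ho σ).2.trans (le_abs_self _)) (abs_nonneg _) (by positivity)
        _ = _ := by ring
    rw [abs_le] at h1 h2 ⊢
    constructor <;> linarith [h1.1, h1.2, h2.1, h2.2]
  obtain ⟨c₂, h₂⟩ := exists_eventually_abs_log_coeffNorm_specialize_sub_le σ (hne j)
  have hev : ∀ᶠ u in cobounded ℂ,
      |Real.log (coeffNorm absComplex (specialize σ u ((pushforward F)^[j] Φ)))
        - (M - E j * r.intDegree) * Real.log ‖u‖| ≤ C' * δ ^ j := by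
    filter_upwards [hasBasis_cobounded_norm.mem_of_mem (i := R₀) trivial,
      tendsto_log_norm_cobounded.eventually_ge_atTop (C' * δ ^ j)] with u h1 h2
    exact hlarge u h1 h2
  -- Two descriptions of the same growth as u tends to infinity must have the same slope; this
  -- identifies M after removal of R^(E_j).
  have heq : Real.log (coeffNorm (absInfty K) ((pushforward F)^[j] Φ))
      = M - E j * r.intDegree := by
    refine le_antisymm (sub_nonpos.mp ?_) (sub_nonpos.mp ?_) <;>
    · refine le_of_eventually_mul_log_norm_le (B := c₂ + C' * δ ^ j) ?_
      filter_upwards [hev, h₂] with u hu hu'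
      have h3 := abs_le.mp hu
      have h4 := abs_le.mp hu'.2
      linarith [h3.1, h3.2, h4.1, h4.2]
  rw [heq]
  exact hlarge t ht hj

end Arithmetic

end EscapeRate
end

noncomputable section
namespace EscapeRate
open MvPolynomial Bornology

/-! ### Escape rates and their asymptotics -/

section Limits

theorem escapeSeq_eq {k : Type*} [Field k] (v : AbsoluteValue k ℝ) {N : ℕ} (d : ℕ)
    (F : Fin (N + 1) → MvPolynomial (Fin (N + 1)) k) (Φ : MvPolynomial (Fin (N + 1)) k) :
    escapeSeq v d F Φ
      = fun j => Real.log (coeffNorm v ((pushforward F)^[j] Φ)) / ((d : ℝ) ^ (N + 1)) ^ j := by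
  funext j
  rw [escapeSeq, ← pow_mul, mul_comm j]

variable {K : Type*} [Field K] [NumberField K] {N d : ℕ}
  {F : Fin (N + 1) → MvPolynomial (Fin (N + 1)) (RatFunc K)}

/-- The two recursions give the limits with rates, and the uniform comparison links them through
`abs_sub_mul_le_rpow`. Every exponent from 1 - 1/(2N+2) upwards is allowed. -/
theorem IsLift.exists_escapeRate_asymptotics (hF : IsLift d F) (hd : 2 ≤ d) (σ : K →+* ℂ) {e : ℕ}
    {Φ : MvPolynomial (Fin (N + 1)) (RatFunc K)} (hΦ : Φ.IsHomogeneous e) (hΦ0 : Φ ≠ 0) {p : ℝ}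
    (hp : 1 - 1 / (2 * ((N + 1 : ℕ) : ℝ)) ≤ p) :
    ∃ β C : ℝ, Tendsto (escapeSeq (absInfty K) d F Φ) atTop (𝓝 β) ∧
      ∀ᶠ t in cobounded ℂ, ∃ α : ℝ,
        Tendsto (escapeSeq absComplex d (fun i => specialize σ t (F i)) (specialize σ t Φ)) atTop
          (𝓝 α) ∧ |α - β * Real.log ‖t‖| ≤ C * Real.log ‖t‖ ^ p := by
  set δ : ℝ := (d : ℝ) ^ (N + 1) with hδ
  have hd' : (1 : ℝ) ≤ d := by exact_mod_cast (show 1 ≤ d by omega)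
  have hδ1 : 1 ≤ δ := one_le_pow₀ hd'
  set s : ℝ := (√d)⁻¹ with hs
  have hsq := five_quarters_le_sqrt hd
  have hs0 : 0 ≤ s := by positivity
  have hs1 : s < 1 := inv_lt_one_of_one_lt₀ (by linarith)
  have hs1' : 0 < 1 - s := by linarith
  have hDle : ((genericFibre F).ncard : ℝ) ≤ δ := by
    rw [hδ]; exact_mod_cast hF.ncard_genericFibre_le (show 1 ≤ d by omega)
  obtain ⟨Cb, hCb, hb⟩ := hF.exists_abs_log_absInfty_iterate_sub_le hd σ hΦ hΦ0
  obtain ⟨Ca, hCa, ha⟩ := hF.exists_eventually_iterate hd σ hΦ hΦ0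
  obtain ⟨C, hC, hclose⟩ := hF.exists_eventually_abs_log_sub_mul_le hd σ hΦ hΦ0
  obtain ⟨β, hβ, hβ1, hβ2⟩ := exists_tendsto_of_recursion
    (a := fun j => Real.log (coeffNorm (absInfty K) ((pushforward F)^[j] Φ)))
    (Nat.cast_nonneg _) hDle hδ1 hs0 hs1 hCb hb
  set M := (Ca + Cb) / (1 - s) with hM
  have hM0 : 0 ≤ M := by positivity
  refine ⟨β, 2 * M * √d * C + C, by rw [escapeSeq_eq]; exact hβ, ?_⟩
  filter_upwards [ha, hclose, tendsto_log_norm_cobounded.eventually_ge_atTop C] with t ht htc hL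
  set L := Real.log ‖t‖ with hLdef
  have hL0 : 0 ≤ L := by linarith
  obtain ⟨α, hα, hα1, hα2⟩ := exists_tendsto_of_recursion
    (a := fun j => Real.log (coeffNorm absComplex (specialize σ t ((pushforward F)^[j] Φ))))
    (Nat.cast_nonneg _) hDle hδ1 hs0 hs1 (mul_nonneg hCa hL0) fun j => (ht j).2.2.2
  refine ⟨α, ?_, ?_⟩
  · rw [escapeSeq_eq]
    simp only [fun j => (ht j).2.1] at hα
    exact hα
  rcases hDle.eq_or_lt with heq | hlt
  · refine abs_sub_mul_le_rpow (n := N + 1) hd (by omega) hC hL hM0 hp (fun j hj => ?_)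
      (fun j => (hα1 heq j).trans ?_) (fun j => (hβ1 heq j).trans ?_)
    · have h1 := htc j hj
      rw [div_mul_eq_mul_div, ← sub_div, abs_div, abs_of_pos (show 0 < δ ^ j by positivity),
        div_le_iff₀ (by positivity)]
      exact h1
    · rw [hM]
      calc Ca * L * s ^ j / (1 - s) = Ca / (1 - s) * L * s ^ j := by ring
        _ ≤ (Ca + Cb) / (1 - s) * L * s ^ j := by gcongr; linarith
    · rw [hM]
      calc Cb * s ^ j / (1 - s) = Cb / (1 - s) * s ^ j := by ring
        _ ≤ (Ca + Cb) / (1 - s) * s ^ j := by gcongr; linarith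
  -- With fewer than δ points in the fibre both escape rates would be zero.
  · rw [hα2 hlt, hβ2 hlt]
    simp only [zero_mul, sub_self, abs_zero]
    positivity

end Limits

end EscapeRate
end

theorem mainTheorem2 {K : Type*} [Field K] [NumberField K] (σ : K →+* ℂ)
    (N : ℕ) (hN : 1 ≤ N) (d : ℕ) (hd : 2 ≤ d)
    (F : Fin (N + 1) → MvPolynomial (Fin (N + 1)) (RatFunc K)) (hF : EscapeRate.IsLift d F)
    (e : ℕ) (Φ : MvPolynomial (Fin (N + 1)) (RatFunc K)) (hΦ : Φ.IsHomogeneous e)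
    (hΦ0 : Φ ≠ 0) :
    -- the limit that defines the escape rate on the generic fibre exists
    Tendsto (EscapeRate.escapeSeq (EscapeRate.absInfty K) d F Φ) atTop
      (𝓝 (EscapeRate.escapeRate (EscapeRate.absInfty K) d F Φ)) ∧
    -- so do the limits for the specialized maps, once `|t|` is large
    (∀ᶠ t in Bornology.cobounded ℂ,
      Tendsto
        (EscapeRate.escapeSeq EscapeRate.absComplex d
          (fun i => EscapeRate.specialize σ t (F i)) (EscapeRate.specialize σ t Φ)) atTop
        (𝓝 (EscapeRate.escapeRate EscapeRate.absComplex d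
          (fun i => EscapeRate.specialize σ t (F i)) (EscapeRate.specialize σ t Φ)))) ∧
    -- the asymptotic formula
    (fun t : ℂ =>
        EscapeRate.escapeRate EscapeRate.absComplex d
            (fun i => EscapeRate.specialize σ t (F i)) (EscapeRate.specialize σ t Φ)
          - EscapeRate.escapeRate (EscapeRate.absInfty K) d F Φ * Real.posLog ‖t‖)
      =O[Bornology.cobounded ℂ]
      (fun t : ℂ => (Real.posLog ‖t‖) ^ ((3 * (N : ℝ) + 3) / (3 * (N : ℝ) + 4))) := by
  -- The exponent obtained is (2N+1)/(2N+2); cross multiplication gives 6N² + 11N + 4 ≤ 6N² + 12N +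
  -- 6.
  have hp : 1 - 1 / (2 * ((N + 1 : ℕ) : ℝ)) ≤ (3 * (N : ℝ) + 3) / (3 * (N : ℝ) + 4) := by
    have hN0 : (0 : ℝ) ≤ N := N.cast_nonneg
    push_cast
    rw [one_sub_div (by positivity), div_le_div_iff₀ (by positivity) (by positivity)]
    nlinarith
  obtain ⟨β, C, hβ, hev⟩ := hF.exists_escapeRate_asymptotics hd σ hΦ hΦ0 hp
  have hβ' : EscapeRate.escapeRate (EscapeRate.absInfty K) d F Φ = β := hβ.limUnder_eq
  refine ⟨by rw [hβ']; exact hβ, ?_, ?_⟩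
  · filter_upwards [hev] with t ⟨α, hα, _⟩
    rw [show EscapeRate.escapeRate _ _ _ _ = α from hα.limUnder_eq]
    exact hα
  · refine Asymptotics.IsBigO.of_bound C ?_
    filter_upwards [hev, EscapeRate.tendsto_log_norm_cobounded.eventually_ge_atTop 0]
      with t ⟨α, hα, hαβ⟩ hL
    rw [show EscapeRate.escapeRate EscapeRate.absComplex _ _ _ = α from hα.limUnder_eq, hβ',
      Real.posLog, max_eq_right hL, Real.norm_eq_abs, Real.norm_of_nonneg (by positivity)]
    exact hαβ
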